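/- **Setting.** Let $n=2k\ge 2$ and $\ell\ge 1$ be integers. Let $L\subset\mathbb R^n$ be a lattice (a discrete subgroup of full rank), with dual $L^\#=\{y: x\cdot y\in\mathbb Z \text{ for all } x\in L\}$. Suppose that $L$ is even ($x\cdot x\in 2\mathbb Z$ for all $x\in L$) and $\ell$-modular, i.e. $L=\sigma(L^\#)$ for a linear map $\sigma$ with $\sigma(v)\cdot\sigma(w)=\ell\, v\cdot w$ for all $v,w\in\mathbb R^n$. For $s\ge 0$ let $L(s)=\{v\in L:\|v\|^2=s\}$, and put $a_m=|L(2m)|$, so that $\Theta_L=\sum_{m\ge 0}a_mq^m$ is the theta series of $L$. Suppose that every nonempty shell $L(r^2)$, $r>0$, is a spherical $2$-design. **Cusp forms.** Let $S_{n/2+4}(\Gamma_0(\ell),\chi)$ be the space of cusp forms of weight $n/2+4$ for $\Gamma_0(\ell)$ with character $\chi\begin{pmatrix}a&b\\c&d\end{pmatrix}=\left(\frac{(-\ell)^{k}}{d}\right)$ (Kronecker symbol). Suppose that it has a basis $C_1,\dots,C_e$ in reduced row-echelon form: with $C_i(\tau)=\sum_{m}c_{i,m}q^m$, $q=e^{2\pi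 i\tau}$, one has $c_{i,i}=1$ and $c_{i,m}=0$ for all $m\in\{1,\dots,e\}$ with $m\ne i$. **Shell forms.** Let $V$ be the space of real symmetric $n\times n$ matrices of trace $0$, with inner product $\langle G,H\rangle=\operatorname{Tr}(GH)$, and write $H[x]=x^{\mathsf T}Hx$. Eigenvalues and eigenvectors of a quadratic form on $V$ are those of the self-adjoint operator which represents its symmetric bilinear form with respect to $\langle\cdot,\cdot\rangle$. Suppose that the forms $Q_{2i}[H]=\sum_{x\in L(2i)}H[x]^2$ $(1\le i\le e)$ are simultaneously diagonalizable on $V$, with common eigenspaces $E_1,\dots,E_s$: $V=E_1\oplus\dots\oplus E_s$, each $E_j\ne 0$, and $E_j$ is the space of all $H\in V$ that lie, for every $i$, in the eigenspace of $Q_{2i}$ for an eigenvalue $\lambda_{i,j}$. **Hessian.** For $\alpha>0$ and a lattice $M$ let $\mathcal E(\alpha,M)=\sum_{x\in M\setminus\{0\}}e^{-\alpha\|x\|^2}$. Let $\nabla^2\mathcal E(\alpha,L)$ be the quadratic form on $V$ given by the second-order Taylor term $$\nabla^2\mathcal E(\alpha,L)[H]=\tfrac12\,\frac{d^2}{dt^2}\Big|_{t=0}\mathcal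 E\big(\alpha,e^{tH/2}L\big).$$ **Theorem.** For every $\alpha>0$ the following hold. 1. For every $H\in V$, $$\nabla^2\mathcal E(\alpha,L)[H]=\alpha\sum_{x\in L\setminus\{0\}}e^{-\alpha\|x\|^2}\left(\tfrac{\alpha}{2}H[x]^2-\tfrac12H^2[x]\right).$$ 2. For $1\le j\le s$ the two series in $$\mu_j=\frac1{n(n+2)}\sum_{m=1}^\infty\left(\sum_{i=1}^e c_{i,m}\frac{\alpha^2}{2}\big(\lambda_{i,j}\,n(n+2)-8i^2a_i\big)\right)e^{-2\alpha m}+\frac1{n(n+2)}\sum_{m=1}^\infty a_m\,2\alpha m\left(2\alpha m-\left(\tfrac n2+1\right)\right)e^{-2\alpha m}$$ converge absolutely and $\mu_j$ is real. Every nonzero $H\in E_j$ is an eigenvector of $\nabla^2\mathcal E(\alpha,L)$ with eigenvalue $\mu_j$, and $\{\mu_1,\dots,\mu_s\}$ is the set of all eigenvalues of $\nabla^2\mathcal E(\alpha,L)$. -/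

import Mathlib

open scoped UpperHalfPlane ModularForm Manifold MatrixGroups

noncomputable section

namespace ModularLattice

/-! ### Lattices -/

/-- `ℝⁿ` with the standard inner product. -/
abbrev Euc (n : ℕ) : Type := EuclideanSpace ℝ (Fin n)

/-- The dual lattice `L^# = {y ∈ ℝⁿ : x ⬝ y ∈ ℤ for all x ∈ L}`. -/
def dualLattice {n : ℕ} (L : Submodule ℤ (Euc n)) : Submodule ℤ (Euc n) :=
  LinearMap.BilinForm.dualSubmodule (innerₗ (Euc n)) L

/-- Every lattice vector has even integral squared norm. -/
def IsEvenLattice {n : ℕ} (L : Submodule ℤ (Euc n)) : Prop :=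
  ∀ x ∈ L, ∃ z : ℤ, inner ℝ x x = 2 * (z : ℝ)

/-- `σ v ⬝ σ w = ℓ (v ⬝ w)` for all `v`, `w`. -/
def IsSimilarity {n : ℕ} (ℓ : ℝ) (σ : Euc n →ₗ[ℝ] Euc n) : Prop :=
  ∀ v w : Euc n, inner ℝ (σ v) (σ w) = ℓ * inner ℝ v w

/-- `L = σ(L^#)` for some similarity `σ` of norm `ℓ`. -/
def IsModularLattice {n : ℕ} (ℓ : ℕ) (L : Submodule ℤ (Euc n)) : Prop :=
  ∃ σ : Euc n →ₗ[ℝ] Euc n, IsSimilarity (ℓ : ℝ) σ ∧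
    L = (dualLattice L).map (σ.restrictScalars ℤ)

/-- The shell `L(s) = {v ∈ L : ‖v‖² = s}`. -/
def shell {n : ℕ} (L : Submodule ℤ (Euc n)) (s : ℝ) : Set (Euc n) :=
  {v | v ∈ L ∧ ‖v‖ ^ 2 = s}

/-- The theta coefficient `a_m = |L(2m)|` of an even lattice. -/
def thetaCoeff {n : ℕ} (L : Submodule ℤ (Euc n)) (m : ℕ) : ℕ :=
  (shell L (2 * (m : ℝ))).ncard

/-- A finite set `X` on the sphere of radius `r` is a spherical `t`-design: for every polynomial of
degree at most `t`, its mean over the sphere (with respect to the rotationally invariant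
probability measure) is its mean over `X`. -/
def IsSphericalDesign {n : ℕ} (t : ℕ) (r : ℝ) (X : Set (Euc n)) : Prop :=
  X.Finite ∧ X ⊆ Metric.sphere 0 r ∧
    ∀ p : MvPolynomial (Fin n) ℝ, p.totalDegree ≤ t →
      (⨍ u : Metric.sphere (0 : Euc n) 1,
          MvPolynomial.eval (fun j => r * (u : Euc n) j) p
            ∂(MeasureTheory.volume : MeasureTheory.Measure (Euc n)).toSphere)
        = (X.ncard : ℝ)⁻¹ * ∑ᶠ x ∈ X, MvPolynomial.eval (fun j => x j) p

/-! ### Cusp forms for `Γ₀(ℓ)` with character -/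

/-- The Kronecker symbol `(a / d)`: completely multiplicative in `d`, equal to the Jacobi symbol for
odd positive `d`, with `(a / 2) = χ₈(a)`, `(a / -1) = sign a` (and `1` for `a = 0`), and
`(a / 0) = 1` exactly for `a = ±1`. -/
def kroneckerSymbol (a d : ℤ) : ℤ :=
  if d = 0 then (if a.natAbs = 1 then 1 else 0)
  else (if d < 0 ∧ a < 0 then -1 else 1) *
    ZMod.χ₈ (a : ZMod 8) ^ d.natAbs.factorization 2 *
    jacobiSym a (d.natAbs / 2 ^ d.natAbs.factorization 2)

/-- `χ(A) = ((-ℓ)^k / d)`, for `A = (a, b; c, d)`. -/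
def latticeCharacter (ℓ k : ℕ) (A : SL(2, ℤ)) : ℤ :=
  kroneckerSymbol ((-(ℓ : ℤ)) ^ k) (A 1 1)

/-- The space `S_w(Γ₀(ℓ), χ)` of cusp forms of weight `w`, where `χ` is the character
`A ↦ ((-ℓ)^k / d)`: holomorphic functions `f` on the upper half plane with
`f(Aτ) = χ(A) (cτ + d)^w f(τ)` for `A ∈ Γ₀(ℓ)`, vanishing at all cusps. -/
def cuspForms (ℓ k : ℕ) (w : ℤ) : Submodule ℂ (ℍ → ℂ) where
  carrier := {f | MDifferentiable 𝓘(ℂ) 𝓘(ℂ) f ∧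
    (∀ A ∈ CongruenceSubgroup.Gamma0 ℓ, f ∣[w] A = (latticeCharacter ℓ k A : ℂ) • f) ∧
    ∀ A : SL(2, ℤ), UpperHalfPlane.IsZeroAtImInfty (f ∣[w] A)}
  zero_mem' := by
    refine ⟨mdifferentiable_const, fun A _ => by simp, fun A => ?_⟩
    rw [SlashAction.zero_slash]
    exact Filter.zero_zeroAtFilter _
  add_mem' := by
    rintro f g ⟨hf, hf', hf''⟩ ⟨hg, hg', hg''⟩
    refine ⟨hf.add hg, fun A hA => ?_, fun A => ?_⟩
    · rw [SlashAction.add_slash, hf' A hA, hg' A hA, smul_add]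
    · rw [SlashAction.add_slash]
      exact (hf'' A).add (hg'' A)
  smul_mem' := by
    rintro c f ⟨hf, hf', hf''⟩
    refine ⟨hf.const_smul c, fun A hA => ?_, fun A => ?_⟩
    · rw [ModularForm.SL_smul_slash, hf' A hA, smul_comm]
    · rw [ModularForm.SL_smul_slash]
      exact (hf'' A).smul c

/-- The `m`-th coefficient of the expansion `f(τ) = ∑ c_m q^m`, `q = exp(2πiτ)`. -/
def qCoeff (f : ℍ → ℂ) (m : ℕ) : ℂ :=
  (UpperHalfPlane.qExpansion 1 f).coeff m

/-- The family `C_1, …, C_e` (indexed here from `0`) is in reduced row-echelon form: `c_{i,m} = 1`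
if `m = i`, and `c_{i,m} = 0` if `m ≠ i`, `1 ≤ m ≤ e`. -/
def IsReducedRowEchelon {e : ℕ} (C : Fin e → ℍ → ℂ) : Prop :=
  ∀ i j : Fin e, qCoeff (C i) ((j : ℕ) + 1) = if i = j then 1 else 0

/-! ### Traceless symmetric matrices and the shell forms -/

/-- The space of real symmetric matrices of trace zero, with the inner product `Tr(GH)`. -/
def tracelessSymm (n : ℕ) : Submodule ℝ (Matrix (Fin n) (Fin n) ℝ) where
  carrier := {H | H.IsSymm ∧ H.trace = 0}
  zero_mem' := ⟨Matrix.isSymm_zero, Matrix.trace_zero _ _⟩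
  add_mem' := by
    rintro G H ⟨hG, hG'⟩ ⟨hH, hH'⟩
    exact ⟨hG.add hH, by rw [Matrix.trace_add, hG', hH', add_zero]⟩
  smul_mem' := by
    rintro c H ⟨hH, hH'⟩
    exact ⟨hH.smul c, by rw [Matrix.trace_smul, hH', smul_zero]⟩

/-- `H[x] = xᵀ H x`. -/
def matQuad {n : ℕ} (H : Matrix (Fin n) (Fin n) ℝ) (x : Euc n) : ℝ :=
  dotProduct x.ofLp (H.mulVec x.ofLp)

/-- The bilinear form `B(G, H) = ∑_{x ∈ L(s)} G[x] H[x]` of the shell form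
`Q_s[H] = ∑_{x ∈ L(s)} H[x]²`. -/
def shellBilin {n : ℕ} (L : Submodule ℤ (Euc n)) (s : ℝ) (G H : tracelessSymm n) : ℝ :=
  ∑ᶠ x ∈ shell L s, matQuad (G : Matrix (Fin n) (Fin n) ℝ) x * matQuad (H : Matrix _ _ ℝ) x

/-- `H` lies in the eigenspace for `μ` of a bilinear form `B` on the traceless symmetric matrices:
`B(G, H) = μ Tr(GH)` for all `G`, i.e. `T H = μ H` where `T` is the operator (in an orthonormal
basis, the Gram matrix) that represents `B`. -/
def InEigenspace {n : ℕ} (B : tracelessSymm n → tracelessSymm n → ℝ) (μ : ℝ)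
    (H : tracelessSymm n) : Prop :=
  ∀ G : tracelessSymm n, B G H = μ * ((G : Matrix (Fin n) (Fin n) ℝ) * H).trace

/-- `μ` is an eigenvalue of `B`. -/
def IsEigenvalue {n : ℕ} (B : tracelessSymm n → tracelessSymm n → ℝ) (μ : ℝ) : Prop :=
  ∃ H : tracelessSymm n, H ≠ 0 ∧ InEigenspace B μ H

/-- `Q_2, …, Q_{2e}` are simultaneously diagonalizable with common eigenspaces `E_1, …, E_s` and
associated eigenvalues `lam i k` of `Q_{2i}` on `E_k` (both indices start from `0` here). -/
structure IsSimultaneousDiagonalization {n : ℕ} (L : Submodule ℤ (Euc n)) {e s : ℕ}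
    (E : Fin s → Submodule ℝ (tracelessSymm n)) (lam : Fin e → Fin s → ℝ) : Prop where
  isInternal : DirectSum.IsInternal E
  ne_bot : ∀ k, E k ≠ ⊥
  mem_iff : ∀ k H, H ∈ E k ↔
    ∀ i : Fin e, InEigenspace (shellBilin L (2 * ((i : ℕ) + 1))) (lam i k) H

/-! ### Gaussian energy and its Hessian -/

/-- The Gaussian energy `∑_{x ∈ L ∖ {0}} exp(-α ‖x‖²)`. -/
def energy {n : ℕ} (α : ℝ) (L : Submodule ℤ (Euc n)) : ℝ :=
  ∑' x : {x : Euc n // x ∈ L ∧ x ≠ 0}, Real.exp (-α * ‖(x : Euc n)‖ ^ 2)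

/-- The lattice `exp(H/2) L`, of the same point density as `L` if `Tr H = 0`, whose quadratic form
is `x ↦ exp(H)[x]` on `L`. -/
def deform {n : ℕ} (L : Submodule ℤ (Euc n)) (H : Matrix (Fin n) (Fin n) ℝ) :
    Submodule ℤ (Euc n) :=
  L.map ((Matrix.toEuclideanLin (NormedSpace.exp ((1 / 2 : ℝ) • H))).restrictScalars ℤ)

/-- The Hessian `∇²E(α, L)` as a quadratic form on the tangent space of traceless symmetric
matrices: `∇²E(α, L)[H]` is the second-order term, i.e. the coefficient of `t²`, in the Taylor
expansion at `t = 0` of `E(α, exp(tH/2) L)`. -/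
def hessian {n : ℕ} (α : ℝ) (L : Submodule ℤ (Euc n)) (H : tracelessSymm n) : ℝ :=
  (1 / 2) * iteratedDeriv 2 (fun t : ℝ => energy α (deform L (t • (H : Matrix _ _ ℝ)))) 0

/-- The symmetric bilinear form of the Hessian, by polarization. -/
def hessianBilin {n : ℕ} (α : ℝ) (L : Submodule ℤ (Euc n)) (G H : tracelessSymm n) : ℝ :=
  (1 / 2) * QuadraticMap.polar (hessian α L) G H

/-! ### The series of the eigenvalue formula -/

/-- The `m`-th term
`(∑_{i=1}^e c_{i,m} (α²/2) (λ_i n(n+2) - 8 i² a_i)) exp(-2αm)`,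
where `c_{i,m}` are the coefficients of the cusp forms `C_i` and `a_i = |L(2i)|`. -/
def cuspTerm {n e : ℕ} (α : ℝ) (L : Submodule ℤ (Euc n)) (C : Fin e → ℍ → ℂ) (lam : Fin e → ℝ)
    (m : ℕ) : ℂ :=
  (∑ i : Fin e, qCoeff (C i) m *
    ((α ^ 2 / 2 * (lam i * n * (n + 2) -
      8 * ((i : ℕ) + 1) ^ 2 * thetaCoeff L ((i : ℕ) + 1)) : ℝ) : ℂ)) *
    (Real.exp (-2 * α * m) : ℂ)

/-- The `m`-th term `a_m 2αm (2αm - (n/2 + 1)) exp(-2αm)`. -/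
def thetaTerm {n : ℕ} (α : ℝ) (L : Submodule ℤ (Euc n)) (m : ℕ) : ℝ :=
  thetaCoeff L m * (2 * α * m) * (2 * α * m - ((n : ℝ) / 2 + 1)) * Real.exp (-2 * α * m)

end ModularLattice

end

/-! In an orthonormal eigenbasis of H with eigenvalues c_i one has ‖exp(tH/2)x‖² = ∑ e^{t c_i} x_i²,
so the energy can be differentiated twice termwise at t = 0; this is the first claim
(`hasSum_hessian`). Grouped by shells, the term H²[x] is controlled by the 2-design property, since
∑ x_i x_j over L(2m) is (2m a_m/n) δ_ij. What remains is Q_{2m}[H] for every m, and modularity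
reduces these to the first e of them.

For traceless H, the square H[x]² minus its non-harmonic part is a harmonic quartic (`harmonicSq`).
Its sum over L(2m) is, again by the design property, the deviation Q_{2m}[H] − 8m² a_m
Tr(H²)/(n(n+2)). These deviations are Fourier coefficients of a theta series with a harmonic quartic
factor, which is a cusp form of weight n/2+4. In the reduced echelon basis the m-th deviation is
therefore ∑ c_{i,m} times the i-th one (`shellDeviation_eq_sum`). Hence the Hessian is a linear
combination of Q_2, …, Q_{2e} and Tr(H²). The common eigenspaces consist of eigenvectors of it, and
collecting constants gives μ_j.

Cuspidality is only needed for the factor (a·x + i b·x)⁴ with a + ib isotropic, because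
`sum_harmonic_quartic` writes the harmonic quartic in terms of Re(x_i + √-1 x_j)⁴. For such factors,
differentiation along a + ib gives the Fourier transform inductively (`fourier_polyGauss`). Poisson
summation, used twice, gives the transformation under (a, b; c, d) with ℓ | c and d > 0, up to a
Gauss sum modulo d (`isoTheta_transform`). That sum is evaluated for d = 1 and for odd primes d,
where det L = ℓ^k produces the symbol of (−ℓ)^k; Dirichlet's theorem on primes in progressions
extends the result to all of Γ₀(ℓ) (`slash_eq_latticeCharacter`). Vanishing at every cusp follows
from the bound O((im τ)^{-(k+3)}), whose exponent lies below the weight k+4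
(`isZeroAtImInfty_slash`). -/

noncomputable section

namespace ModularLattice

open MeasureTheory Complex

/-! ### Poisson summation -/

section PoissonPi

variable {ι : Type*} [Fintype ι]

/-- The standard lattice in `ι → ℝ`, coordinatised. -/
def intPiEquiv (ι : Type*) [Fintype ι] :
    (ι → ℤ) ≃ Submodule.span ℤ (Set.range (Pi.basisFun ℝ ι)) :=
  ((Pi.basisFun ℝ ι).restrictScalars ℤ).equivFun.symm.toEquiv

lemma intPiEquiv_apply (k : ι → ℤ) : ((intPiEquiv ι k : _) : ι → ℝ) = fun i => (k i : ℝ) := by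
  classical
  have : ((intPiEquiv ι k : _) : ι → ℝ) = ∑ i, (k i : ℝ) • (Pi.basisFun ℝ ι i) := by
    simp [intPiEquiv, Module.Basis.equivFun_symm_apply, Int.cast_smul_eq_zsmul]
  rw [this]
  ext j
  rw [Finset.sum_apply]
  simp [Pi.single_apply]

/-- Peetre's inequality, from `1 + ‖y‖ ≤ (1 + R)(1 + ‖x + y‖)`. It makes power decay uniform under
bounded translations. -/
lemma one_add_norm_add_rpow_le {E : Type*} [SeminormedAddCommGroup E] {r R : ℝ} (hr : 0 ≤ r)
    {x : E} (hx : ‖x‖ ≤ R) (y : E) :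
    (1 + ‖x + y‖) ^ (-r) ≤ (1 + R) ^ r * (1 + ‖y‖) ^ (-r) := by
  have hR : 0 ≤ R := (norm_nonneg _).trans hx
  have h1 : 1 + ‖y‖ ≤ (1 + R) * (1 + ‖x + y‖) := by
    have : ‖y‖ ≤ ‖x + y‖ + ‖x‖ := by
      simpa using norm_sub_le (x + y) x
    nlinarith [norm_nonneg (x + y)]
  rw [Real.rpow_neg (by positivity), Real.rpow_neg (by positivity),
    inv_le_comm₀ (by positivity) (by positivity), mul_inv, inv_inv,
    inv_mul_le_iff₀ (by positivity), ← Real.mul_rpow (by positivity) (by positivity)]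
  exact Real.rpow_le_rpow (by positivity) h1 hr

/-- Away from the origin the summand is at most `‖x‖ ^ (-r)`, whose lattice sum converges for `r`
above the rank. -/
lemma summable_one_add_norm_rpow {E : Type*} [NormedAddCommGroup E] [NormedSpace ℝ E]
    [FiniteDimensional ℝ E] (L : Submodule ℤ E) [DiscreteTopology L] [IsZLattice ℝ L] {r : ℝ}
    (hr : (Module.finrank ℝ E : ℝ) < r) :
    Summable fun x : L => (1 + ‖(x : E)‖) ^ (-r) := by
  have hfr : (Module.finrank ℤ L : ℝ) < r := by
    rwa [ZLattice.rank ℝ L]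
  have h := ZLattice.summable_norm_rpow L (-r) (by linarith)
  have hr0 : 0 < r := lt_of_le_of_lt (Nat.cast_nonneg _) hr
  refine Summable.of_norm_bounded_eventually h ?_
  have : {x : L | ¬ ‖(1 + ‖(x : E)‖) ^ (-r)‖ ≤ ‖x‖ ^ (-r)} ⊆ {0} := by
    intro x hx
    by_contra h0
    apply hx
    have hx0 : 0 < ‖(x : E)‖ := by simpa using h0
    rw [Real.norm_of_nonneg (by positivity)]
    exact Real.rpow_le_rpow_of_nonpos hx0 (by simp) (by linarith)
  exact (Set.finite_singleton _).subset this

lemma summable_intPi {r : ℝ} (hr : (Fintype.card ι : ℝ) < r) :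
    Summable fun k : ι → ℤ => (1 + ‖fun i => (k i : ℝ)‖) ^ (-r) := by
  have := summable_one_add_norm_rpow (Submodule.span ℤ (Set.range (Pi.basisFun ℝ ι)))
    (r := r) (by simpa using hr)
  rw [← (intPiEquiv ι).summable_iff] at this
  simpa [Function.comp_def, intPiEquiv_apply] using this

/-- A summable majorant that is uniform on a ball, for the Weierstrass test. -/
lemma summable_bound_intPi {f : (ι → ℝ) → ℂ} {c r : ℝ} (hr : (Fintype.card ι : ℝ) < r)
    (hdec : ∀ x, ‖f x‖ ≤ c * (1 + ‖x‖) ^ (-r)) (R : ℝ) :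
    ∃ u : (ι → ℤ) → ℝ, Summable u ∧
      ∀ x, ‖x‖ ≤ R → ∀ k : ι → ℤ, ‖f (x + fun i => (k i : ℝ))‖ ≤ u k := by
  refine ⟨fun k => c * ((1 + R) ^ r * (1 + ‖fun i => (k i : ℝ)‖) ^ (-r)),
    ((summable_intPi hr).mul_left _).mul_left _, fun x hx k => (hdec _).trans ?_⟩
  have hc : 0 ≤ c := by
    have := (norm_nonneg _).trans (hdec 0)
    simpa using this
  have hr0 : 0 ≤ r := (Nat.cast_nonneg _).trans hr.le
  exact mul_le_mul_of_nonneg_left (one_add_norm_add_rpow_le hr0 hx _) hc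

lemma continuous_periodization {f : (ι → ℝ) → ℂ} (hf : Continuous f) {c r : ℝ}
    (hr : (Fintype.card ι : ℝ) < r) (hdec : ∀ x, ‖f x‖ ≤ c * (1 + ‖x‖) ^ (-r)) :
    Continuous fun x : ι → ℝ => ∑' k : ι → ℤ, f (x + fun i => (k i : ℝ)) := by
  rw [continuous_iff_continuousAt]
  intro x
  obtain ⟨u, hu, hfu⟩ := summable_bound_intPi hr hdec (‖x‖ + 1)
  have hc : ContinuousOn (fun x : ι → ℝ => ∑' k : ι → ℤ, f (x + fun i => (k i : ℝ)))
      (Metric.closedBall 0 (‖x‖ + 1)) :=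
    continuousOn_tsum (fun k => by fun_prop) hu
      (fun k y hy => hfu y (by simpa using hy) k)
  refine hc.continuousAt ?_
  refine Metric.closedBall_mem_nhds_of_mem ?_
  simp

/-- The additive character `t ↦ exp(2πi m⬝t)`. -/
def piChar (m : ι → ℤ) (x : ι → ℝ) : ℂ := cexp (2 * Real.pi * I * ∑ i, (m i : ℂ) * (x i : ℂ))

lemma mFourier_coe (m : ι → ℤ) (x : ι → ℝ) :
    UnitAddTorus.mFourier m (fun i => (x i : UnitAddCircle)) = piChar m x := by
  simp only [UnitAddTorus.mFourier, ContinuousMap.coe_mk, fourier_coe_apply, piChar,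
    ← Complex.exp_sum]
  congr 1
  rw [Finset.mul_sum]
  refine Finset.sum_congr rfl fun i _ => ?_
  push_cast
  ring

lemma norm_piChar (m : ι → ℤ) (x : ι → ℝ) : ‖piChar m x‖ = 1 := by
  rw [piChar, Complex.norm_exp]
  simp [Complex.mul_re]

lemma continuous_piChar (m : ι → ℤ) : Continuous (piChar m) := by
  unfold piChar; fun_prop

lemma piChar_add_int (m : ι → ℤ) (x : ι → ℝ) (k : ι → ℤ) :
    piChar m (x + fun i => (k i : ℝ)) = piChar m x := by
  rw [← mFourier_coe, ← mFourier_coe]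
  congr 1
  ext i
  simp only [Pi.add_apply, AddCircle.coe_add]
  have : ((k i : ℝ) : UnitAddCircle) = 0 := by
    rw [AddCircle.coe_eq_zero_iff]
    exact ⟨k i, by simp⟩
  rw [this, add_zero]

lemma integrable_of_decay_pi {f : (ι → ℝ) → ℂ} (hf : Continuous f) {c r : ℝ}
    (hr : (Fintype.card ι : ℝ) < r) (hdec : ∀ x, ‖f x‖ ≤ c * (1 + ‖x‖) ^ (-r)) :
    Integrable f := by
  refine Integrable.mono' ((integrable_one_add_norm (r := r) (by simpa using hr)).const_mul c)
    hf.aestronglyMeasurable (.of_forall hdec)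

/-- The Fourier coefficients of the periodization of `f` are values of its Fourier transform. -/
lemma integral_periodization {f : (ι → ℝ) → ℂ} (hf : Continuous f) {c r : ℝ}
    (hr : (Fintype.card ι : ℝ) < r) (hdec : ∀ x, ‖f x‖ ≤ c * (1 + ‖x‖) ^ (-r)) (m : ι → ℤ) :
    ∫ x in {x : ι → ℝ | ∀ i, x i ∈ Set.Ioc ((0 : ι → ℝ) i) ((0 : ι → ℝ) i + 1)},
      piChar m x * ∑' k : ι → ℤ, f (x + fun i => (k i : ℝ)) = ∫ x, piChar m x * f x := by
  -- The torus integral uses an `Ioc` cube and the fundamental domain of `ℤ^ι` is an `Ico` cube;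
  -- they differ by a null set.
  have hset : {x : ι → ℝ | ∀ i, x i ∈ Set.Ioc ((0 : ι → ℝ) i) ((0 : ι → ℝ) i + 1)} =ᵐ[volume]
      ZSpan.fundamentalDomain (Pi.basisFun ℝ ι) := by
    rw [ZSpan.fundamentalDomain_pi_basisFun]
    have h1 : {x : ι → ℝ | ∀ i, x i ∈ Set.Ioc ((0 : ι → ℝ) i) ((0 : ι → ℝ) i + 1)} =
        Set.univ.pi fun _ => Set.Ioc 0 1 := by
      ext x; simp [Set.mem_pi]
    rw [h1]
    exact (Measure.univ_pi_Ioc_ae_eq_Icc (μ := fun _ : ι => (volume : Measure ℝ))).trans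
      (Measure.univ_pi_Ico_ae_eq_Icc (μ := fun _ : ι => (volume : Measure ℝ))).symm
  rw [setIntegral_congr_set hset]
  have : VAddInvariantMeasure (Submodule.span ℤ (Set.range (Pi.basisFun ℝ ι))) (ι → ℝ) volume :=
    inferInstanceAs (VAddInvariantMeasure
      (Submodule.span ℤ (Set.range (Pi.basisFun ℝ ι))).toAddSubgroup (ι → ℝ) volume)
  have hFD := ZSpan.isAddFundamentalDomain (Pi.basisFun ℝ ι) (volume : Measure (ι → ℝ))
  set h : (ι → ℝ) → ℂ := fun x => piChar m x * f x with hh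
  have hcont : Continuous h := (continuous_piChar m).mul hf
  have hint : Integrable h := integrable_of_decay_pi hcont hr
    (fun x => by rw [hh]; simpa [norm_piChar] using hdec x)
  -- The character is `ℤ^ι`-periodic, so it moves inside the periodization and the integral unfolds
  -- to all of `ℝ^ι`.
  have e1 : ∀ x : ι → ℝ, piChar m x * ∑' k : ι → ℤ, f (x + fun i => (k i : ℝ)) =
      ∑' g : Submodule.span ℤ (Set.range (Pi.basisFun ℝ ι)), h (g +ᵥ x) := by
    intro x
    rw [← tsum_mul_left, ← (intPiEquiv ι).tsum_eq]
    refine tsum_congr fun k => ?_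
    rw [Submodule.vadd_def, vadd_eq_add, intPiEquiv_apply, add_comm _ x]
    simp only [hh, piChar_add_int]
  simp_rw [e1]
  rw [hFD.integral_eq_tsum'' h hint, integral_tsum]
  · intro g
    refine (Continuous.aestronglyMeasurable ?_).restrict
    simp only [Submodule.vadd_def, vadd_eq_add]
    fun_prop
  · rw [← hFD.lintegral_eq_tsum'' (fun x => ‖h x‖ₑ)]
    exact hint.2.ne

/-- **Poisson summation** on `ℝ^ι`. -/
theorem poisson_pi {f : (ι → ℝ) → ℂ} (hf : Continuous f) {c r : ℝ}
    (hr : (Fintype.card ι : ℝ) < r) (hdec : ∀ x, ‖f x‖ ≤ c * (1 + ‖x‖) ^ (-r))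
    (hsum : Summable fun m : ι → ℤ => ∫ x, piChar (-m) x * f x) (x : ι → ℝ) :
    ∑' k : ι → ℤ, f (x + fun i => (k i : ℝ)) =
      ∑' m : ι → ℤ, (∫ y, piChar (-m) y * f y) * piChar m x := by
  set F : (ι → ℝ) → ℂ := fun x => ∑' k : ι → ℤ, f (x + fun i => (k i : ℝ)) with hF
  have hFc : Continuous F := continuous_periodization hf hr hdec
  have hper : ∀ (x : ι → ℝ) (k : ι → ℤ), F (x + fun i => (k i : ℝ)) = F x := by
    intro x k
    simp only [hF]
    rw [← (Equiv.addLeft k).tsum_eq (fun j : ι → ℤ => f (x + fun i => (j i : ℝ)))]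
    refine tsum_congr fun j => ?_
    congr 1
    ext i
    simp [add_assoc]
  have hq : IsOpenQuotientMap (Pi.map fun (_ : ι) (y : ℝ) => (y : UnitAddCircle)) :=
    IsOpenQuotientMap.piMap fun _ => QuotientAddGroup.isOpenQuotientMap_mk
  have hlift : ∀ a b : ι → ℝ, (Pi.map fun (_ : ι) (y : ℝ) => (y : UnitAddCircle)) a =
      (Pi.map fun (_ : ι) (y : ℝ) => (y : UnitAddCircle)) b → F a = F b := by
    intro a b hab
    have : ∀ i, ∃ k : ℤ, a i = b i + k := by
      intro i
      have h1 : ((a i : ℝ) : UnitAddCircle) = (b i : ℝ) := congr_fun hab i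
      have h2 : ((a i - b i : ℝ) : UnitAddCircle) = 0 := by
        rw [AddCircle.coe_sub, h1, sub_self]
      rw [AddCircle.coe_eq_zero_iff] at h2
      obtain ⟨k, hk⟩ := h2
      refine ⟨k, ?_⟩
      have : (k : ℝ) = a i - b i := by simpa using hk
      rw [this]; ring
    choose k hk using this
    rw [← hper b k]
    congr 1
    ext i
    exact hk i
  -- The periodization descends to a continuous function on the torus. Its Fourier coefficients are
  -- summable by `hsum`, so its Fourier series converges to it pointwise.
  let G : C(UnitAddTorus ι, ℂ) :=
    ⟨fun t => F (Function.surjInv hq.surjective t), by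
      rw [hq.isQuotientMap.continuous_iff]
      convert hFc using 1
      ext y
      exact hlift _ _ (Function.surjInv_eq hq.surjective _)⟩
  have hG : ∀ y : ι → ℝ, G (fun i => (y i : UnitAddCircle)) = F y := fun y =>
    hlift _ _ (Function.surjInv_eq hq.surjective (Pi.map (fun (_ : ι) (y : ℝ) => (y : UnitAddCircle)) y))
  have hcoeff : ∀ m, UnitAddTorus.mFourierCoeff G m = ∫ x, piChar (-m) x * f x := by
    intro m
    rw [UnitAddTorus.mFourierCoeff_eq_integral _ _ 0, ← integral_periodization hf hr hdec]
    simp only [smul_eq_mul, hG, mFourier_coe, hF]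
  have hs : Summable (UnitAddTorus.mFourierCoeff G) := by
    rw [funext hcoeff]; exact hsum
  have := (UnitAddTorus.hasSum_mFourier_series_apply_of_summable hs
    (fun i => (x i : UnitAddCircle))).tsum_eq
  rw [hG] at this
  refine this.symm.trans ?_
  simp only [hcoeff, mFourier_coe, smul_eq_mul]

end PoissonPi
end ModularLattice
end

noncomputable section

namespace ModularLattice

open MeasureTheory Complex
open scoped FourierTransform

/-! ### Poisson summation over a lattice and its dual -/

section PoissonLattice

variable {n : ℕ} {ι : Type*} [Fintype ι]

lemma innerₗ_nondegenerate : (innerₗ (Euc n) : LinearMap.BilinForm ℝ (Euc n)).Nondegenerate := by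
  refine ⟨fun x hx => ?_, fun x hx => ?_⟩ <;>
  · have := hx x
    simpa using this

/-- The basis dual to `B` with respect to the inner product. -/
def dualBasis [DecidableEq ι] (B : Module.Basis ι ℝ (Euc n)) : Module.Basis ι ℝ (Euc n) :=
  LinearMap.BilinForm.dualBasis (innerₗ (Euc n)) innerₗ_nondegenerate B

lemma inner_dualBasis [DecidableEq ι] (B : Module.Basis ι ℝ (Euc n)) (i j : ι) :
    inner ℝ (dualBasis B i) (B j) = if j = i then (1 : ℝ) else 0 := by
  exact LinearMap.BilinForm.apply_dualBasis_left (B := innerₗ (Euc n)) innerₗ_nondegenerate B i j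

lemma dualLattice_span [DecidableEq ι] (B : Module.Basis ι ℝ (Euc n)) :
    dualLattice (Submodule.span ℤ (Set.range B)) = Submodule.span ℤ (Set.range (dualBasis B)) :=
  LinearMap.BilinForm.dualSubmodule_span_of_basis _ innerₗ_nondegenerate B

lemma exists_basis_span_eq (L : Submodule ℤ (Euc n)) [DiscreteTopology L] [IsZLattice ℝ L] :
    ∃ B : Module.Basis (Fin n) ℝ (Euc n), L = Submodule.span ℤ (Set.range B) := by
  have hc : Fintype.card (Module.Free.ChooseBasisIndex ℤ L) = n := by
    rw [← Module.finrank_eq_card_chooseBasisIndex, ZLattice.rank ℝ L, finrank_euclideanSpace_fin]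
  let b0 := (Module.Free.chooseBasis ℤ L).reindex (Fintype.equivFinOfCardEq hc)
  exact ⟨b0.ofZLatticeBasis ℝ L, (b0.ofZLatticeBasis_span ℝ L).symm⟩

instance discreteTopology_dualLattice (L : Submodule ℤ (Euc n)) [DiscreteTopology L]
    [IsZLattice ℝ L] : DiscreteTopology (dualLattice L) := by
  obtain ⟨B, hB⟩ := exists_basis_span_eq L
  rw [hB, dualLattice_span]
  infer_instance

instance isZLattice_dualLattice (L : Submodule ℤ (Euc n)) [DiscreteTopology L]
    [IsZLattice ℝ L] : IsZLattice ℝ (dualLattice L) := by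
  obtain ⟨B, hB⟩ := exists_basis_span_eq L
  constructor
  rw [hB, dualLattice_span]
  exact ZSpan.span_top _

/-- Integer coordinates on the lattice spanned by a basis. -/
def spanEquiv (B : Module.Basis ι ℝ (Euc n)) :
    (ι → ℤ) ≃ Submodule.span ℤ (Set.range B) :=
  (B.restrictScalars ℤ).equivFun.symm.toEquiv

lemma spanEquiv_apply (B : Module.Basis ι ℝ (Euc n)) (k : ι → ℤ) :
    (spanEquiv B k : Euc n) = B.equivFun.symm fun i => (k i : ℝ) := by
  simp [spanEquiv, Module.Basis.equivFun_symm_apply, Int.cast_smul_eq_zsmul]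

lemma inner_spanEquiv_dualBasis [DecidableEq ι] (B : Module.Basis ι ℝ (Euc n)) (m : ι → ℤ)
    (t : ι → ℝ) :
    inner ℝ (B.equivFun.symm t) (spanEquiv (dualBasis B) m : Euc n) = ∑ i, (m i : ℝ) * t i := by
  rw [spanEquiv_apply, Module.Basis.equivFun_symm_apply, Module.Basis.equivFun_symm_apply]
  simp only [sum_inner, inner_sum, inner_smul_left, inner_smul_right]
  refine Finset.sum_congr rfl fun i _ => ?_
  rw [Finset.sum_eq_single i]
  · rw [real_inner_comm, inner_dualBasis]; simp
  · intro j _ hj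
    rw [real_inner_comm, inner_dualBasis, if_neg hj]; simp
  · simp

/-- Decay at infinity fast enough for Poisson summation. -/
def IsRapid (f : Euc n → ℂ) : Prop :=
  Continuous f ∧ ∃ c r : ℝ, (n : ℝ) < r ∧ ∀ x, ‖f x‖ ≤ c * (1 + ‖x‖) ^ (-r)

lemma IsRapid.integrable {f : Euc n → ℂ} (hf : IsRapid f) : Integrable f := by
  obtain ⟨h1, c, r, hr, h⟩ := hf
  exact Integrable.mono' ((integrable_one_add_norm (r := r) (by simpa using hr)).const_mul c)
    h1.aestronglyMeasurable (.of_forall h)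

lemma IsRapid.summable {f : Euc n → ℂ} (hf : IsRapid f) (L : Submodule ℤ (Euc n))
    [DiscreteTopology L] [IsZLattice ℝ L] (v : Euc n) : Summable fun x : L => f (v + x) := by
  obtain ⟨h1, c, r, hr, h⟩ := hf
  have hc : 0 ≤ c := by simpa using (norm_nonneg _).trans (h 0)
  refine Summable.of_norm_bounded (((summable_one_add_norm_rpow L (r := r)
    (by simpa using hr)).mul_left ((1 + ‖v‖) ^ r)).mul_left c) fun x => (h _).trans ?_
  exact mul_le_mul_of_nonneg_left
    (one_add_norm_add_rpow_le ((Nat.cast_nonneg _).trans hr.le) le_rfl _) hc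

/-- **Poisson summation** for a lattice in Euclidean space. The constant is the inverse of the
covolume, but its value plays no role here. -/
theorem exists_poisson_lattice (L : Submodule ℤ (Euc n)) [DiscreteTopology L] [IsZLattice ℝ L] :
    ∃ c : ℂ, ∀ f : Euc n → ℂ, IsRapid f → IsRapid (𝓕 f) → ∀ v : Euc n,
      ∑' x : L, f (v + x) =
        c * ∑' y : dualLattice L, 𝓕 f y * cexp (2 * Real.pi * I * (inner ℝ v (y : Euc n) : ℝ)) := by
  obtain ⟨B, rfl⟩ := exists_basis_span_eq L
  set T := B.equivFunL.symm with hT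
  have hTapp : ∀ t, T t = B.equivFun.symm t := fun t => rfl
  -- Coordinates carry Lebesgue measure to a translation-invariant measure, hence to a multiple of
  -- volume; the covolume enters only through `κ`.
  set κ := (volume.map T).addHaarScalarFactor (volume : Measure (Euc n)) with hκ
  have hmap : volume.map T = κ • (volume : Measure (Euc n)) :=
    Measure.isAddLeftInvariant_eq_smul _ _
  refine ⟨(κ : ℝ), fun f hf hf' v => ?_⟩
  have hint : ∀ m : Fin n → ℤ, ∫ t, piChar (-m) t * f (T t) =
      (κ : ℝ) * 𝓕 f (spanEquiv (dualBasis B) m : Euc n) := by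
    intro m
    rw [Real.fourier_eq', ← Complex.real_smul]
    have h1 : (κ : ℝ) • ∫ x, cexp ((↑(-2 * Real.pi *
        inner ℝ x (spanEquiv (dualBasis B) m : Euc n)) * I)) • f x =
        ∫ x, cexp ((↑(-2 * Real.pi *
        inner ℝ x (spanEquiv (dualBasis B) m : Euc n)) * I)) • f x ∂(volume.map T) := by
      rw [hmap, integral_smul_nnreal_measure]; rfl
    rw [h1]
    refine Eq.trans ?_ (T.toHomeomorph.measurableEmbedding.integral_map (μ := volume) _).symm
    refine integral_congr_ae (.of_forall fun t => ?_)
    simp only [smul_eq_mul]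
    congr 1
    rw [piChar]
    congr 1
    have := inner_spanEquiv_dualBasis B m t
    erw [this]
    push_cast
    simp only [Pi.neg_apply, Int.cast_neg, neg_mul, Finset.sum_neg_distrib]
    ring
  obtain ⟨hfc, c, r, hr, hdec⟩ := hf
  have hr0 : 0 ≤ r := (Nat.cast_nonneg _).trans hr.le
  obtain ⟨K, hK, hKT⟩ : ∃ K : ℝ, 0 < K ∧ ∀ t, ‖t‖ ≤ K * ‖T t‖ := by
    refine ⟨‖(T.symm : Euc n →L[ℝ] (Fin n → ℝ))‖ + 1, by positivity, fun t => ?_⟩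
    have := (T.symm : Euc n →L[ℝ] (Fin n → ℝ)).le_opNorm (T t)
    simp only [ContinuousLinearEquiv.coe_coe, ContinuousLinearEquiv.symm_apply_apply] at this
    nlinarith [norm_nonneg (T t)]
  have hc : 0 ≤ c := by simpa using (norm_nonneg _).trans (hdec 0)
  have hdec' : ∀ t, ‖f (T t)‖ ≤ (c * (1 + K) ^ r) * (1 + ‖t‖) ^ (-r) := by
    intro t
    refine (hdec _).trans ?_
    rw [mul_assoc]
    refine mul_le_mul_of_nonneg_left ?_ hc
    rw [Real.rpow_neg (by positivity), Real.rpow_neg (by positivity),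
      inv_le_comm₀ (by positivity) (by positivity), mul_inv, inv_inv,
      inv_mul_le_iff₀ (by positivity), ← Real.mul_rpow (by positivity) (by positivity)]
    exact Real.rpow_le_rpow (by positivity) (by nlinarith [hKT t, norm_nonneg (T t)]) hr0
  have hs0 : Summable fun m : Fin n → ℤ => 𝓕 f (spanEquiv (dualBasis B) m : Euc n) := by
    have := (hf'.summable (Submodule.span ℤ (Set.range (dualBasis B))) 0)
    simp only [zero_add] at this
    exact ((spanEquiv (dualBasis B)).summable_iff
      (f := fun y : Submodule.span ℤ (Set.range (dualBasis B)) => 𝓕 f (y : Euc n))).mpr this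
  have hP := poisson_pi (f := fun t => f (T t)) (hfc.comp T.continuous) (by simpa using hr) hdec'
    (by simp only [hint]; exact hs0.mul_left _) (T.symm v)
  rw [← (spanEquiv B).tsum_eq]
  have hl : ∀ k : Fin n → ℤ, f (v + (spanEquiv B k : Euc n)) =
      f (T (T.symm v + fun i => (k i : ℝ))) := by
    intro k
    rw [map_add, ContinuousLinearEquiv.apply_symm_apply, spanEquiv_apply, hTapp]
  simp only [hl]
  have hdual : ∀ (M : Submodule ℤ (Euc n)) (g : Euc n → ℂ),
      M = Submodule.span ℤ (Set.range (dualBasis B)) →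
      ∑' y : M, g y = ∑' m : Fin n → ℤ, g (spanEquiv (dualBasis B) m : Euc n) := by
    rintro M g rfl
    exact ((spanEquiv (dualBasis B)).tsum_eq
      (fun y : Submodule.span ℤ (Set.range (dualBasis B)) => g y)).symm
  have hd := hdual _ (fun y => 𝓕 f y * cexp (2 * Real.pi * I * (inner ℝ v y : ℝ)))
    (dualLattice_span B)
  refine hP.trans (Eq.trans ?_ (congrArg (((κ : ℝ) : ℂ) * ·) hd).symm)
  rw [← tsum_mul_left]
  refine tsum_congr fun m => ?_
  rw [hint, mul_assoc]
  congr 2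
  rw [piChar]
  congr 2
  have := inner_spanEquiv_dualBasis B m (T.symm v)
  rw [← hTapp, ContinuousLinearEquiv.apply_symm_apply] at this
  rw [this]
  push_cast
  rfl

end PoissonLattice
end ModularLattice
end

noncomputable section

namespace ModularLattice

open MeasureTheory Complex
open scoped FourierTransform

/-! ### Gaussians times powers of an isotropic linear form -/

section PolyGauss

variable {n : ℕ}

/-- A single Taylor term `u^N/N! ≤ e^u` at `u = c(1 + t²)` suffices, since `(1 + t)² ≤ 2(1 + t²)`;
passing from `t²` to `1 + t²` costs the factor `e^c`. -/
lemma exp_neg_mul_sq_le {c : ℝ} (hc : 0 < c) (N : ℕ) {t : ℝ} (ht : 0 ≤ t) :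
    Real.exp (-c * t ^ 2) ≤
      Real.exp c * (N.factorial * (2 / c) ^ N) * ((1 + t) ^ (2 * N))⁻¹ := by
  have h1 : (c * (1 + t ^ 2)) ^ N / N.factorial ≤ Real.exp (c * (1 + t ^ 2)) :=
    Real.pow_div_factorial_le_exp _ (by positivity) N
  have h2 : (1 + t) ^ (2 * N) ≤ (2 * (1 + t ^ 2)) ^ N := by
    rw [pow_mul]
    exact pow_le_pow_left₀ (by positivity) (by nlinarith [sq_nonneg (1 - t)]) N
  have h3 : Real.exp (-c * t ^ 2) = Real.exp c * (Real.exp (c * (1 + t ^ 2)))⁻¹ := by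
    rw [← Real.exp_neg, ← Real.exp_add]; ring_nf
  rw [h3, mul_assoc]
  refine mul_le_mul_of_nonneg_left ?_ (Real.exp_pos _).le
  rw [inv_le_comm₀ (Real.exp_pos _) (by positivity)]
  refine le_trans ?_ h1
  have e : (N.factorial * (2 / c) ^ N * ((1 + t) ^ (2 * N))⁻¹)⁻¹ =
      ((2 / c) ^ N)⁻¹ * (1 + t) ^ (2 * N) / N.factorial := by
    rw [mul_inv, inv_inv, mul_inv]; ring
  rw [e]
  refine div_le_div_of_nonneg_right ?_ (by positivity)
  calc ((2 / c) ^ N)⁻¹ * (1 + t) ^ (2 * N) ≤ ((2 / c) ^ N)⁻¹ * (2 * (1 + t ^ 2)) ^ N := by gcongr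
    _ = (c * (1 + t ^ 2)) ^ N := by
      rw [← inv_pow, ← mul_pow]; congr 1; field_simp

lemma exists_gauss_bound {c : ℝ} (hc : 0 < c) (j N : ℕ) :
    ∃ K : ℝ, 0 ≤ K ∧ ∀ t : ℝ, 0 ≤ t →
      (1 + t) ^ j * Real.exp (-c * t ^ 2) ≤ K * (1 + t) ^ (-(N : ℝ)) := by
  refine ⟨Real.exp c * ((j + N).factorial * (2 / c) ^ (j + N)), by positivity, fun t ht => ?_⟩
  have h := exp_neg_mul_sq_le hc (j + N) ht
  rw [Real.rpow_neg (by positivity), Real.rpow_natCast]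
  calc (1 + t) ^ j * Real.exp (-c * t ^ 2)
      ≤ (1 + t) ^ j * (Real.exp c * ((j + N).factorial * (2 / c) ^ (j + N)) *
        ((1 + t) ^ (2 * (j + N)))⁻¹) := by gcongr
    _ = Real.exp c * ((j + N).factorial * (2 / c) ^ (j + N)) *
        ((1 + t) ^ j * ((1 + t) ^ (2 * (j + N)))⁻¹) := by ring
    _ ≤ _ := by
      refine mul_le_mul_of_nonneg_left ?_ (by positivity)
      rw [← div_eq_mul_inv, div_le_iff₀ (by positivity), inv_mul_eq_div,
        le_div_iff₀ (by positivity), ← pow_add]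
      exact pow_le_pow_right₀ (by linarith) (by omega)

lemma isRapid_of_bound {f : Euc n → ℂ} (hf : Continuous f) {M c : ℝ} (hc : 0 < c) (j : ℕ)
    (h : ∀ x, ‖f x‖ ≤ M * ((1 + ‖x‖) ^ j * Real.exp (-c * ‖x‖ ^ 2))) : IsRapid f := by
  obtain ⟨K, hK, hb⟩ := exists_gauss_bound hc j (n + 1)
  have hM : 0 ≤ M := by simpa using (norm_nonneg _).trans (h 0)
  refine ⟨hf, M * K, (n + 1 : ℕ), by push_cast; linarith, fun x => (h x).trans ?_⟩
  rw [mul_assoc]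
  exact mul_le_mul_of_nonneg_left (hb _ (norm_nonneg _)) hM

lemma integrable_gauss_bound {c : ℝ} (hc : 0 < c) (j : ℕ) :
    Integrable fun x : Euc n => (1 + ‖x‖) ^ j * Real.exp (-c * ‖x‖ ^ 2) := by
  obtain ⟨K, hK, hb⟩ := exists_gauss_bound hc j (n + 1)
  refine Integrable.mono' ((integrable_one_add_norm (r := (n + 1 : ℕ)) (E := Euc n)
    (by simp)).const_mul K) (by fun_prop) (.of_forall fun x => ?_)
  rw [Real.norm_of_nonneg (by positivity)]
  exact hb _ (norm_nonneg _)

/-- The complex linear form `x ↦ a⬝x + i b⬝x`. -/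
def clin (a b : Euc n) : Euc n →L[ℝ] ℂ :=
  ofRealCLM ∘L innerSL ℝ a + I • (ofRealCLM ∘L innerSL ℝ b)

lemma clin_apply (a b x : Euc n) :
    clin a b x = (inner ℝ a x : ℝ) + I * (inner ℝ b x : ℝ) := by
  simp [clin]

/-- `x ↦ (a⬝x + i b⬝x)^j exp(πiτ|x|²)`. -/
def polyGauss (a b : Euc n) (j : ℕ) (τ : ℂ) (x : Euc n) : ℂ :=
  clin a b x ^ j * cexp (Real.pi * I * τ * (‖x‖ : ℂ) ^ 2)

lemma norm_cexp_gauss (τ : ℂ) (t : ℝ) :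
    ‖cexp (Real.pi * I * τ * (t : ℂ) ^ 2)‖ = Real.exp (-(Real.pi * τ.im) * t ^ 2) := by
  rw [Complex.norm_exp]
  congr 1
  have : (Real.pi * I * τ * (t : ℂ) ^ 2) = ((Real.pi * t ^ 2 : ℝ) : ℂ) * (I * τ) := by
    push_cast; ring
  rw [this, Complex.re_ofReal_mul]
  simp
  ring

lemma norm_polyGauss_le (a b : Euc n) (j : ℕ) (τ : ℂ) (x : Euc n) :
    ‖polyGauss a b j τ x‖ ≤
      ‖clin a b‖ ^ j * (‖x‖ ^ j * Real.exp (-(Real.pi * τ.im) * ‖x‖ ^ 2)) := by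
  rw [polyGauss, norm_mul, norm_cexp_gauss, norm_pow, ← mul_assoc, ← mul_pow]
  gcongr
  exact (clin a b).le_opNorm x

lemma isRapid_polyGauss (a b : Euc n) (j : ℕ) {τ : ℂ} (hτ : 0 < τ.im) :
    IsRapid (polyGauss a b j τ) := by
  refine isRapid_of_bound (M := ‖clin a b‖ ^ j) (c := Real.pi * τ.im) ?_ (by positivity) j ?_
  · unfold polyGauss; fun_prop
  · intro x
    refine (norm_polyGauss_le a b j τ x).trans ?_
    gcongr
    linarith

lemma hasFDerivAt_polyGauss (a b : Euc n) (j : ℕ) (τ : ℂ) (x : Euc n) :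
    HasFDerivAt (polyGauss a b j τ)
      ((j * clin a b x ^ (j - 1) * cexp (Real.pi * I * τ * (‖x‖ : ℂ) ^ 2)) • clin a b +
        (2 * Real.pi * I * τ * polyGauss a b j τ x) • (ofRealCLM ∘L innerSL ℝ x)) x := by
  have h1 : HasFDerivAt (fun x : Euc n => clin a b x ^ j)
      ((j * clin a b x ^ (j - 1)) • clin a b) x := by
    simpa using (clin a b).hasFDerivAt.pow j
  have h2 : HasFDerivAt (fun x : Euc n => (‖x‖ : ℂ) ^ 2)
      (ofRealCLM ∘L (2 • innerSL ℝ x)) x := by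
    have := ofRealCLM.hasFDerivAt.comp x (hasStrictFDerivAt_norm_sq x).hasFDerivAt
    simpa [Function.comp_def] using this
  have h3 := (h2.const_mul (Real.pi * I * τ)).cexp
  have h4 := h1.mul h3
  refine h4.congr_fderiv ?_
  ext v
  simp [polyGauss]
  ring

lemma integrable_fderiv_polyGauss (a b : Euc n) (j : ℕ) {τ : ℂ} (hτ : 0 < τ.im) :
    Integrable (fderiv ℝ (polyGauss a b j τ)) := by
  have hfd : fderiv ℝ (polyGauss a b j τ) = fun x =>
      ((j * clin a b x ^ (j - 1) * cexp (Real.pi * I * τ * (‖x‖ : ℂ) ^ 2)) • clin a b +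
        (2 * Real.pi * I * τ * polyGauss a b j τ x) • (ofRealCLM ∘L innerSL ℝ x)) :=
    funext fun x => (hasFDerivAt_polyGauss a b j τ x).fderiv
  have hc : 0 < Real.pi * τ.im := by positivity
  rw [hfd]
  refine Integrable.add (f := fun x : Euc n => (j * clin a b x ^ (j - 1) *
      cexp (Real.pi * I * τ * (‖x‖ : ℂ) ^ 2)) • clin a b)
    (g := fun x : Euc n => (2 * Real.pi * I * τ * polyGauss a b j τ x) •
      (ofRealCLM ∘L innerSL ℝ x : Euc n →L[ℝ] ℂ)) ?_ ?_
  · refine Integrable.smul_const (f := fun x : Euc n =>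
      j * clin a b x ^ (j - 1) * cexp (Real.pi * I * τ * (‖x‖ : ℂ) ^ 2)) ?_ (clin a b)
    simp_rw [mul_assoc]
    refine Integrable.const_mul ?_ _
    have := (isRapid_polyGauss a b (j - 1) hτ).integrable
    unfold polyGauss at this
    simpa only [mul_assoc] using this
  · refine Integrable.mono' ((integrable_gauss_bound hc (j + 1)).const_mul
      (‖2 * Real.pi * I * τ‖ * ‖clin a b‖ ^ j)) ?_ (.of_forall fun x => ?_)
    · refine Continuous.aestronglyMeasurable ?_
      unfold polyGauss
      have : Continuous fun x : Euc n => (ofRealCLM ∘L innerSL ℝ x : Euc n →L[ℝ] ℂ) :=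
        ((ContinuousLinearMap.compL ℝ (Euc n) ℝ ℂ ofRealCLM).continuous).comp
          (innerSL ℝ (E := Euc n)).continuous
      fun_prop
    · rw [norm_smul, norm_mul]
      have h1 : ‖(ofRealCLM ∘L innerSL ℝ x : Euc n →L[ℝ] ℂ)‖ ≤ ‖x‖ := by
        refine (ContinuousLinearMap.opNorm_comp_le _ _).trans ?_
        simp
      have h2 := norm_polyGauss_le a b j τ x
      calc ‖2 * Real.pi * I * τ‖ * ‖polyGauss a b j τ x‖ *
          ‖(ofRealCLM ∘L innerSL ℝ x : Euc n →L[ℝ] ℂ)‖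
          ≤ ‖2 * Real.pi * I * τ‖ * (‖clin a b‖ ^ j * (‖x‖ ^ j *
            Real.exp (-(Real.pi * τ.im) * ‖x‖ ^ 2))) * ‖x‖ := by gcongr
        _ = ‖2 * Real.pi * I * τ‖ * ‖clin a b‖ ^ j * (‖x‖ ^ (j + 1) *
            Real.exp (-(Real.pi * τ.im) * ‖x‖ ^ 2)) := by ring
        _ ≤ _ := by gcongr; linarith

lemma fourier_fderiv_apply {f : Euc n → ℂ} (hf : Integrable f) (hd : Differentiable ℝ f)
    (hf' : Integrable (fderiv ℝ f)) (v w : Euc n) :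
    𝓕 (fun x => fderiv ℝ f x v) w = 2 * Real.pi * I * (inner ℝ v w : ℝ) * 𝓕 f w := by
  rw [← Real.fourier_continuousLinearMap_apply hf', Real.fourier_fderiv hf hd hf',
    VectorFourier.fourierSMulRight_apply]
  have e : (innerSL ℝ w) v = inner ℝ v w := by rw [innerSL_apply_apply, real_inner_comm]
  change -(2 * Real.pi * I) • (-(innerSL ℝ w) v) • 𝓕 f w = _
  rw [e]
  simp only [smul_eq_mul, Complex.real_smul, ofReal_neg]
  ring

/-- `a`, `b` span the isotropic complex line of `a + i b`. -/
def IsIsotropic (a b : Euc n) : Prop := inner ℝ a a = (inner ℝ b b : ℝ) ∧ inner ℝ a b = (0 : ℝ)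

/-- For `a + ib` isotropic, `∂_a + i∂_b` annihilates `clin a b`. It therefore acts on `polyGauss a b
j τ` only through the Gaussian and gives `2πiτ` times the function with `j + 1`. On the Fourier side
the operator is multiplication by `2πi · clin a b w`. -/
lemma fourier_polyGauss_succ {a b : Euc n} (hab : IsIsotropic a b) (j : ℕ) {τ : ℂ}
    (hτ : 0 < τ.im) (w : Euc n) :
    𝓕 (polyGauss a b (j + 1) τ) w = τ⁻¹ * clin a b w * 𝓕 (polyGauss a b j τ) w := by
  have hi := (isRapid_polyGauss a b j hτ).integrable
  have hd : Differentiable ℝ (polyGauss a b j τ) := fun x =>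
    (hasFDerivAt_polyGauss a b j τ x).differentiableAt
  have hf' := integrable_fderiv_polyGauss a b j hτ
  have ha := fourier_fderiv_apply hi hd hf' a w
  have hb := fourier_fderiv_apply hi hd hf' b w
  have hia : Integrable fun x => fderiv ℝ (polyGauss a b j τ) x a :=
    (ContinuousLinearMap.apply ℝ ℂ a).integrable_comp hf'
  have hib : Integrable fun x => fderiv ℝ (polyGauss a b j τ) x b :=
    (ContinuousLinearMap.apply ℝ ℂ b).integrable_comp hf'
  have key : ∀ x, fderiv ℝ (polyGauss a b j τ) x a + I * fderiv ℝ (polyGauss a b j τ) x b =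
      2 * Real.pi * I * τ * polyGauss a b (j + 1) τ x := by
    intro x
    rw [(hasFDerivAt_polyGauss a b j τ x).fderiv]
    have e1 : clin a b a + I * clin a b b = 0 := by
      rw [clin_apply, clin_apply, real_inner_comm a b, hab.2, hab.1, ofReal_zero]
      linear_combination ((inner ℝ b b : ℝ) : ℂ) * I_mul_I
    have e2 : ((inner ℝ x a : ℝ) : ℂ) + I * (inner ℝ x b : ℝ) = clin a b x := by
      rw [clin_apply, real_inner_comm, real_inner_comm b]
    simp only [add_apply, smul_apply, smul_eq_mul,
      ContinuousLinearMap.comp_apply, innerSL_apply_apply, ofRealCLM_apply]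
    rw [show polyGauss a b (j + 1) τ x = clin a b x * polyGauss a b j τ x by
      simp only [polyGauss]; ring]
    linear_combination (j * clin a b x ^ (j - 1) * cexp (Real.pi * I * τ * (‖x‖ : ℂ) ^ 2)) * e1 +
      (2 * Real.pi * I * τ * polyGauss a b j τ x) * e2
  have h1 : 𝓕 (fun x => fderiv ℝ (polyGauss a b j τ) x a +
      I * fderiv ℝ (polyGauss a b j τ) x b) w =
      𝓕 (fun x => fderiv ℝ (polyGauss a b j τ) x a) w +
        I * 𝓕 (fun x => fderiv ℝ (polyGauss a b j τ) x b) w := by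
    simp only [Real.fourier_eq, smul_add]
    rw [integral_add, ← integral_const_mul]
    · congr 1
      refine integral_congr_ae (.of_forall fun x => ?_)
      simp [Circle.smul_def]; ring
    · exact (Real.fourierIntegral_convergent_iff w).mpr hia
    · exact (Real.fourierIntegral_convergent_iff w).mpr (hib.const_mul I)
  have h2 : 𝓕 (fun x => 2 * Real.pi * I * τ * polyGauss a b (j + 1) τ x) w =
      2 * Real.pi * I * τ * 𝓕 (polyGauss a b (j + 1) τ) w := by
    simp only [Real.fourier_eq]
    rw [← integral_const_mul]
    refine integral_congr_ae (.of_forall fun x => ?_)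
    simp [Circle.smul_def]; ring
  have h3 : 2 * Real.pi * I * τ * 𝓕 (polyGauss a b (j + 1) τ) w =
      2 * Real.pi * I * clin a b w * 𝓕 (polyGauss a b j τ) w := by
    rw [← h2, ← funext key, h1, ha, hb, clin_apply]
    ring
  have hτ0 : τ ≠ 0 := fun h => by simp [h] at hτ
  have hpi : (2 * Real.pi * I : ℂ) ≠ 0 := Complex.two_pi_I_ne_zero
  field_simp
  refine mul_left_cancel₀ hpi ?_
  linear_combination h3

/-- The Fourier transform of `(a⬝x + i b⬝x)^j exp(πiτ|x|²)` on `ℝ^{2k}`, for `a + ib` isotropic. -/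
theorem fourier_polyGauss {k : ℕ} (hk : n = 2 * k) {a b : Euc n} (hab : IsIsotropic a b) (j : ℕ)
    {τ : ℂ} (hτ : 0 < τ.im) :
    𝓕 (polyGauss a b j τ) = fun w => I ^ k * (τ⁻¹) ^ (k + j) * polyGauss a b j (-τ⁻¹) w := by
  have hτ0 : τ ≠ 0 := fun h => by simp [h] at hτ
  funext w
  induction j with
  | zero =>
    -- Base case: the factor `(π/(-πiτ))^(n/2) = (iτ⁻¹)^k` is an integral power because `n = 2k`, so
    -- no branch of a root is involved.
    have hre : 0 < (-(Real.pi * I * τ)).re := by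
      simp; positivity
    have h := fourier_gaussian_innerProductSpace hre w
    rw [finrank_euclideanSpace_fin] at h
    have e0 : polyGauss a b 0 τ = fun v => cexp (-(-(Real.pi * I * τ)) * (‖v‖ : ℂ) ^ 2) := by
      funext v; simp [polyGauss]
    have hp : (Real.pi : ℂ) ≠ 0 := by exact_mod_cast Real.pi_ne_zero
    have e1 : (Real.pi / -(Real.pi * I * τ) : ℂ) = I * τ⁻¹ := by
      field_simp; simp
    have e2 : ((n : ℂ) / 2) = (k : ℂ) := by rw [hk]; push_cast; ring
    rw [e0, h, e1, e2, cpow_natCast, polyGauss, pow_zero, one_mul, mul_pow, add_zero]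
    congr 2
    field_simp
    ring_nf
    simp
  | succ j ih =>
    rw [fourier_polyGauss_succ hab j hτ, ih]
    simp only [polyGauss]
    ring

end PolyGauss
end ModularLattice
end

noncomputable section

namespace ModularLattice

open MeasureTheory Complex
open scoped FourierTransform

/-! ### Theta series and their transformation under `Γ₀(ℓ)` -/

section Theta

variable {n : ℕ}

/-- The theta series `∑_{x ∈ L} (a⬝x + i b⬝x)^j exp(πiτ|x|²)`. -/
def isoTheta (L : Submodule ℤ (Euc n)) (a b : Euc n) (j : ℕ) (τ : ℂ) : ℂ :=
  ∑' x : L, polyGauss a b j τ x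

/-- Poisson summation for `polyGauss`. The constant is independent of `τ` and `v`, so its value is
not needed when the formula is used at two different points. -/
lemma exists_theta_inversion {k : ℕ} (hk : n = 2 * k) (L : Submodule ℤ (Euc n))
    [DiscreteTopology L] [IsZLattice ℝ L] {a b : Euc n} (hab : IsIsotropic a b) (j : ℕ) :
    ∃ c : ℂ, ∀ τ : ℂ, 0 < τ.im → ∀ v : Euc n,
      ∑' x : L, polyGauss a b j τ (v + x) =
        c * (τ⁻¹) ^ (k + j) * ∑' y : dualLattice L,
          polyGauss a b j (-τ⁻¹) y * cexp (2 * Real.pi * I * (inner ℝ v (y : Euc n) : ℝ)) := by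
  obtain ⟨c, hc⟩ := exists_poisson_lattice L
  refine ⟨c * I ^ k, fun τ hτ v => ?_⟩
  have hτ' : 0 < (-τ⁻¹).im := by
    have h0 : τ ≠ 0 := fun h => by simp [h] at hτ
    rw [neg_im, inv_im, neg_div, neg_neg]
    exact div_pos hτ (normSq_pos.mpr h0)
  have h := hc _ (isRapid_polyGauss a b j hτ) (by
    rw [fourier_polyGauss hk hab j hτ]
    obtain ⟨h1, K, r, hr, h2⟩ := isRapid_polyGauss a b j hτ'
    refine ⟨h1.const_mul _, ‖I ^ k * (τ⁻¹) ^ (k + j)‖ * K, r, hr, fun x => ?_⟩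
    rw [norm_mul, mul_assoc]
    exact mul_le_mul_of_nonneg_left (h2 x) (norm_nonneg _)) v
  rw [h, fourier_polyGauss hk hab j hτ]
  simp only [mul_assoc, tsum_mul_left]

/-- Division with remainder, coordinatewise. -/
def divModPi (n d : ℕ) [NeZero d] :
    (Fin n → ZMod d) × (Fin n → ℤ) ≃ (Fin n → ℤ) where
  toFun p i := ((p.1 i).val : ℤ) + d * p.2 i
  invFun m := (fun i => (m i : ZMod d), fun i => m i / d)
  left_inv p := by
    have hd : (d : ℤ) ≠ 0 := by exact_mod_cast NeZero.ne d
    ext i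
    · simp
    · simp only
      rw [Int.add_mul_ediv_left _ _ hd, Int.ediv_eq_zero_of_lt (by positivity)
        (by exact_mod_cast ZMod.val_lt _), zero_add]
  right_inv m := by
    ext i
    simp only [ZMod.val_intCast]
    exact Int.emod_add_mul_ediv _ _

/-- Splitting of a sum over a lattice into cosets modulo `d`. -/
lemma tsum_span_divMod (B : Module.Basis (Fin n) ℝ (Euc n)) (d : ℕ) [NeZero d] {F : Euc n → ℂ}
    (hF : Summable fun x : Submodule.span ℤ (Set.range B) => F x) :
    ∑' x : Submodule.span ℤ (Set.range B), F x =
      ∑ r : Fin n → ZMod d, ∑' y : Submodule.span ℤ (Set.range B),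
        F ((spanEquiv B fun i => ((r i).val : ℤ) : Euc n) + (d : ℝ) • (y : Euc n)) := by
  have hF' : Summable fun m : Fin n → ℤ => F (spanEquiv B m) :=
    ((spanEquiv B).summable_iff
      (f := fun y : Submodule.span ℤ (Set.range B) => F (y : Euc n))).mpr hF
  have hF'' := (divModPi n d).summable_iff.mpr hF'
  rw [← (spanEquiv B).tsum_eq, ← (divModPi n d).tsum_eq]
  refine hF''.tsum_prod.trans ?_
  rw [tsum_fintype]
  refine Finset.sum_congr rfl fun r _ => ?_
  rw [← (spanEquiv B).tsum_eq]
  refine tsum_congr fun q => ?_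
  refine congrArg F ?_
  rw [spanEquiv_apply, spanEquiv_apply, spanEquiv_apply, ← map_smul, ← map_add]
  refine congrArg _ ?_
  ext i
  simp [divModPi]

/-- Polarization: `2 x·y = |x + y|² − |x|² − |y|²` is a combination of even integers. -/
lemma IsEvenLattice.exists_inner_eq {L : Submodule ℤ (Euc n)} (hL : IsEvenLattice L)
    {x y : Euc n} (hx : x ∈ L) (hy : y ∈ L) : ∃ z : ℤ, inner ℝ x y = (z : ℝ) := by
  obtain ⟨p, hp⟩ := hL _ (L.add_mem hx hy)
  obtain ⟨q, hq⟩ := hL x hx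
  obtain ⟨r, hr⟩ := hL y hy
  refine ⟨p - q - r, ?_⟩
  rw [real_inner_add_add_self] at hp
  push_cast
  linarith

/-- The phase `exp(πi (b/d) |x|²)`. -/
def quadPhase (β : ℝ) (x : Euc n) : ℂ := cexp (Real.pi * I * (β * inner ℝ x x : ℝ))

lemma cexp_pi_int (t : ℝ) (z : ℤ) :
    cexp (Real.pi * I * (t + 2 * z : ℝ)) = cexp (Real.pi * I * (t : ℝ)) := by
  rw [← Complex.exp_periodic.int_mul z (Real.pi * I * (t : ℝ))]
  congr 1
  push_cast
  ring

/-- Evenness makes the phase well defined on `L/dL`: the cross term `2b x·y` and the square term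
`bd|y|²` are both even integers. -/
lemma quadPhase_add_smul {L : Submodule ℤ (Euc n)} (hL : IsEvenLattice L) (b : ℤ) {d : ℕ}
    (hd : d ≠ 0) {x y : Euc n} (hx : x ∈ L) (hy : y ∈ L) :
    quadPhase (b / d) (x + (d : ℝ) • y) = quadPhase (b / d) x := by
  obtain ⟨p, hp⟩ := hL.exists_inner_eq hx hy
  obtain ⟨q, hq⟩ := hL y hy
  have hd' : (d : ℝ) ≠ 0 := by exact_mod_cast hd
  rw [quadPhase, quadPhase, ← cexp_pi_int _ (-(b * p + b * d * q))]
  congr 3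
  rw [real_inner_add_add_self, inner_smul_left, inner_smul_right, inner_smul_right, hp, hq]
  push_cast
  simp only [conj_trivial]
  field_simp
  ring

/-- The Gauss sum `∑_{x ∈ L/dL} exp(πi (b/d) |x|²)`, in coordinates. -/
def latticeGaussSum (B : Module.Basis (Fin n) ℝ (Euc n)) (b : ℤ) (d : ℕ) [NeZero d] : ℂ :=
  ∑ r : Fin n → ZMod d, quadPhase (b / d) (spanEquiv B fun i => ((r i).val : ℤ) : Euc n)

/-- Translation permutes the classes of `L/dL`, and the phase depends only on the class; `q` below
measures the change of representative. -/
lemma latticeGaussSum_shift (B : Module.Basis (Fin n) ℝ (Euc n))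
    (hL : IsEvenLattice (Submodule.span ℤ (Set.range B))) (b : ℤ) (d : ℕ) [NeZero d]
    {w : Euc n} (hw : w ∈ Submodule.span ℤ (Set.range B)) :
    ∑ r : Fin n → ZMod d, quadPhase (b / d) ((spanEquiv B fun i => ((r i).val : ℤ) : Euc n) + w)
      = latticeGaussSum B b d := by
  obtain ⟨m, hm⟩ := (spanEquiv B).surjective ⟨w, hw⟩
  have hm' : (spanEquiv B m : Euc n) = w := by rw [hm]
  refine Fintype.sum_equiv (Equiv.addRight fun i => (m i : ZMod d)) _ _ fun r => ?_
  set s : Fin n → ZMod d := r + fun i => (m i : ZMod d) with hs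
  have hdiv : ∀ i, (d : ℤ) ∣ ((r i).val : ℤ) + m i - ((s i).val : ℤ) := by
    intro i
    rw [← ZMod.intCast_zmod_eq_zero_iff_dvd]
    push_cast
    simp [hs]
  choose q hq using hdiv
  have e : (spanEquiv B fun i => ((r i).val : ℤ) : Euc n) + w =
      (spanEquiv B fun i => ((s i).val : ℤ) : Euc n) + (d : ℝ) • (spanEquiv B q : Euc n) := by
    rw [← hm', spanEquiv_apply, spanEquiv_apply, spanEquiv_apply, spanEquiv_apply, ← map_smul,
      ← map_add, ← map_add]
    congr 1
    ext i
    have := hq i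
    simp only [Pi.add_apply, Pi.smul_apply, smul_eq_mul]
    have h2 : ((r i).val : ℤ) + m i = ((s i).val : ℤ) + d * q i := by linarith
    exact_mod_cast h2
  rw [e, quadPhase_add_smul hL b (NeZero.ne d) (Subtype.coe_prop _) (Subtype.coe_prop _)]
  rfl

lemma polyGauss_add_real (a b : Euc n) (j : ℕ) (τ : ℂ) (β : ℝ) (x : Euc n) :
    polyGauss a b j (τ + β) x = quadPhase β x * polyGauss a b j τ x := by
  rw [polyGauss, polyGauss, quadPhase, mul_left_comm, ← Complex.exp_add]
  congr 2
  rw [real_inner_self_eq_norm_sq]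
  push_cast
  ring

lemma polyGauss_smul (a b : Euc n) (j : ℕ) (τ : ℂ) (d : ℝ) (x : Euc n) :
    polyGauss a b j τ (d • x) = d ^ j * polyGauss a b j (d ^ 2 * τ) x := by
  rw [polyGauss, polyGauss, map_smul, norm_smul, Complex.real_smul, mul_pow, mul_assoc]
  congr 3
  have : ((‖d‖ * ‖x‖ : ℝ) : ℂ) ^ 2 = (d : ℂ) ^ 2 * (‖x‖ : ℂ) ^ 2 := by
    rw [← ofReal_pow, mul_pow, Real.norm_eq_abs, sq_abs]; push_cast; ring
  rw [this]; ring

/-- The product of the phases of the two Poisson summations is a shifted phase. -/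
lemma quadPhase_sub (a₀ b₀ c₀ : ℤ) {d : ℕ} (hd : d ≠ 0) (hdet : a₀ * d - b₀ * c₀ = 1)
    {x w : Euc n} {p q : ℤ} (hp : inner ℝ x w = (p : ℝ)) (hq : c₀ * inner ℝ w w = (2 * q : ℝ)) :
    quadPhase (b₀ / d) (x + (-c₀ : ℝ) • w) =
      quadPhase (b₀ / d) x * (quadPhase (-(c₀ / d)) w *
        cexp (2 * Real.pi * I * (inner ℝ ((d : ℝ)⁻¹ • x) w : ℝ))) := by
  have hd' : (d : ℝ) ≠ 0 := by exact_mod_cast hd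
  have hdet' : (b₀ : ℝ) * c₀ = a₀ * d - 1 := by
    have : (b₀ : ℝ) * c₀ = ((b₀ * c₀ : ℤ) : ℝ) := by push_cast; ring
    rw [this, show b₀ * c₀ = a₀ * d - 1 by linarith]; push_cast; ring
  rw [quadPhase, quadPhase, quadPhase, ← Complex.exp_add, ← Complex.exp_add]
  have e : (Real.pi * I * (b₀ / d * inner ℝ x x : ℝ) + (Real.pi * I * (-(c₀ / d) * inner ℝ w w : ℝ)
      + 2 * Real.pi * I * (inner ℝ ((d : ℝ)⁻¹ • x) w : ℝ)) : ℂ) =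
      Real.pi * I * (b₀ / d * inner ℝ x x - (c₀ / d) * inner ℝ w w +
        2 * inner ℝ ((d : ℝ)⁻¹ • x) w : ℝ) := by push_cast; ring
  -- Since `b₀c₀ = a₀d − 1`, the cross term is `-2a₀p + 2 x·w/d` and the square term in `w` is `2a₀q
  -- − (c₀/d)|w|²`; the even integer `2(a₀p − a₀q)` makes up the difference.
  rw [e, ← cexp_pi_int _ (a₀ * p - a₀ * q)]
  congr 3
  rw [real_inner_add_add_self, inner_smul_left, inner_smul_right, inner_smul_right,
    inner_smul_left]
  push_cast
  simp only [conj_trivial]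
  field_simp
  linear_combination (-2 * inner ℝ x w + c₀ * inner ℝ w w) * hdet' - 2 * a₀ * d * hp +
    a₀ * d * hq

/-- Transformation of theta series under a matrix `(a, b; c, d)` with `d > 0`, `c L^# ⊆ L` and
`c |w|² ∈ 2ℤ` on `L^#`. -/
theorem isoTheta_transform {k : ℕ} (hk : n = 2 * k) (B : Module.Basis (Fin n) ℝ (Euc n))
    (hL : IsEvenLattice (Submodule.span ℤ (Set.range B))) {a b : Euc n} (hab : IsIsotropic a b)
    (j : ℕ) (a₀ b₀ c₀ : ℤ) (d : ℕ) [NeZero d] (hdet : a₀ * d - b₀ * c₀ = 1)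
    (hc1 : ∀ w ∈ dualLattice (Submodule.span ℤ (Set.range B)),
      (c₀ : ℝ) • w ∈ Submodule.span ℤ (Set.range B))
    (hc2 : ∀ w ∈ dualLattice (Submodule.span ℤ (Set.range B)),
      ∃ q : ℤ, c₀ * inner ℝ w w = (2 * q : ℝ)) {τ : ℂ} (hτ : 0 < τ.im) :
    isoTheta (Submodule.span ℤ (Set.range B)) a b j ((a₀ * τ + b₀) / (c₀ * τ + d)) =
      latticeGaussSum B b₀ d / d ^ k * (c₀ * τ + d) ^ (k + j) *
        isoTheta (Submodule.span ℤ (Set.range B)) a b j τ := by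
  set L := Submodule.span ℤ (Set.range B) with hLdef
  have hd : d ≠ 0 := NeZero.ne d
  have hdC : (d : ℂ) ≠ 0 := by exact_mod_cast hd
  have hdR : (0 : ℝ) < d := by exact_mod_cast Nat.pos_of_ne_zero hd
  have hτ0 : τ ≠ 0 := fun h => by simp [h] at hτ
  have hdetC : (a₀ : ℂ) * d - b₀ * c₀ = 1 := by exact_mod_cast hdet
  have hden : (c₀ : ℂ) * τ + d ≠ 0 := by
    intro h
    have him := congrArg Complex.im h
    simp at him
    rcases him with h0 | h0
    · rw [h0] at h
      simp [hd] at h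
    · exact hτ.ne' h0
  obtain ⟨C, hC⟩ := exists_theta_inversion hk L hab j
  -- With this `σ`, `(a₀τ + b₀)/(c₀τ + d) = σ/d² + b₀/d` and `-1/σ = -1/τ − c₀/d`. On a coset of
  -- `dL` the theta sum is thus a phase times a sum at `σ` over a translate of `L`. Poisson
  -- summation passes to `-1/σ`, the real shift `-c₀/d` becomes another phase, and inversion at `τ`
  -- leads back.
  set σ : ℂ := d * τ / (c₀ * τ + d) with hσ
  have hσinv : -σ⁻¹ = -τ⁻¹ + ((-(c₀ / d) : ℝ) : ℂ) := by
    rw [hσ]; push_cast; field_simp; ring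
  have hτ' : 0 < (-τ⁻¹).im := by
    rw [neg_im, inv_im, neg_div, neg_neg]
    exact div_pos hτ (normSq_pos.mpr hτ0)
  have hσ' : 0 < (-σ⁻¹).im := by
    rw [hσinv, add_im, ofReal_im, add_zero]; exact hτ'
  have hσim : 0 < σ.im := by
    rw [neg_im, inv_im, neg_div, neg_neg] at hσ'
    by_contra h
    exact absurd hσ' (not_lt.mpr (div_nonpos_of_nonpos_of_nonneg (not_lt.mp h) (normSq_nonneg _)))
  have hA : (a₀ * τ + b₀) / (c₀ * τ + d) = ((d : ℝ)⁻¹ : ℂ) ^ 2 * σ + ((b₀ / d : ℝ) : ℂ) := by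
    have e : ((d : ℝ)⁻¹ : ℂ) ^ 2 * (d * τ / (c₀ * τ + d)) + ((b₀ / d : ℝ) : ℂ) =
        (τ + b₀ * (c₀ * τ + d)) / (d * (c₀ * τ + d)) := by
      push_cast
      generalize (c₀ : ℂ) * τ + d = D at hden
      field_simp
    rw [hσ, e, div_eq_div_iff hden (mul_ne_zero hdC hden)]
    linear_combination τ * (c₀ * τ + d) * hdetC
  have hAim : 0 < (((d : ℝ)⁻¹ : ℂ) ^ 2 * σ).im := by
    rw [← ofReal_inv, ← ofReal_pow, Complex.im_ofReal_mul]
    positivity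
  have hterm : ∀ (r : Fin n → ZMod d) (y : L),
      polyGauss a b j ((a₀ * τ + b₀) / (c₀ * τ + d))
        ((spanEquiv B fun i => ((r i).val : ℤ) : Euc n) + (d : ℝ) • (y : Euc n)) =
      quadPhase (b₀ / d) (spanEquiv B fun i => ((r i).val : ℤ) : Euc n) * d ^ j *
        polyGauss a b j σ ((d : ℝ)⁻¹ • (spanEquiv B fun i => ((r i).val : ℤ) : Euc n) + y) := by
    intro r y
    rw [hA, polyGauss_add_real, quadPhase_add_smul hL b₀ hd (Subtype.coe_prop _)
      (Subtype.coe_prop _), mul_assoc]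
    congr 1
    have : (spanEquiv B fun i => ((r i).val : ℤ) : Euc n) + (d : ℝ) • (y : Euc n) =
        (d : ℝ) • ((d : ℝ)⁻¹ • (spanEquiv B fun i => ((r i).val : ℤ) : Euc n) + (y : Euc n)) := by
      rw [smul_add, smul_smul, mul_inv_cancel₀ hdR.ne', one_smul]
    rw [this, polyGauss_smul]
    congr 2
    push_cast
    field_simp
  have hsum0 := (isRapid_polyGauss a b j (τ := (a₀ * τ + b₀) / (c₀ * τ + d)) (by
    rw [hA, add_im, ofReal_im, add_zero]; exact hAim)).summable L 0
  simp only [zero_add] at hsum0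
  have hinv := hC τ hτ 0
  simp only [zero_add, inner_zero_left, ofReal_zero, mul_zero, Complex.exp_zero, mul_one] at hinv
  have hsumw : ∀ r : Fin n → ZMod d, Summable fun w : dualLattice L =>
      quadPhase (b₀ / d) (spanEquiv B fun i => ((r i).val : ℤ) : Euc n) *
      (polyGauss a b j (-σ⁻¹) w * cexp (2 * Real.pi * I *
        (inner ℝ ((d : ℝ)⁻¹ • (spanEquiv B fun i => ((r i).val : ℤ) : Euc n)) (w : Euc n) : ℝ))) := by
    intro r
    refine Summable.mul_left _ ?_
    have h := (isRapid_polyGauss a b j hσ').summable (dualLattice L) 0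
    simp only [zero_add] at h
    refine Summable.of_norm (h.norm.congr fun w => ?_)
    rw [norm_mul, Complex.norm_exp]
    simp [Complex.mul_re]
  rw [isoTheta, tsum_span_divMod B d hsum0]
  simp only [hterm]
  simp only [tsum_mul_left]
  -- The phases combine into one translated by `-c₀w ∈ L`, so the sum over residues is the same
  -- Gauss sum for every dual vector `w`.
  have hG : ∀ w : dualLattice L, ∑ r : Fin n → ZMod d,
      quadPhase (b₀ / d) (spanEquiv B fun i => ((r i).val : ℤ) : Euc n) *
      (polyGauss a b j (-σ⁻¹) w * cexp (2 * Real.pi * I *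
        (inner ℝ ((d : ℝ)⁻¹ • (spanEquiv B fun i => ((r i).val : ℤ) : Euc n)) (w : Euc n) : ℝ))) =
      latticeGaussSum B b₀ d * polyGauss a b j (-τ⁻¹) w := by
    intro w
    have hw := w.2
    have hcw : (-c₀ : ℝ) • (w : Euc n) ∈ L := by
      rw [neg_smul]; exact L.neg_mem (hc1 _ hw)
    obtain ⟨q, hq⟩ := hc2 _ hw
    rw [← latticeGaussSum_shift B hL b₀ d hcw, Finset.sum_mul]
    refine Finset.sum_congr rfl fun r _ => ?_
    have hmem : inner ℝ (w : Euc n) (spanEquiv B fun i => ((r i).val : ℤ) : Euc n) ∈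
        (1 : Submodule ℤ ℝ) := hw _ (Subtype.coe_prop _)
    obtain ⟨p, hp⟩ := Submodule.mem_one.mp hmem
    rw [quadPhase_sub a₀ b₀ c₀ hd hdet (p := p) (by rw [real_inner_comm, ← hp]; simp) hq,
      hσinv, polyGauss_add_real]
    ring
  calc _ = C * (d : ℂ) ^ j * (σ⁻¹) ^ (k + j) * ∑ r : Fin n → ZMod d, ∑' w : dualLattice L,
      quadPhase (b₀ / d) (spanEquiv B fun i => ((r i).val : ℤ) : Euc n) *
      (polyGauss a b j (-σ⁻¹) w * cexp (2 * Real.pi * I *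
        (inner ℝ ((d : ℝ)⁻¹ • (spanEquiv B fun i => ((r i).val : ℤ) : Euc n)) (w : Euc n) : ℝ))) := by
        rw [Finset.mul_sum]
        refine Finset.sum_congr rfl fun r _ => ?_
        rw [tsum_mul_left, show (∑' x : Submodule.span ℤ (Set.range B), polyGauss a b j σ
          ((d : ℝ)⁻¹ • (spanEquiv B fun i => ((r i).val : ℤ) : Euc n) + x)) = _ from hC σ hσim _]
        ring
    _ = C * (d : ℂ) ^ j * (σ⁻¹) ^ (k + j) *
        (latticeGaussSum B b₀ d * ∑' w : dualLattice L, polyGauss a b j (-τ⁻¹) w) := by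
        rw [← Summable.tsum_finsetSum fun r _ => hsumw r]
        simp only [hG, tsum_mul_left]
    _ = _ := by
        rw [isoTheta, hinv, hσ, inv_div, div_pow, mul_pow, inv_pow, pow_add (d : ℂ)]
        field_simp

end Theta
end ModularLattice
end

noncomputable section

namespace ModularLattice

/-! ### Quadratic Gauss sums in several variables -/

section GaussSum

variable {F : Type*} [Field F] [Fintype F] [DecidableEq F]

/-- The quadratic character with complex values. -/
def quadCharC (F : Type*) [Field F] [Fintype F] [DecidableEq F] : MulChar F ℂ :=
  (quadraticChar F).ringHomComp (Int.castRingHom ℂ)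

lemma quadCharC_apply (a : F) : quadCharC F a = (quadraticChar F a : ℂ) := rfl

lemma quadCharC_sq {a : F} (ha : a ≠ 0) : quadCharC F (a ^ 2) = 1 := by
  rw [quadCharC_apply, quadraticChar_sq_one' ha]; simp

lemma addChar_map_sum {A ι : Type*} [AddCommMonoid A] [Fintype ι] (ψ : AddChar A ℂ) (f : ι → A) :
    ψ (∑ i, f i) = ∏ i, ψ (f i) := by
  classical
  induction (Finset.univ : Finset ι) using Finset.induction_on with
  | empty => simp
  | insert i s hi ih => rw [Finset.sum_insert hi, Finset.prod_insert hi, AddChar.map_add_eq_mul, ih]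

/-- Each `s` has `1 + χ(s)` square roots; the constant part sums to zero and the rest is a Gauss sum
for a shifted additive character. -/
lemma sum_sq_addChar (hF : ringChar F ≠ 2) {ψ : AddChar F ℂ} (hψ : ψ.IsPrimitive) {w : F}
    (hw : w ≠ 0) : ∑ t : F, ψ (w * t ^ 2) = quadCharC F w * gaussSum (quadCharC F) ψ := by
  have h1 : ∑ t : F, ψ (w * t ^ 2) = ∑ s : F, ((quadraticChar F s + 1 : ℤ) : ℂ) * ψ (w * s) := by
    rw [← Finset.sum_fiberwise Finset.univ (fun t : F => t ^ 2)]
    refine Finset.sum_congr rfl fun s _ => ?_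
    rw [← quadraticChar_card_sqrts hF s, Finset.sum_congr rfl (g := fun _ => ψ (w * s))]
    · rw [Finset.sum_const, nsmul_eq_mul, Int.cast_natCast]
      congr 3
      ext t; simp
    · intro t ht
      rw [(Finset.mem_filter.mp ht).2]
  have h2 : ∑ s : F, ψ (w * s) = 0 := by
    have := AddChar.sum_mulShift (ψ := ψ) w hψ
    simpa [hw, mul_comm] using this
  have h3 := gaussSum_mulShift (quadCharC F) ψ (Units.mk0 w hw)
  simp only [Units.val_mk0] at h3
  have h4 : quadCharC F w * quadCharC F w = 1 := by
    rw [← map_mul, ← pow_two, quadCharC_sq hw]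
  rw [h1, ← h3, ← mul_assoc, h4, one_mul, gaussSum]
  simp only [Int.cast_add, Int.cast_one, add_mul, one_mul, Finset.sum_add_distrib, h2, add_zero]
  rfl

/-- The Gauss sum of a nondegenerate quadratic form over a finite field of odd characteristic. -/
theorem sum_quadForm_addChar (hF : ringChar F ≠ 2) {ψ : AddChar F ℂ} (hψ : ψ.IsPrimitive) {n : ℕ}
    (M : Matrix (Fin n) (Fin n) F) (hM : M.IsSymm) (hdet : M.det ≠ 0) :
    ∑ r : Fin n → F, ψ (r ⬝ᵥ M.mulVec r) =
      quadCharC F M.det * gaussSum (quadCharC F) ψ ^ n := by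
  have : Invertible (2 : F) := invertibleOfNonzero (Ring.two_ne_zero hF)
  have hB : LinearMap.IsSymm (Matrix.toBilin' M) := by
    refine ⟨fun x y => ?_⟩
    simp only [Matrix.toBilin'_apply', RingHom.id_apply]
    rw [dotProduct_comm, ← Matrix.vecMul_transpose, ← Matrix.dotProduct_mulVec, hM.eq]
  -- Since `2` is invertible, an orthogonal basis exists and splits the sum into one-variable sums.
  -- The product of the diagonal entries is `det M` times a square, which the quadratic character
  -- does not see.
  obtain ⟨v0, hv0⟩ := LinearMap.BilinForm.exists_orthogonal_basis hB
  let v : Module.Basis (Fin n) F (Fin n → F) := v0.reindex (finCongr (by simp))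
  have hv : ∀ i j, i ≠ j → Matrix.toBilin' M (v i) (v j) = 0 := by
    intro i j hij
    simp only [v, Module.Basis.reindex_apply]
    exact hv0 (fun h => hij (by simpa using h))
  set w : Fin n → F := fun i => Matrix.toBilin' M (v i) (v i) with hw
  set P := (Pi.basisFun F (Fin n)).toMatrix v with hP
  have hdiag : P.transpose * M * P = Matrix.diagonal w := by
    have := LinearMap.BilinForm.toMatrix_mul_basis_toMatrix (Pi.basisFun F (Fin n)) v
      (Matrix.toBilin' M)
    rw [LinearMap.BilinForm.toMatrix_basisFun, LinearMap.BilinForm.toMatrix'_toBilin'] at this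
    rw [this]
    ext i j
    rw [LinearMap.BilinForm.toMatrix_apply, Matrix.diagonal_apply]
    split_ifs with h
    · rw [h]
    · exact hv i j h
  have hPdet : P.det ≠ 0 := by
    have : Invertible P := Module.Basis.invertibleToMatrix _ _
    exact (Matrix.isUnit_det_of_invertible P).ne_zero
  have hprod : ∏ i, w i = P.det ^ 2 * M.det := by
    rw [← Matrix.det_diagonal, ← hdiag, Matrix.det_mul, Matrix.det_mul, Matrix.det_transpose]
    ring
  have hw0 : ∀ i, w i ≠ 0 := by
    intro i h
    have : ∏ i, w i = 0 := Finset.prod_eq_zero (Finset.mem_univ i) h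
    rw [hprod] at this
    exact mul_ne_zero (pow_ne_zero _ hPdet) hdet this
  have hquad : ∀ c : Fin n → F, (v.equivFun.symm c) ⬝ᵥ M.mulVec (v.equivFun.symm c) =
      ∑ i, w i * c i ^ 2 := by
    intro c
    rw [← Matrix.toBilin'_apply', Module.Basis.equivFun_symm_apply]
    simp only [map_sum, LinearMap.sum_apply, map_smul, LinearMap.smul_apply, smul_eq_mul]
    refine Finset.sum_congr rfl fun i _ => ?_
    rw [Finset.sum_eq_single i]
    · simp only [hw]; ring
    · intro j _ hj
      rw [hv j i hj]; ring
    · simp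
  calc ∑ r : Fin n → F, ψ (r ⬝ᵥ M.mulVec r)
      = ∑ c : Fin n → F, ψ (∑ i, w i * c i ^ 2) := by
        rw [← v.equivFun.symm.toEquiv.sum_comp]
        refine Finset.sum_congr rfl fun c _ => ?_
        exact congrArg ψ (hquad c)
    _ = ∑ c : Fin n → F, ∏ i, ψ (w i * c i ^ 2) := by
        refine Finset.sum_congr rfl fun c _ => ?_
        exact addChar_map_sum ψ _
    _ = ∏ i, ∑ t : F, ψ (w i * t ^ 2) := by
        rw [Finset.prod_univ_sum, Fintype.piFinset_univ]
    _ = ∏ i, (quadCharC F (w i) * gaussSum (quadCharC F) ψ) :=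
        Finset.prod_congr rfl fun i _ => sum_sq_addChar hF hψ (hw0 i)
    _ = _ := by
        rw [Finset.prod_mul_distrib, ← map_prod, hprod, map_mul, quadCharC_sq hPdet, one_mul]
        simp

/-- The square of the quadratic Gauss sum is `χ(-1)` times the order of the field. -/
lemma gaussSum_quadCharC_pow (hF : ringChar F ≠ 2) {ψ : AddChar F ℂ} (hψ : ψ.IsPrimitive) (k : ℕ) :
    gaussSum (quadCharC F) ψ ^ (2 * k) = quadCharC F ((-1) ^ k) * (Fintype.card F : ℂ) ^ k := by
  have h1 : quadCharC F ≠ 1 := by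
    intro h
    refine quadraticChar_ne_one hF ?_
    ext a
    have := congrArg (fun χ : MulChar F ℂ => χ a) h
    simp only [quadCharC_apply, MulChar.one_apply_coe] at this
    simpa using this
  have h2 : (quadCharC F).IsQuadratic := by
    exact (quadraticChar_isQuadratic F).comp _
  rw [pow_mul, gaussSum_sq h1 h2 hψ, mul_pow, map_pow]

end GaussSum
end ModularLattice
end

noncomputable section

namespace ModularLattice

open Complex

/-! ### Gram matrices of modular lattices -/

section Gram

variable {n : ℕ}

lemma det_map_intCast {R : Type*} [CommRing R] (A : Matrix (Fin n) (Fin n) ℤ) :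
    (A.map (Int.castRingHom R)).det = (A.det : R) :=
  ((Int.castRingHom R).map_det A).symm

/-- `A` is the (integral) Gram matrix of the basis `B`. -/
def IsGram (B : Module.Basis (Fin n) ℝ (Euc n)) (A : Matrix (Fin n) (Fin n) ℤ) : Prop :=
  ∀ i j, (A i j : ℝ) = inner ℝ (B i) (B j)

lemma IsEvenLattice.exists_gram {B : Module.Basis (Fin n) ℝ (Euc n)}
    (hL : IsEvenLattice (Submodule.span ℤ (Set.range B))) : ∃ A, IsGram B A := by
  have : ∀ i j, ∃ z : ℤ, inner ℝ (B i) (B j) = (z : ℝ) := fun i j =>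
    hL.exists_inner_eq (Submodule.subset_span ⟨i, rfl⟩) (Submodule.subset_span ⟨j, rfl⟩)
  choose A hA using this
  exact ⟨A, fun i j => (hA i j).symm⟩

lemma IsGram.isSymm {B : Module.Basis (Fin n) ℝ (Euc n)} {A : Matrix (Fin n) (Fin n) ℤ}
    (hA : IsGram B A) : A.IsSymm := by
  ext i j
  have : (A j i : ℝ) = A i j := by rw [hA, hA, real_inner_comm]
  exact_mod_cast this

lemma IsGram.inner_self {B : Module.Basis (Fin n) ℝ (Euc n)} {A : Matrix (Fin n) (Fin n) ℤ}
    (hA : IsGram B A) (m : Fin n → ℤ) :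
    inner ℝ (spanEquiv B m : Euc n) (spanEquiv B m : Euc n) = ((m ⬝ᵥ A.mulVec m : ℤ) : ℝ) := by
  rw [spanEquiv_apply, Module.Basis.equivFun_symm_apply]
  simp only [sum_inner, inner_sum, inner_smul_left, inner_smul_right, dotProduct, Matrix.mulVec,
    Int.cast_sum, Int.cast_mul, hA _ _, conj_trivial, Finset.mul_sum]
  refine Finset.sum_congr rfl fun i _ => Finset.sum_congr rfl fun j _ => ?_
  rw [real_inner_comm]
  ring_nf

/-- The Gram matrix is `X Xᵀ` with `X` invertible. Positivity later selects the root `ℓ^k` of `(det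
A)² = ℓ^n`. -/
lemma IsGram.det_pos {B : Module.Basis (Fin n) ℝ (Euc n)} {A : Matrix (Fin n) (Fin n) ℤ}
    (hA : IsGram B A) : 0 < A.det := by
  set X : Matrix (Fin n) (Fin n) ℝ := Matrix.of fun i j => B i j with hX
  have h1 : A.map (Int.castRingHom ℝ) = X * X.transpose := by
    ext i j
    simp only [Matrix.map_apply, Matrix.mul_apply, Matrix.transpose_apply, hX, Matrix.of_apply]
    have := hA i j
    simp only [eq_intCast]
    rw [this, PiLp.inner_apply]
    simp [mul_comm]
  have h2 : ((A.det : ℤ) : ℝ) = X.det ^ 2 := by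
    rw [← det_map_intCast, h1, Matrix.det_mul, Matrix.det_transpose, pow_two]
  have h3 : X.det ≠ 0 := by
    have hXe : X.transpose = (EuclideanSpace.basisFun (Fin n) ℝ).toBasis.toMatrix B := by
      ext i j
      simp [hX, Module.Basis.toMatrix_apply]
    have : Invertible ((EuclideanSpace.basisFun (Fin n) ℝ).toBasis.toMatrix B) :=
      Module.Basis.invertibleToMatrix _ _
    rw [← Matrix.det_transpose, hXe]
    exact (Matrix.isUnit_det_of_invertible _).ne_zero
  have : (0 : ℝ) < A.det := by rw [h2]; positivity
  exact_mod_cast this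

lemma latticeGaussSum_one (B : Module.Basis (Fin n) ℝ (Euc n)) (b : ℤ) :
    latticeGaussSum B b 1 = 1 := by
  rw [latticeGaussSum, Fintype.sum_eq_single (0 : Fin n → ZMod 1)]
  · have : (spanEquiv B fun i => (((0 : Fin n → ZMod 1) i).val : ℤ) : Euc n) = 0 := by
      rw [spanEquiv_apply]
      have : (fun i => (((((0 : Fin n → ZMod 1) i).val : ℤ)) : ℝ)) = 0 := by ext; simp
      rw [this, map_zero]
    rw [this]
    simp [quadPhase]
  · intro x hx
    exact absurd (Subsingleton.elim x 0) hx

/-- Evaluation of the Gauss sum of an even lattice modulo an odd prime not dividing `b det L`. -/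
theorem latticeGaussSum_prime {k : ℕ} (hk : n = 2 * k) {B : Module.Basis (Fin n) ℝ (Euc n)}
    (hL : IsEvenLattice (Submodule.span ℤ (Set.range B))) {A : Matrix (Fin n) (Fin n) ℤ}
    (hA : IsGram B A) (b : ℤ) (p : ℕ) [Fact p.Prime] (hp2 : p ≠ 2) (hb : (b : ZMod p) ≠ 0)
    (hdet : (A.det : ZMod p) ≠ 0) :
    latticeGaussSum B b p = (jacobiSym ((-1) ^ k * A.det) p : ℂ) * (p : ℂ) ^ k := by
  have hF : ringChar (ZMod p) ≠ 2 := by rwa [ZMod.ringChar_zmod_n]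
  have h2 : (2 : ZMod p) ≠ 0 := Ring.two_ne_zero hF
  -- Evenness gives `|x|² = 2N`, so the phase is `exp(2πi bN/p)`; modulo `p`, `N` is half the Gram
  -- form, hence the factor `b/2`.
  set M : Matrix (Fin n) (Fin n) (ZMod p) :=
    ((b : ZMod p) / 2) • A.map (Int.castRingHom (ZMod p)) with hM
  have hMsymm : M.IsSymm := by
    have := hA.isSymm.map (Int.castRingHom (ZMod p))
    exact this.smul _
  have hMdet : M.det = ((b : ZMod p) / 2) ^ n * (A.det : ZMod p) := by
    rw [hM, Matrix.det_smul, Fintype.card_fin]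
    rw [det_map_intCast]
  have hb2 : (b : ZMod p) / 2 ≠ 0 := div_ne_zero hb h2
  have hMdet0 : M.det ≠ 0 := by
    rw [hMdet]; exact mul_ne_zero (pow_ne_zero _ hb2) hdet
  have hψ := ZMod.isPrimitive_stdAddChar p
  have hterm : ∀ r : Fin n → ZMod p,
      quadPhase (b / p) (spanEquiv B fun i => ((r i).val : ℤ) : Euc n) =
        ZMod.stdAddChar (r ⬝ᵥ M.mulVec r) := by
    intro r
    set m : Fin n → ℤ := fun i => ((r i).val : ℤ) with hm
    obtain ⟨N, hN⟩ := hL _ (Subtype.coe_prop (spanEquiv B m))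
    have hN' : m ⬝ᵥ A.mulVec m = 2 * N := by
      rw [hA.inner_self] at hN
      exact_mod_cast hN
    have hr : ∀ i, ((m i : ℤ) : ZMod p) = r i := fun i => by simp [hm]
    have e1 : r ⬝ᵥ M.mulVec r = ((b * N : ℤ) : ZMod p) := by
      have : r ⬝ᵥ (A.map (Int.castRingHom (ZMod p))).mulVec r = ((m ⬝ᵥ A.mulVec m : ℤ) : ZMod p) := by
        simp only [dotProduct, Matrix.mulVec, Matrix.map_apply, eq_intCast]
        push_cast
        simp only [hr]
      rw [hM, Matrix.smul_mulVec, dotProduct_smul, this, hN', smul_eq_mul]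
      push_cast
      field_simp
    rw [e1, ZMod.stdAddChar_coe, quadPhase, hN]
    congr 1
    push_cast
    ring
  -- As `n` is even, `(b/2)^n` is a square, so the value does not depend on `b`.
  have hpow : ∀ x : ZMod p, x ^ n = x ^ (2 * k) := fun x => by rw [hk]
  have hpow' : gaussSum (quadCharC (ZMod p)) ZMod.stdAddChar ^ n =
      gaussSum (quadCharC (ZMod p)) ZMod.stdAddChar ^ (2 * k) := by rw [hk]
  rw [latticeGaussSum, Finset.sum_congr rfl fun r _ => hterm r,
    sum_quadForm_addChar hF hψ M hMsymm hMdet0, hMdet, hpow, hpow', gaussSum_quadCharC_pow hF hψ,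
    map_mul, pow_mul', quadCharC_sq (pow_ne_zero _ hb2), one_mul, ← mul_assoc,
    ← map_mul, ZMod.card, mul_comm (A.det : ZMod p)]
  congr 1
  rw [← jacobiSym.legendreSym.to_jacobiSym, quadCharC_apply, legendreSym]
  push_cast
  rfl

/-- The coordinates of `x` in `B` are its pairings with the dual basis; in effect the bidual lattice
lies in the lattice. -/
lemma mem_span_of_inner_dualBasis (B : Module.Basis (Fin n) ℝ (Euc n)) {x : Euc n}
    (h : ∀ i, ∃ z : ℤ, inner ℝ x (dualBasis B i) = (z : ℝ)) :
    x ∈ Submodule.span ℤ (Set.range B) := by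
  choose m hm using h
  have : x = (spanEquiv B m : Euc n) := by
    rw [spanEquiv_apply]
    apply B.equivFun.injective
    rw [LinearEquiv.apply_symm_apply]
    ext i
    rw [← hm i]
    conv_rhs => rw [← B.sum_equivFun x]
    rw [sum_inner]
    simp only [inner_smul_left, conj_trivial]
    rw [Finset.sum_eq_single i]
    · rw [real_inner_comm, inner_dualBasis]; simp
    · intro j _ hj
      rw [real_inner_comm, inner_dualBasis, if_neg hj]; simp
    · simp
  rw [this]
  exact Subtype.coe_prop _

/-- For an even `ℓ`-modular lattice, `ℓ |w|²` is even on the dual lattice. -/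
lemma even_on_dual {ℓ : ℕ} {L : Submodule ℤ (Euc n)} (hL : IsEvenLattice L)
    (hm : IsModularLattice ℓ L) {w : Euc n} (hw : w ∈ dualLattice L) :
    ∃ q : ℤ, (ℓ : ℝ) * inner ℝ w w = 2 * q := by
  obtain ⟨σ, hσ, hLσ⟩ := hm
  rw [← hσ]
  refine hL _ ?_
  rw [hLσ]
  exact ⟨w, hw, rfl⟩

/-- For an integral `ℓ`-modular lattice, `ℓ L^# ⊆ L`. -/
lemma smul_dual_mem {ℓ : ℕ} {B : Module.Basis (Fin n) ℝ (Euc n)}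
    (hL : IsEvenLattice (Submodule.span ℤ (Set.range B)))
    (hm : IsModularLattice ℓ (Submodule.span ℤ (Set.range B))) {w : Euc n}
    (hw : w ∈ dualLattice (Submodule.span ℤ (Set.range B))) :
    (ℓ : ℝ) • w ∈ Submodule.span ℤ (Set.range B) := by
  obtain ⟨σ, hσ, hLσ⟩ := hm
  refine mem_span_of_inner_dualBasis B fun i => ?_
  -- `ℓ w·y = σw·σy` is an inner product of two vectors of `L`, hence an integer.
  rw [inner_smul_left, conj_trivial, ← hσ]
  have hmem : ∀ x ∈ dualLattice (Submodule.span ℤ (Set.range B)),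
      σ x ∈ Submodule.span ℤ (Set.range B) := by
    intro x hx
    have : σ x ∈ (dualLattice (Submodule.span ℤ (Set.range B))).map (σ.restrictScalars ℤ) :=
      ⟨x, hx, rfl⟩
    rwa [← hLσ] at this
  refine hL.exists_inner_eq (hmem _ hw) (hmem _ ?_)
  rw [dualLattice_span]
  exact Submodule.subset_span ⟨i, rfl⟩

/-- The determinant of an `ℓ`-modular lattice of rank `2k` is `ℓ^k`. -/
theorem det_gram_eq {k ℓ : ℕ} (hk : n = 2 * k) (hℓ : 0 < ℓ) {B : Module.Basis (Fin n) ℝ (Euc n)}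
    (hm : IsModularLattice ℓ (Submodule.span ℤ (Set.range B))) {A : Matrix (Fin n) (Fin n) ℤ}
    (hA : IsGram B A) : A.det = (ℓ : ℤ) ^ k := by
  obtain ⟨σ, hσ, hLσ⟩ := hm
  set Dl := Submodule.span ℤ (Set.range (dualBasis B)) with hDl
  rw [dualLattice_span] at hLσ
  have hU : ∀ i, ∃ u : Fin n → ℤ, (spanEquiv B u : Euc n) = σ (dualBasis B i) := by
    intro i
    have : σ (dualBasis B i) ∈ Submodule.span ℤ (Set.range B) := by
      rw [hLσ]; exact ⟨_, Submodule.subset_span ⟨i, rfl⟩, rfl⟩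
    obtain ⟨u, hu⟩ := (spanEquiv B).surjective ⟨_, this⟩
    exact ⟨u, by rw [hu]⟩
  have hV : ∀ i, ∃ u : Fin n → ℤ, σ (spanEquiv (dualBasis B) u : Euc n) = B i := by
    intro i
    have : B i ∈ Submodule.span ℤ (Set.range B) := Submodule.subset_span ⟨i, rfl⟩
    rw [hLσ] at this
    obtain ⟨y, hy, hyi⟩ := this
    obtain ⟨u, hu⟩ := (spanEquiv (dualBasis B)).surjective ⟨y, hy⟩
    exact ⟨u, by rw [hu]; exact hyi⟩
  choose U₀ hU using hU
  choose V₀ hV using hV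
  -- `U` expresses the images under `σ` of the dual basis in terms of `B`, and `V` expresses `B` in
  -- terms of those images. `V * U = 1` over `ℤ`, so both determinants are `±1`.
  set U : Matrix (Fin n) (Fin n) ℤ := Matrix.of U₀
  set V : Matrix (Fin n) (Fin n) ℤ := Matrix.of V₀
  replace hU : ∀ i, (spanEquiv B (fun j => U i j) : Euc n) = σ (dualBasis B i) := hU
  replace hV : ∀ i, σ (spanEquiv (dualBasis B) (fun j => V i j) : Euc n) = B i := hV
  simp only [spanEquiv_apply, Module.Basis.equivFun_symm_apply] at hU hV
  have hVU : V * U = 1 := by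
    ext i m
    have h1 : ∑ m, ((∑ j, V i j * U j m : ℤ) : ℝ) • B m = B i := by
      conv_rhs => rw [← hV i]
      simp only [map_sum, map_smul, ← hU, Finset.smul_sum, smul_smul]
      rw [Finset.sum_comm]
      refine Finset.sum_congr rfl fun m _ => ?_
      rw [← Finset.sum_smul]
      push_cast
      rfl
    have h2 := congrArg (fun x => B.repr x m) h1
    simp only [map_sum, map_smul, Module.Basis.repr_self, Finsupp.coe_finsetSum, Finset.sum_apply,
      Finsupp.smul_apply, Finsupp.single_apply, smul_eq_mul, mul_ite, mul_one, mul_zero,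
      Finset.sum_ite_eq', Finset.mem_univ, if_true] at h2
    rw [Matrix.mul_apply, Matrix.one_apply]
    split_ifs at h2 ⊢ <;> exact_mod_cast h2
  set D : Matrix (Fin n) (Fin n) ℝ := Matrix.of fun i j => inner ℝ (dualBasis B i) (dualBasis B j) with hD
  set AR : Matrix (Fin n) (Fin n) ℝ := A.map (Int.castRingHom ℝ) with hAR
  set UR : Matrix (Fin n) (Fin n) ℝ := U.map (Int.castRingHom ℝ) with hUR
  set VR : Matrix (Fin n) (Fin n) ℝ := V.map (Int.castRingHom ℝ) with hVR
  -- Obtained by pairing the images of the dual basis with `B`. As `D` is inverse to the Gram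
  -- matrix, determinants give `(det A)² = ℓ^n`.
  have e1 : UR * AR = (ℓ : ℝ) • (D * VR.transpose) := by
    ext i m
    have h1 : inner ℝ (σ (dualBasis B i)) (B m) = ∑ j, (U i j : ℝ) * A j m := by
      rw [← hU, sum_inner]
      refine Finset.sum_congr rfl fun j _ => ?_
      rw [inner_smul_left, hA j m]; rfl
    have h2 : inner ℝ (σ (dualBasis B i)) (B m) =
        ℓ * ∑ j, (V m j : ℝ) * inner ℝ (dualBasis B i) (dualBasis B j) := by
      conv_lhs => rw [← hV m]
      rw [hσ, inner_sum]
      simp only [inner_smul_right]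
    rw [Matrix.mul_apply, Matrix.smul_apply, Matrix.mul_apply]
    simp only [hUR, hAR, hVR, hD, Matrix.of_apply, Matrix.map_apply, Matrix.transpose_apply, eq_intCast, smul_eq_mul]
    rw [← h1, h2]
    congr 1
    exact Finset.sum_congr rfl fun j _ => mul_comm _ _
  have e2 : D * AR = 1 := by
    ext i j
    have h1 : B j = ∑ m, (inner ℝ (B j) (B m) : ℝ) • dualBasis B m := by
      have := (dualBasis B).sum_equivFun (B j)
      conv_lhs => rw [← this]
      refine Finset.sum_congr rfl fun m _ => ?_
      congr 1
      conv_rhs => rw [← this]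
      rw [sum_inner, Finset.sum_eq_single m]
      · rw [inner_smul_left, inner_dualBasis]; simp
      · intro l _ hl
        rw [inner_smul_left, inner_dualBasis, if_neg hl.symm]; simp
      · simp
    have h2 := inner_dualBasis B i j
    rw [h1, inner_sum] at h2
    rw [Matrix.mul_apply, Matrix.one_apply]
    simp only [hD, hAR, Matrix.of_apply, Matrix.map_apply, eq_intCast, hA _ _]
    simp only [inner_smul_right] at h2
    rw [show (if i = j then (1 : ℝ) else 0) = if j = i then 1 else 0 by simp [eq_comm], ← h2]
    refine Finset.sum_congr rfl fun m _ => ?_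
    rw [real_inner_comm (B j)]; ring
  have d1 : V.det * U.det = 1 := by
    have := congrArg Matrix.det hVU
    rwa [Matrix.det_mul, Matrix.det_one] at this
  have dU : UR.det = (U.det : ℝ) := det_map_intCast U
  have dV : VR.det = (V.det : ℝ) := det_map_intCast V
  have dA : AR.det = (A.det : ℝ) := det_map_intCast A
  have f1 := congrArg Matrix.det e1
  have f2 := congrArg Matrix.det e2
  rw [Matrix.det_mul, Matrix.det_smul, Matrix.det_mul, Matrix.det_transpose, dU, dV, dA,
    Fintype.card_fin] at f1
  rw [Matrix.det_mul, Matrix.det_one, dA] at f2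
  have d1R : ((V.det : ℤ) : ℝ) * (U.det : ℤ) = 1 := by exact_mod_cast d1
  have hV2 : ((V.det : ℤ) : ℝ) ^ 2 = 1 := by
    have : IsUnit (V.det) := IsUnit.of_mul_eq_one _ d1
    rcases Int.isUnit_iff.mp this with h | h <;> rw [h] <;> norm_num
  have g : ((A.det : ℤ) : ℝ) ^ 2 = ((ℓ : ℝ) ^ k) ^ 2 := by
    have : ((A.det : ℤ) : ℝ) ^ 2 = (ℓ : ℝ) ^ n := by
      linear_combination (-(A.det : ℝ) ^ 2) * d1R + (A.det : ℝ) * (V.det : ℝ) * f1 +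
        (ℓ : ℝ) ^ n * (V.det : ℝ) ^ 2 * f2 + (ℓ : ℝ) ^ n * hV2
    rw [this, hk, pow_mul, pow_right_comm]
  have hpos := hA.det_pos
  have hposR : (0 : ℝ) ≤ A.det := by exact_mod_cast hpos.le
  have := (pow_left_inj₀ hposR (by positivity) two_ne_zero).mp g
  exact_mod_cast this

end Gram
end ModularLattice
end

noncomputable section

namespace ModularLattice

/-! ### The Kronecker symbol and the character of a modular lattice -/

section Character

/-- The sign `(-1/m)` cancels the sign of the reciprocity law in both odd classes of `m` modulo 4.
-/
lemma jacobiSym_neg_of_three_mod_four {ℓ m : ℕ} (hℓ : ℓ % 4 = 3) (hm : Odd m) :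
    jacobiSym (-(ℓ : ℤ)) m = jacobiSym m ℓ := by
  rw [jacobiSym.neg _ hm]
  have hm' := Nat.odd_iff.mp hm
  rcases (by omega : m % 4 = 1 ∨ m % 4 = 3) with h | h
  · rw [ZMod.χ₄_nat_one_mod_four h, one_mul,
      jacobiSym.quadratic_reciprocity_one_mod_four' (Nat.odd_iff.mpr (by omega)) h]
  · rw [ZMod.χ₄_nat_three_mod_four h, jacobiSym.quadratic_reciprocity_three_mod_four hℓ h]
    ring

lemma chi_eight_neg {ℓ : ℕ} (hℓ : Odd ℓ) : ZMod.χ₈ ((-(ℓ : ℤ) : ℤ) : ZMod 8) = jacobiSym 2 ℓ := by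
  rw [jacobiSym.at_two hℓ, ← Int.cast_natCast (R := ZMod 8) ℓ, ZMod.χ₈_int_eq_if_mod_eight,
    ZMod.χ₈_int_eq_if_mod_eight]
  have := Nat.odd_iff.mp hℓ
  split_ifs <;> first | rfl | omega

/-- Splits off the power of `2`, where `χ₈(-ℓ) = (2/ℓ)`, and uses reciprocity for the odd part.
Consequently the symbol depends only on `d` modulo `ℓ`. -/
lemma kronecker_pos_of_three_mod_four {ℓ d : ℕ} (hℓ : ℓ % 4 = 3) (hd : d ≠ 0) :
    ZMod.χ₈ ((-(ℓ : ℤ) : ℤ) : ZMod 8) ^ d.factorization 2 *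
      jacobiSym (-(ℓ : ℤ)) (d / 2 ^ d.factorization 2) = jacobiSym d ℓ := by
  have hodd : Odd (d / 2 ^ d.factorization 2) := by
    rw [← Nat.not_even_iff_odd, even_iff_two_dvd]
    exact Nat.not_dvd_ordCompl Nat.prime_two hd
  rw [chi_eight_neg (Nat.odd_iff.mpr (by omega)), jacobiSym_neg_of_three_mod_four hℓ hodd,
    ← jacobiSym.pow_left, ← jacobiSym.mul_left]
  congr 1
  exact_mod_cast Nat.ordProj_mul_ordCompl_eq_self d 2

lemma kroneckerSymbol_natCast {a : ℤ} {d : ℕ} (hd : d ≠ 0) :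
    kroneckerSymbol a d = ZMod.χ₈ (a : ZMod 8) ^ d.factorization 2 *
      jacobiSym a (d / 2 ^ d.factorization 2) := by
  have h0 : ¬ ((d : ℤ) = 0) := by exact_mod_cast hd
  have h1 : ¬ ((d : ℤ) < 0 ∧ a < 0) := fun h => by omega
  rw [kroneckerSymbol, if_neg h0, if_neg h1]
  simp

lemma kroneckerSymbol_of_odd {a : ℤ} {d : ℕ} (hd : Odd d) :
    kroneckerSymbol a d = jacobiSym a d := by
  have h2 : d.factorization 2 = 0 := by
    apply Nat.factorization_eq_zero_of_not_dvd
    rw [← even_iff_two_dvd]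
    exact Nat.not_even_iff_odd.mpr hd
  rw [kroneckerSymbol_natCast (by rintro rfl; simp at hd), h2]
  simp

lemma kroneckerSymbol_neg_pow {ℓ k : ℕ} (hℓ : 0 < ℓ) {d : ℤ} (hd : d < 0) :
    kroneckerSymbol ((-(ℓ : ℤ)) ^ k) d = (-1) ^ k * kroneckerSymbol ((-(ℓ : ℤ)) ^ k) (-d) := by
  have h0 : ¬ (d = 0) := hd.ne
  have h1 : ¬ (-d = 0) := by omega
  have h2 : ¬ (-d < 0 ∧ (-(ℓ : ℤ)) ^ k < 0) := fun h => by omega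
  rw [kroneckerSymbol, kroneckerSymbol, if_neg h0, if_neg h1, if_neg h2, Int.natAbs_neg]
  have hs : (if d < 0 ∧ (-(ℓ : ℤ)) ^ k < 0 then (-1 : ℤ) else 1) = (-1) ^ k := by
    have hl : (0 : ℤ) < ℓ := by exact_mod_cast hℓ
    rcases Nat.even_or_odd k with hk | hk
    · rw [hk.neg_one_pow, if_neg]
      rintro ⟨-, h⟩
      exact absurd h (not_lt.mpr (hk.pow_nonneg _))
    · rw [hk.neg_one_pow, if_pos ⟨hd, hk.pow_neg (by omega)⟩]
  rw [hs]
  ring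

/-- Here `a` is odd, so all local factors are `±1` and disappear in an even power. -/
lemma kroneckerSymbol_pow_of_even {a : ℤ} {k d : ℕ} (hk : Even k) (hd : Even d) (hd0 : d ≠ 0)
    (h : a.gcd d = 1) : kroneckerSymbol (a ^ k) d = 1 := by
  obtain ⟨m, rfl⟩ := hk
  have ha : a % 2 = 1 := by
    rcases Int.emod_two_eq_zero_or_one a with h0 | h0
    · exfalso
      have h2 : (2 : ℤ) ∣ a := Int.dvd_of_emod_eq_zero h0
      have h3 : (2 : ℤ) ∣ d := by exact_mod_cast even_iff_two_dvd.mp hd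
      have := Int.dvd_coe_gcd h2 h3
      rw [h] at this
      omega
    · exact h0
  have hg : a.gcd (d / 2 ^ d.factorization 2 : ℕ) = 1 := by
    refine Nat.Coprime.coprime_dvd_right ?_ h
    exact_mod_cast Nat.ordCompl_dvd d 2
  rw [kroneckerSymbol_natCast hd0, ← two_mul, jacobiSym.pow_left, pow_mul (jacobiSym _ _), jacobiSym.sq_one hg,
    one_pow, mul_one, Int.cast_pow, map_pow, pow_mul]
  have : ZMod.χ₈ (a : ZMod 8) ^ 2 = 1 := by
    rw [ZMod.χ₈_int_eq_if_mod_eight]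
    split_ifs <;> omega
  rw [this]
  simp

/-- `(1, t; 0, 1)`. -/
def upperUni (t : ℤ) : SL(2, ℤ) := ⟨!![1, t; 0, 1], by simp⟩

/-- `(1, 0; t, 1)`. -/
def lowerUni (t : ℤ) : SL(2, ℤ) := ⟨!![1, 0; t, 1], by simp⟩

lemma upperUni_mul_neg (t : ℤ) : upperUni t * upperUni (-t) = 1 := by
  refine Subtype.ext ?_
  rw [Matrix.SpecialLinearGroup.coe_mul]
  ext i j; fin_cases i <;> fin_cases j <;> simp [upperUni]

lemma lowerUni_mul_neg (t : ℤ) : lowerUni t * lowerUni (-t) = 1 := by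
  refine Subtype.ext ?_
  rw [Matrix.SpecialLinearGroup.coe_mul]
  ext i j; fin_cases i <;> fin_cases j <;> simp [lowerUni]

lemma mul_upperUni_one_zero (A : SL(2, ℤ)) (t : ℤ) : (A * upperUni t) 1 0 = A 1 0 := by
  rw [Matrix.SpecialLinearGroup.coe_mul]
  simp [upperUni, Matrix.mul_apply, Fin.sum_univ_two]

lemma mul_upperUni_one_one (A : SL(2, ℤ)) (t : ℤ) : (A * upperUni t) 1 1 = A 1 0 * t + A 1 1 := by
  rw [Matrix.SpecialLinearGroup.coe_mul]
  simp [upperUni, Matrix.mul_apply, Fin.sum_univ_two]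

lemma mul_lowerUni_one_zero (A : SL(2, ℤ)) (t : ℤ) : (A * lowerUni t) 1 0 = A 1 0 + A 1 1 * t := by
  rw [Matrix.SpecialLinearGroup.coe_mul]
  simp [lowerUni, Matrix.mul_apply, Fin.sum_univ_two]

lemma mul_lowerUni_one_one (A : SL(2, ℤ)) (t : ℤ) : (A * lowerUni t) 1 1 = A 1 1 := by
  rw [Matrix.SpecialLinearGroup.coe_mul]
  simp [lowerUni, Matrix.mul_apply, Fin.sum_univ_two]

variable {ℓ k : ℕ} {w : ℤ} {f : ℍ → ℂ}

/-- Unipotent matrices fixing `f` may thus be used to change the lower row of a matrix without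
changing its multiplier. -/
lemma slash_of_slash_mul {c : ℂ} {A N N' : SL(2, ℤ)} (hN : N * N' = 1)
    (h : f ∣[w] (A * N) = c • f) (hf : f ∣[w] N' = f) : f ∣[w] A = c • f := by
  have : A = A * N * N' := by rw [mul_assoc, hN, mul_one]
  rw [this, SlashAction.slash_mul, h, ModularForm.SL_smul_slash, hf]

lemma isCoprime_lower_row (A : SL(2, ℤ)) : IsCoprime (A 1 0) (A 1 1) :=
  ⟨-A 0 1, A 0 0, by have := Matrix.det_fin_two A.1; rw [A.2] at this; linarith⟩

/-- Values of the multiplier at matrices with odd positive lower right entry. -/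
lemma slash_of_odd (hℓ : 0 < ℓ)
    (H1 : ∀ A : SL(2, ℤ), (ℓ : ℤ) ∣ A 1 0 → A 1 1 = 1 → f ∣[w] A = f)
    (H2 : ∀ (A : SL(2, ℤ)) (p : ℕ), p.Prime → p ≠ 2 → (ℓ : ℤ) ∣ A 1 0 → A 1 1 = p →
      f ∣[w] A = (jacobiSym ((-(ℓ : ℤ)) ^ k) p : ℂ) • f)
    (A : SL(2, ℤ)) (hA : (ℓ : ℤ) ∣ A 1 0) (d : ℕ) (hd : Odd d) (hAd : A 1 1 = d) :
    f ∣[w] A = (jacobiSym ((-(ℓ : ℤ)) ^ k) d : ℂ) • f := by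
  have hU : ∀ t, f ∣[w] upperUni t = f := fun t =>
    H1 _ (by simp [upperUni]) (by simp [upperUni])
  have hLo : ∀ t, f ∣[w] lowerUni (ℓ * t) = f := fun t =>
    H1 _ (by simp [lowerUni]) (by simp [lowerUni])
  obtain ⟨c', hc'⟩ := hA
  -- The new lower left entry `ℓ(c' + dj)` should be nonzero and divisible by `4ℓ`, so that the
  -- Jacobi symbol is constant along the progression used below. As `d² ≡ 1` modulo 4, `j = -dc'`
  -- gives divisibility; adding `4` repairs the zero case.
  obtain ⟨j, hj4, hj0⟩ : ∃ j : ℤ, 4 ∣ c' + d * j ∧ c' + d * j ≠ 0 := by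
    obtain ⟨e, he⟩ := hd
    have hd4 : (4 : ℤ) ∣ 1 - d * d := by
      refine ⟨-((e : ℤ) * e + e), ?_⟩
      rw [he]; push_cast; ring
    have h4 : (4 : ℤ) ∣ c' + d * (-(d * c')) := by
      have : c' + (d : ℤ) * (-(d * c')) = c' * (1 - d * d) := by ring
      rw [this]; exact hd4.mul_left _
    by_cases h0 : c' + d * (-(d * c')) = 0
    · refine ⟨-(d * c') + 4, ?_, ?_⟩
      · rw [mul_add, ← add_assoc, h0]; exact ⟨d, by ring⟩
      · rw [mul_add, ← add_assoc, h0, he]; push_cast; omega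
    · exact ⟨_, h4, h0⟩
  have hN : lowerUni ((ℓ : ℤ) * j) * lowerUni (ℓ * -j) = 1 := by
    rw [mul_neg]; exact lowerUni_mul_neg _
  refine slash_of_slash_mul hN ?_ (hLo _)
  set A₁ := A * lowerUni (ℓ * j) with hA₁
  set c₁ := A₁ 1 0 with hc₁
  have hc₁' : c₁ = ℓ * (c' + d * j) := by
    rw [hc₁, hA₁, mul_lowerUni_one_zero, hc', hAd]; ring
  have hd₁ : A₁ 1 1 = d := by rw [hA₁, mul_lowerUni_one_one, hAd]
  have hc₁0 : c₁ ≠ 0 := by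
    rw [hc₁']; exact mul_ne_zero (by exact_mod_cast hℓ.ne') hj0
  have : NeZero c₁.natAbs := ⟨Int.natAbs_ne_zero.mpr hc₁0⟩
  have hunit : IsUnit ((d : ℕ) : ZMod c₁.natAbs) := by
    rw [ZMod.isUnit_iff_coprime]
    have := isCoprime_lower_row A₁
    rw [hd₁, Int.isCoprime_iff_gcd_eq_one] at this
    rw [Nat.coprime_comm]
    exact this
  -- Dirichlet's theorem: an odd prime congruent to `d` modulo `c₁`, reached by an upper unipotent
  -- matrix.
  obtain ⟨p, hp2, hp, hpd⟩ := Nat.forall_exists_prime_gt_and_eq_mod hunit 2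
  have hdvd : c₁ ∣ (p : ℤ) - d := by
    rw [← Int.natAbs_dvd, ← ZMod.intCast_zmod_eq_zero_iff_dvd]
    push_cast
    rw [hpd, sub_self]
  obtain ⟨t, ht⟩ := hdvd
  have hp' : (A₁ * upperUni t) 1 1 = p := by
    rw [mul_upperUni_one_one, hd₁, ← hc₁]; linarith
  have hres := H2 (A₁ * upperUni t) p hp hp2.ne'
    (by rw [mul_upperUni_one_zero, ← hc₁, hc₁']; exact Dvd.intro _ rfl) hp'
  have hjac : jacobiSym ((-(ℓ : ℤ)) ^ k) p = jacobiSym ((-(ℓ : ℤ)) ^ k) d := by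
    rw [jacobiSym.pow_left, jacobiSym.pow_left, jacobiSym.mod_right _ (hp.odd_of_ne_two hp2.ne'),
      jacobiSym.mod_right _ hd]
    congr 2
    have h4ℓ : ((4 * (-(ℓ : ℤ)).natAbs : ℕ) : ℤ) ∣ (p : ℤ) - d := by
      rw [ht, hc₁']
      obtain ⟨q, hq⟩ := hj4
      rw [hq]
      refine ⟨q * t, ?_⟩
      simp
      ring
    exact ((Nat.modEq_iff_dvd.mpr h4ℓ).symm)
  rw [← hjac]
  exact slash_of_slash_mul (upperUni_mul_neg t) hres (hU _)

/-- A function with the transformation behaviour of a theta series at matrices with prime lower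
right entry has the character `d ↦ ((-ℓ)^k / d)`. -/
theorem slash_eq_latticeCharacter (hℓ : 0 < ℓ)
    (H1 : ∀ A : SL(2, ℤ), (ℓ : ℤ) ∣ A 1 0 → A 1 1 = 1 → f ∣[w] A = f)
    (H2 : ∀ (A : SL(2, ℤ)) (p : ℕ), p.Prime → p ≠ 2 → (ℓ : ℤ) ∣ A 1 0 → A 1 1 = p →
      f ∣[w] A = (jacobiSym ((-(ℓ : ℤ)) ^ k) p : ℂ) • f)
    (H3 : ∀ A : SL(2, ℤ), f ∣[w] (-A) = ((-1 : ℂ) ^ k) • (f ∣[w] A))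
    (A : SL(2, ℤ)) (hA : A ∈ CongruenceSubgroup.Gamma0 ℓ) :
    f ∣[w] A = (latticeCharacter ℓ k A : ℂ) • f := by
  by_cases hf0 : f = 0
  · rw [hf0, SlashAction.zero_slash, smul_zero]
  have hU : ∀ t, f ∣[w] upperUni t = f := fun t =>
    H1 _ (by simp [upperUni]) (by simp [upperUni])
  have hLo : ∀ t, f ∣[w] lowerUni (ℓ * t) = f := fun t =>
    H1 _ (by simp [lowerUni]) (by simp [lowerUni])
  have hA' : (ℓ : ℤ) ∣ A 1 0 := by
    rw [← ZMod.intCast_zmod_eq_zero_iff_dvd]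
    exact CongruenceSubgroup.Gamma0_mem.mp hA
  clear hA
  rw [latticeCharacter]
  have hpos : ∀ (A : SL(2, ℤ)) (d : ℕ), d ≠ 0 → (ℓ : ℤ) ∣ A 1 0 → A 1 1 = d →
      f ∣[w] A = (kroneckerSymbol ((-(ℓ : ℤ)) ^ k) d : ℂ) • f := by
    intro A d hd0 hA hAd
    rcases Nat.even_or_odd d with hd | hd
    · have hcop := isCoprime_lower_row A
      rw [hAd] at hcop
      have hcodd : A 1 0 % 2 = 1 := by
        rcases Int.emod_two_eq_zero_or_one (A 1 0) with h0 | h0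
        · exfalso
          have h2 : (2 : ℤ) ∣ A 1 0 := Int.dvd_of_emod_eq_zero h0
          have h3 : (2 : ℤ) ∣ d := by exact_mod_cast even_iff_two_dvd.mp hd
          have := hcop.isUnit_of_dvd' h2 h3
          rw [Int.isUnit_iff] at this
          omega
        · exact h0
      have hℓodd : ℓ % 2 = 1 := by
        obtain ⟨q, hq⟩ := hA
        rw [hq, Int.mul_emod] at hcodd
        by_contra h
        have h' : (ℓ : ℤ) % 2 = 0 := by omega
        rw [h'] at hcodd
        simp at hcodd
      -- For even `d` the entry `c` is odd, and adding `|c|` to `d` gives an odd positive entry with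
      -- the same multiplier.
      set s : ℤ := (A 1 0).sign with hs
      have hsc : A 1 0 * s = (A 1 0).natAbs := by rw [hs, Int.mul_sign_self]
      set m : ℕ := (A 1 0).natAbs + d with hm
      have hmodd : Odd m := by
        rw [Nat.odd_iff]
        have := Nat.even_iff.mp hd
        omega
      have h1 : (A * upperUni s) 1 1 = m := by
        rw [mul_upperUni_one_one, hsc, hAd, hm]; push_cast; ring
      have h2 := slash_of_odd hℓ H1 H2 (A * upperUni s) (by rwa [mul_upperUni_one_zero]) m hmodd h1
      have h3 := slash_of_slash_mul (upperUni_mul_neg s) h2 (hU _)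
      rw [h3]
      congr 2
      have hgcd : (-(ℓ : ℤ)).gcd d = 1 := by
        rw [← Int.isCoprime_iff_gcd_eq_one]
        exact (hcop.of_isCoprime_of_dvd_left hA).neg_left
      have hgcdm : (-(ℓ : ℤ)).gcd m = 1 := by
        rw [← Int.isCoprime_iff_gcd_eq_one, ← h1]
        have := isCoprime_lower_row (A * upperUni s)
        rw [mul_upperUni_one_zero] at this
        exact (this.of_isCoprime_of_dvd_left hA).neg_left
      rcases Nat.even_or_odd k with hk | hk
      · rw [kroneckerSymbol_pow_of_even hk hd hd0 hgcd]
        obtain ⟨r, rfl⟩ := hk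
        rw [jacobiSym.pow_left, ← two_mul, pow_mul, jacobiSym.sq_one hgcdm, one_pow]
      -- For odd `k` and `ℓ ≡ 1` modulo 4, the matrix `(1, 1; 2ℓ, 2ℓ+1)`, a product of unipotents
      -- fixing `f`, would have multiplier `(-ℓ/(2ℓ+1))^k = -1`, forcing `f = 0`.
      · have hℓ4 : ℓ % 4 = 3 := by
          by_contra h
          have hℓ1 : ℓ % 4 = 1 := by omega
          have e1 : f ∣[w] (lowerUni (ℓ * 2) * upperUni 1) = f := by
            rw [SlashAction.slash_mul, hLo, hU]
          have hodd : Odd (2 * ℓ + 1) := ⟨ℓ, rfl⟩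
          have e2 := slash_of_odd hℓ H1 H2 (lowerUni (ℓ * 2) * upperUni 1)
            (by rw [mul_upperUni_one_zero]; simp [lowerUni]) (2 * ℓ + 1) hodd
            (by rw [mul_upperUni_one_one]; simp [lowerUni]; ring)
          have e3 : jacobiSym ((-(ℓ : ℤ)) ^ k) (2 * ℓ + 1) = -1 := by
            rw [jacobiSym.pow_left, jacobiSym.neg _ hodd, ZMod.χ₄_nat_three_mod_four (by omega),
              jacobiSym.quadratic_reciprocity_one_mod_four hℓ1 hodd,
              jacobiSym.mod_left' (a₂ := 1) (by push_cast; rw [mul_comm, Int.mul_add_emod_self_left]),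
              jacobiSym.one_left, mul_one, hk.neg_one_pow]
          rw [e1, e3] at e2
          apply hf0
          have : (2 : ℂ) • f = 0 := by
            rw [two_smul]
            nth_rewrite 1 [e2]
            simp
          exact (smul_eq_zero.mp this).resolve_left two_ne_zero
        have hpm : ∀ x : ℤ, x = 1 ∨ x = -1 → x ^ k = x := by
          rintro x (rfl | rfl)
          · simp
          · exact hk.neg_one_pow
        have hcdiv : (ℓ : ℤ) ∣ ((A 1 0).natAbs : ℤ) := by rw [Int.dvd_natAbs]; exact hA
        have hJ : jacobiSym (-(ℓ : ℤ)) m = jacobiSym d ℓ := by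
          rw [jacobiSym_neg_of_three_mod_four hℓ4 hmodd]
          refine jacobiSym.mod_left' ?_
          rw [hm]
          obtain ⟨q, hq⟩ := hcdiv
          push_cast
          push_cast at hq
          rw [hq, Int.mul_add_emod_self_left]
        rw [kroneckerSymbol_natCast hd0, Int.cast_pow, map_pow, jacobiSym.pow_left,
          jacobiSym.pow_left, pow_right_comm, ← mul_pow, kronecker_pos_of_three_mod_four hℓ4 hd0, hJ]
    · rw [kroneckerSymbol_of_odd hd]
      exact slash_of_odd hℓ H1 H2 A hA d hd hAd
  rcases lt_trichotomy (A 1 1) 0 with hd | hd | hd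
  · have h1 : A = -(-A) := (neg_neg A).symm
    have h2 := hpos (-A) (A 1 1).natAbs (Int.natAbs_ne_zero.mpr hd.ne)
      (by simpa using hA')
      (by rw [Matrix.SpecialLinearGroup.coe_neg, Matrix.neg_apply]; omega)
    conv_lhs => rw [h1, H3, h2, smul_smul]
    rw [kroneckerSymbol_neg_pow hℓ hd, show -(A 1 1) = ((A 1 1).natAbs : ℤ) by omega]
    push_cast
    rfl
  -- `d = 0` forces `c = ±1`, hence `ℓ = 1`, and the symbol `(±1/0)` is `1`.
  · have hc := isCoprime_lower_row A
    rw [hd, isCoprime_zero_right] at hc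
    have hℓ1 : ℓ = 1 := by
      have := isUnit_of_dvd_unit hA' hc
      rw [Int.isUnit_iff] at this
      omega
    have hcc : A 1 0 * A 1 0 = 1 := Int.isUnit_mul_self hc
    have h1 : f ∣[w] (A * upperUni (A 1 0)) = (1 : ℂ) • f := by
      rw [one_smul]
      refine H1 _ (by rwa [mul_upperUni_one_zero]) ?_
      rw [mul_upperUni_one_one, hcc, hd, add_zero]
    rw [slash_of_slash_mul (upperUni_mul_neg _) h1 (hU _), hd, kroneckerSymbol, if_pos rfl, if_pos]
    · simp
    · rw [hℓ1]; simp [Int.natAbs_pow]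
  · obtain ⟨d, hd'⟩ := Int.eq_ofNat_of_zero_le hd.le
    rw [hd']
    exact hpos A d (by omega) hA' hd'

end Character
end ModularLattice
end

noncomputable section

namespace ModularLattice
open Complex

/-! ### Quartic theta series are cusp forms. -/

section ThetaCusp

variable {n : ℕ}

/-- The theta function `τ ↦ ∑_{x ∈ L} (a·x + i b·x)^4 exp(π i τ ‖x‖²)` on the upper half plane. -/
def quarticTheta (L : Submodule ℤ (Euc n)) (a b : Euc n) (τ : ℍ) : ℂ := isoTheta L a b 4 τ

/-- `isoTheta_transform` in slash notation; modularity supplies its two conditions on `c` whenever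
`ℓ | c`. -/
lemma quarticTheta_slash {k ℓ : ℕ} (hk : n = 2 * k) {B : Module.Basis (Fin n) ℝ (Euc n)}
    (hL : IsEvenLattice (Submodule.span ℤ (Set.range B)))
    (hm : IsModularLattice ℓ (Submodule.span ℤ (Set.range B))) {a b : Euc n}
    (hab : IsIsotropic a b) (A : SL(2, ℤ)) (hA : (ℓ : ℤ) ∣ A 1 0) (d : ℕ) [NeZero d]
    (hd : A 1 1 = d) :
    quarticTheta (Submodule.span ℤ (Set.range B)) a b ∣[(k : ℤ) + 4] A =
      (latticeGaussSum B (A 0 1) d / (d : ℂ) ^ k) •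
        quarticTheta (Submodule.span ℤ (Set.range B)) a b := by
  obtain ⟨q, hq⟩ := hA
  funext τ
  rw [ModularForm.SL_slash_apply, ModularGroup.denom_apply, Pi.smul_apply, smul_eq_mul]
  have hden : ((A 1 0 : ℤ) : ℂ) * τ + (A 1 1 : ℤ) ≠ 0 := by
    rw [← ModularGroup.denom_apply]; exact UpperHalfPlane.denom_ne_zero _ _
  have hdet : A 0 0 * (d : ℤ) - A 0 1 * A 1 0 = 1 := by
    rw [← hd, ← Matrix.det_fin_two]; exact A.det_coe
  have key := isoTheta_transform hk B hL hab 4 (A 0 0) (A 0 1) (A 1 0) d hdet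
    (fun w hw => by
      have h := Submodule.smul_mem _ q (smul_dual_mem hL hm hw)
      rw [hq]
      push_cast
      rw [mul_comm, mul_smul, Int.cast_smul_eq_zsmul]
      exact h)
    (fun w hw => by
      obtain ⟨r, hr⟩ := even_on_dual hL hm hw
      refine ⟨q * r, ?_⟩
      rw [hq]
      push_cast
      linear_combination (q : ℝ) * hr) τ.im_pos
  have hpt : ((A • τ : ℍ) : ℂ) = ((A 0 0 : ℤ) * τ + (A 0 1 : ℤ)) / ((A 1 0 : ℤ) * τ + (d : ℕ)) := by
    rw [UpperHalfPlane.coe_specialLinearGroup_apply, hd]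
    simp
  rw [quarticTheta, quarticTheta, hpt, key, hd]
  rw [hd] at hden
  simp only [Int.cast_natCast] at hden ⊢
  rw [show (-((k : ℤ) + 4)) = -(((k + 4 : ℕ)) : ℤ) by push_cast; rfl, zpow_neg, zpow_natCast]
  field_simp

/-- The Gauss sum modulo `1` is `1`. Modulo an odd prime `p = d`, `ad − bc = 1` and `ℓ | c` make `b`
and `ℓ` units, and `det L = ℓ^k` turns the sum into `p^k` times the symbol of `(-ℓ)^k`. The matrix
`-1` acts by `(-1)^(k+4)`. -/
theorem quarticTheta_slash_gamma0 {k ℓ : ℕ} (hℓ : 0 < ℓ) (hk : n = 2 * k)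
    {B : Module.Basis (Fin n) ℝ (Euc n)}
    (hL : IsEvenLattice (Submodule.span ℤ (Set.range B)))
    (hm : IsModularLattice ℓ (Submodule.span ℤ (Set.range B))) {a b : Euc n}
    (hab : IsIsotropic a b) (A : SL(2, ℤ)) (hA : A ∈ CongruenceSubgroup.Gamma0 ℓ) :
    quarticTheta (Submodule.span ℤ (Set.range B)) a b ∣[(k : ℤ) + 4] A =
      (latticeCharacter ℓ k A : ℂ) • quarticTheta (Submodule.span ℤ (Set.range B)) a b := by
  refine slash_eq_latticeCharacter hℓ (fun A hA hd => ?_) (fun A p hp hp2 hA hd => ?_)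
    (fun A => ?_) A hA
  · rw [quarticTheta_slash hk hL hm hab A hA 1 (by exact_mod_cast hd), latticeGaussSum_one]
    simp
  · have : Fact p.Prime := ⟨hp⟩
    obtain ⟨M, hM⟩ := hL.exists_gram
    have hdet := A.det_coe
    rw [Matrix.det_fin_two, hd] at hdet
    have hcop : (A 0 1 * A 1 0 : ZMod p) = -1 := by
      have h := congrArg (Int.cast : ℤ → ZMod p) hdet
      push_cast at h
      rw [ZMod.natCast_self] at h
      linear_combination -h
    have hne : ∀ x y : ZMod p, x * y = -1 → x ≠ 0 ∧ y ≠ 0 := by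
      intro x y h
      constructor <;> rintro rfl <;> simp at h
    obtain ⟨h0, h1⟩ := hne _ _ hcop
    have hℓp : ((ℓ : ℤ) : ZMod p) ≠ 0 := by
      obtain ⟨q, hq⟩ := hA
      rw [hq] at h1
      push_cast at h1 ⊢
      exact left_ne_zero_of_mul h1
    rw [quarticTheta_slash hk hL hm hab A hA p hd,
      latticeGaussSum_prime hk hL hM _ p hp2 h0
        (by rw [det_gram_eq hk hℓ hm hM]; push_cast at hℓp ⊢; exact pow_ne_zero _ hℓp),
      det_gram_eq hk hℓ hm hM, ← mul_pow, neg_one_mul, mul_div_cancel_right₀]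
    exact pow_ne_zero _ (by exact_mod_cast hp.ne_zero)
  · funext τ
    rw [Pi.smul_apply, ModularForm.SL_slash_apply, ModularForm.SL_slash_apply,
      ModularGroup.SL_neg_smul, ModularGroup.denom_apply, ModularGroup.denom_apply, smul_eq_mul]
    have : (((-A : SL(2, ℤ)) 1 0 : ℤ) : ℂ) * τ + ((-A : SL(2, ℤ)) 1 1 : ℤ) =
        (-1) * (((A 1 0 : ℤ) : ℂ) * τ + (A 1 1 : ℤ)) := by
      rw [Matrix.SpecialLinearGroup.coe_neg, Matrix.neg_apply, Matrix.neg_apply]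
      push_cast
      ring
    rw [this, mul_zpow]
    have : ((-1 : ℂ)) ^ (-((k : ℤ) + 4)) = (-1) ^ k := by
      rw [zpow_neg, show (k : ℤ) + 4 = ((k + 4 : ℕ) : ℤ) by push_cast; rfl, zpow_natCast, pow_add]
      rcases neg_one_pow_eq_or ℂ k with h | h <;> rw [h] <;> norm_num
    rw [this]
    ring

lemma exp_neg_le_factorial_div_pow {s : ℝ} (hs : 0 < s) (N : ℕ) :
    Real.exp (-s) ≤ N.factorial / s ^ N := by
  have h := Real.pow_div_factorial_le_exp s hs.le N
  rw [Real.exp_neg, inv_eq_one_div, div_le_div_iff₀ (Real.exp_pos _) (pow_pos hs _), one_mul]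
  rwa [div_le_iff₀ (by positivity), mul_comm] at h

/-- A bound for the terms of the theta function, uniform on `im τ ≥ y`. -/
lemma norm_polyGauss_four_le {k : ℕ} (hk : n = 2 * k) (a b : Euc n) {y : ℝ} (hy : 0 < y) {τ : ℂ}
    (hτ : y ≤ τ.im) (x : Euc n) :
    ‖polyGauss a b 4 τ x‖ ≤
      ‖clin a b‖ ^ 4 * ((k + 3).factorial / (Real.pi * y) ^ (k + 3)) * ‖x‖⁻¹ ^ (n + 2) := by
  rcases eq_or_ne x 0 with rfl | hx
  · simp [polyGauss]
  refine (norm_polyGauss_le a b 4 τ x).trans ?_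
  rw [mul_assoc]
  refine mul_le_mul_of_nonneg_left ?_ (by positivity)
  have hx' : 0 < ‖x‖ := norm_pos_iff.mpr hx
  have h1 : Real.exp (-(Real.pi * τ.im) * ‖x‖ ^ 2) ≤ Real.exp (-(Real.pi * y * ‖x‖ ^ 2)) := by
    apply Real.exp_le_exp.mpr
    have := mul_le_mul_of_nonneg_right (mul_le_mul_of_nonneg_left hτ Real.pi_pos.le)
      (sq_nonneg ‖x‖)
    linarith
  -- The exponent `r = k + 3` is the only integer that serves: `‖x‖^(4-2r)` must be summable on `L`,
  -- so `r > k + 2`, while vanishing at the cusps needs `r` below the weight `k + 4`.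
  have h2 := h1.trans (exp_neg_le_factorial_div_pow (s := Real.pi * y * ‖x‖ ^ 2)
    (by positivity) (k + 3))
  refine (mul_le_mul_of_nonneg_left h2 (by positivity)).trans (le_of_eq ?_)
  have hpi := Real.pi_pos
  generalize ‖x‖ = r at hx' ⊢
  rw [hk, mul_pow (Real.pi * y), ← pow_mul, inv_pow]
  field_simp
  ring

lemma summable_norm_inv_pow (L : Submodule ℤ (Euc n)) [DiscreteTopology L] [IsZLattice ℝ L] :
    Summable fun x : L => ‖(x : Euc n)‖⁻¹ ^ (n + 2) := by
  refine ZLattice.summable_norm_pow_inv L (n + 2) ?_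
  rw [ZLattice.rank ℝ L]
  simp

lemma summable_polyGauss_four {k : ℕ} (hk : n = 2 * k) (L : Submodule ℤ (Euc n))
    [DiscreteTopology L] [IsZLattice ℝ L] (a b : Euc n) {τ : ℂ} (hτ : 0 < τ.im) :
    Summable fun x : L => polyGauss a b 4 τ x :=
  Summable.of_norm_bounded ((summable_norm_inv_pow L).mul_left _)
    fun x => norm_polyGauss_four_le hk a b hτ le_rfl x

/-- `Θ(τ) = O((im τ)^{-(k+3)})`, uniformly on the upper half plane. -/
lemma exists_norm_quarticTheta_le {k : ℕ} (hk : n = 2 * k) (L : Submodule ℤ (Euc n))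
    [DiscreteTopology L] [IsZLattice ℝ L] (a b : Euc n) :
    ∃ M : ℝ, 0 ≤ M ∧ ∀ τ : ℍ, ‖quarticTheta L a b τ‖ ≤ M * (τ.im ^ (k + 3))⁻¹ := by
  refine ⟨‖clin a b‖ ^ 4 * ((k + 3).factorial / Real.pi ^ (k + 3)) *
    ∑' x : L, ‖(x : Euc n)‖⁻¹ ^ (n + 2), ?_, fun τ => ?_⟩
  · have := Real.pi_pos
    exact mul_nonneg (by positivity) (tsum_nonneg fun x => by positivity)
  · have h := tsum_of_norm_bounded ((summable_norm_inv_pow L).hasSum.mul_left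
      (‖clin a b‖ ^ 4 * ((k + 3).factorial / (Real.pi * τ.im) ^ (k + 3))))
      fun x : L => norm_polyGauss_four_le hk a b τ.im_pos (τ := τ) le_rfl x
    refine h.trans (le_of_eq ?_)
    rw [mul_pow]
    have := τ.im_pos
    have := Real.pi_pos
    field_simp

lemma mdifferentiable_quarticTheta {k : ℕ} (hk : n = 2 * k) (L : Submodule ℤ (Euc n))
    [DiscreteTopology L] [IsZLattice ℝ L] (a b : Euc n) :
    MDifferentiable 𝓘(ℂ) 𝓘(ℂ) (quarticTheta L a b) := by
  rw [UpperHalfPlane.mdifferentiable_iff]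
  have key : DifferentiableOn ℂ (fun τ : ℂ => ∑' x : L, polyGauss a b 4 τ x) {z | 0 < z.im} := by
    intro z hz
    have hz' : 0 < z.im / 2 := half_pos hz
    have ho : IsOpen {w : ℂ | z.im / 2 < w.im} := isOpen_lt continuous_const Complex.continuous_im
    have := Complex.differentiableOn_tsum_of_summable_norm
      (F := fun (x : L) (τ : ℂ) => polyGauss a b 4 τ x)
      ((summable_norm_inv_pow L).mul_left
        (‖clin a b‖ ^ 4 * ((k + 3).factorial / (Real.pi * (z.im / 2)) ^ (k + 3)))) (fun x => ?_) ho
      (fun x w hw => norm_polyGauss_four_le hk a b hz' (le_of_lt hw) x)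
    · have hmem : z ∈ {w : ℂ | z.im / 2 < w.im} := by
        change 0 < z.im at hz
        change z.im / 2 < z.im
        linarith
      exact ((this z hmem).differentiableAt (ho.mem_nhds hmem)).differentiableWithinAt
    · unfold polyGauss
      fun_prop
  refine key.congr fun z hz => ?_
  rw [Function.comp_apply, UpperHalfPlane.ofComplex_apply_of_im_pos hz]
  rfl

/-- Used to see that translations at a cusp do not increase norms. -/
lemma abs_latticeCharacter_le (ℓ k : ℕ) (A : SL(2, ℤ)) : |latticeCharacter ℓ k A| ≤ 1 := by
  rw [latticeCharacter, kroneckerSymbol]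
  generalize (-(ℓ : ℤ)) ^ k = r
  have h1 : ∀ x : ZMod 8, |ZMod.χ₈ x| ≤ 1 := by decide
  split_ifs
  · simp
  · simp
  all_goals
    rw [abs_mul, abs_mul, abs_pow]
    refine mul_le_one₀ (mul_le_one₀ (by simp) (by positivity)
      (pow_le_one₀ (abs_nonneg _) (h1 _))) (abs_nonneg _) ?_
    rcases jacobiSym.trichotomy r (((A 1 1).natAbs) / 2 ^ (A 1 1).natAbs.factorization 2) with
      h | h | h <;> rw [h] <;> simp

lemma slash_upperUni (f : ℍ → ℂ) (w t : ℤ) (τ : ℍ) :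
    (f ∣[w] upperUni t) τ = f (upperUni t • τ) := by
  rw [ModularForm.SL_slash_apply, ModularGroup.denom_apply]
  simp [upperUni]

lemma coe_upperUni_smul (t : ℤ) (τ : ℍ) : ((upperUni t • τ : ℍ) : ℂ) = τ + t := by
  rw [UpperHalfPlane.coe_specialLinearGroup_apply]
  simp [upperUni]

lemma upperUni_mem_Gamma (ℓ : ℕ) (t : ℤ) :
    upperUni (ℓ * t) ∈ CongruenceSubgroup.Gamma ℓ := by
  rw [CongruenceSubgroup.Gamma_mem]
  simp [upperUni]

lemma Gamma_le_Gamma0 (ℓ : ℕ) : CongruenceSubgroup.Gamma ℓ ≤ CongruenceSubgroup.Gamma0 ℓ :=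
  fun _ hA => CongruenceSubgroup.Gamma0_mem.mpr (CongruenceSubgroup.Gamma_mem.mp hA).2.2.1

/-- A function on the upper half plane with the transformation behaviour of a form for `Γ₀(ℓ)` and
of order `(im τ)^{-(k+3)}` vanishes at all cusps. -/
theorem isZeroAtImInfty_slash {ℓ k : ℕ} (hℓ : 0 < ℓ) {f : ℍ → ℂ}
    (hf : ∀ A ∈ CongruenceSubgroup.Gamma0 ℓ,
      f ∣[(k : ℤ) + 4] A = (latticeCharacter ℓ k A : ℂ) • f)
    {M : ℝ} (hM : 0 ≤ M) (hb : ∀ τ : ℍ, ‖f τ‖ ≤ M * (τ.im ^ (k + 3))⁻¹) (A : SL(2, ℤ)) :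
    UpperHalfPlane.IsZeroAtImInfty (f ∣[(k : ℤ) + 4] A) := by
  have hℓ' : (0 : ℝ) < ℓ := by exact_mod_cast hℓ
  -- `K` is chosen so that `|cτ + d| ≤ K im τ` when `im τ ≥ 1` and `|re τ| ≤ ℓ`.
  set K : ℝ := |(A 1 0 : ℝ)| * (ℓ + 1) + |(A 1 1 : ℝ)| with hK
  have hK0 : 0 ≤ K := by positivity
  -- translation by multiples of `ℓ`
  have htrans : ∀ (t : ℤ) (τ : ℍ), ‖(f ∣[(k : ℤ) + 4] A) (upperUni (ℓ * t) • τ)‖ ≤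
      ‖(f ∣[(k : ℤ) + 4] A) τ‖ := by
    intro t τ
    have hmem : A * upperUni (ℓ * t) * A⁻¹ ∈ CongruenceSubgroup.Gamma0 ℓ :=
      Gamma_le_Gamma0 ℓ ((CongruenceSubgroup.Gamma_normal ℓ).conj_mem _ (upperUni_mem_Gamma ℓ t) A)
    rw [← slash_upperUni (f ∣[(k : ℤ) + 4] A) ((k : ℤ) + 4), ← SlashAction.slash_mul,
      show A * upperUni (ℓ * t) = (A * upperUni (ℓ * t) * A⁻¹) * A by group,
      SlashAction.slash_mul, hf _ hmem, ModularForm.SL_smul_slash, Pi.smul_apply, norm_smul]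
    refine mul_le_of_le_one_left (norm_nonneg _) ?_
    rw [Complex.norm_intCast]
    exact_mod_cast abs_latticeCharacter_le ℓ k _
  have hbound : ∀ τ : ℍ, 1 ≤ τ.im → |τ.re| ≤ ℓ →
      ‖(f ∣[(k : ℤ) + 4] A) τ‖ ≤ M * K ^ (k + 2) / τ.im := by
    intro τ h1 h2
    have hy := τ.im_pos
    rw [ModularForm.SL_slash_apply, norm_mul]
    set D := UpperHalfPlane.denom
      (Matrix.SpecialLinearGroup.toGL ((Matrix.SpecialLinearGroup.map (Int.castRingHom ℝ)) A)) τ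
      with hD
    have hD0 : D ≠ 0 := UpperHalfPlane.denom_ne_zero _ _
    have hDn : 0 < ‖D‖ := norm_pos_iff.mpr hD0
    have hDK : ‖D‖ ≤ K * τ.im := by
      rw [hD, ModularGroup.denom_apply]
      have e1 : ‖(τ : ℂ)‖ ≤ ℓ + τ.im := by
        refine (Complex.norm_le_abs_re_add_abs_im _).trans ?_
        exact add_le_add h2 (le_of_eq (abs_of_pos hy))
      calc ‖((A 1 0 : ℤ) : ℂ) * τ + (A 1 1 : ℤ)‖
          ≤ |(A 1 0 : ℝ)| * ‖(τ : ℂ)‖ + |(A 1 1 : ℝ)| := by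
            refine (norm_add_le _ _).trans ?_
            rw [norm_mul, Complex.norm_intCast, Complex.norm_intCast]
        _ ≤ |(A 1 0 : ℝ)| * ((ℓ + 1) * τ.im) + |(A 1 1 : ℝ)| * τ.im := by
            refine add_le_add (mul_le_mul_of_nonneg_left (e1.trans ?_) (abs_nonneg _)) ?_
            · nlinarith
            · nlinarith [abs_nonneg (A 1 1 : ℝ)]
        _ = K * τ.im := by rw [hK]; ring
    have him : (A • τ).im = τ.im / ‖D‖ ^ 2 := by
      rw [ModularGroup.im_smul_eq_div_normSq, Complex.normSq_eq_norm_sq]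
    have h3 := hb (A • τ)
    rw [him] at h3
    have h4 : ‖D ^ (-((k : ℤ) + 4))‖ = (‖D‖ ^ (k + 4))⁻¹ := by
      rw [norm_zpow, zpow_neg, show (k : ℤ) + 4 = ((k + 4 : ℕ) : ℤ) by push_cast; rfl,
        zpow_natCast]
    rw [h4]
    -- As `im(Aτ) = im τ/|D|²`, the bound is `|D|^(2(k+3)-(k+4)) (im τ)^(-(k+3))`; with `|D| ≤ K im
    -- τ`, one power of `im τ` is left in the denominator.
    calc ‖f (A • τ)‖ * (‖D‖ ^ (k + 4))⁻¹
        ≤ M * ((τ.im / ‖D‖ ^ 2) ^ (k + 3))⁻¹ * (‖D‖ ^ (k + 4))⁻¹ := by gcongr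
      _ = M * ‖D‖ ^ (k + 2) * (τ.im ^ (k + 3))⁻¹ := by
        rw [div_pow, ← pow_mul, inv_div]
        field_simp
        ring
      _ ≤ M * (K * τ.im) ^ (k + 2) * (τ.im ^ (k + 3))⁻¹ := by gcongr
      _ = M * K ^ (k + 2) / τ.im := by
        rw [mul_pow]
        field_simp
        ring
  rw [UpperHalfPlane.isZeroAtImInfty_iff]
  intro ε hε
  refine ⟨max 1 (M * K ^ (k + 2) / ε), fun τ hτ => ?_⟩
  have h1 : 1 ≤ τ.im := (le_max_left _ _).trans hτ
  have h2 : M * K ^ (k + 2) / ε ≤ τ.im := (le_max_right _ _).trans hτ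
  -- Translation by a multiple of `ℓ` brings the real part into `[0, ℓ)` at the same height.
  set t : ℤ := ⌊τ.re / ℓ⌋ with ht
  set σ : ℍ := upperUni (ℓ * -t) • τ with hσ
  have hσc : (σ : ℂ) = τ + ((ℓ * -t : ℤ) : ℂ) := coe_upperUni_smul _ _
  have hσim : σ.im = τ.im := by
    have := congrArg Complex.im hσc
    rw [Complex.add_im, Complex.intCast_im, add_zero] at this
    exact this
  have hσre : σ.re = τ.re - ℓ * t := by
    have := congrArg Complex.re hσc
    rw [Complex.add_re, Complex.intCast_re] at this
    push_cast at this
    rw [sub_eq_add_neg, ← mul_neg]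
    exact this
  have hτσ : τ = upperUni (ℓ * t) • σ := by
    rw [hσ, smul_smul, mul_neg, upperUni_mul_neg, one_smul]
  have hre : |σ.re| ≤ ℓ := by
    have e1 := Int.floor_le (τ.re / ℓ)
    have e2 := Int.lt_floor_add_one (τ.re / ℓ)
    rw [← ht] at e1 e2
    rw [le_div_iff₀ hℓ'] at e1
    rw [div_lt_iff₀ hℓ'] at e2
    rw [hσre, abs_le]
    constructor <;> linarith
  rw [hτσ]
  refine (htrans t σ).trans ((hbound σ (by rwa [hσim]) hre).trans ?_)
  rw [hσim, div_le_iff₀ τ.im_pos]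
  rw [div_le_iff₀ hε] at h2
  linarith

theorem quarticTheta_mem_cuspForms {k ℓ : ℕ} (hℓ : 0 < ℓ) (hk : n = 2 * k)
    {L : Submodule ℤ (Euc n)} [DiscreteTopology L] [IsZLattice ℝ L]
    (hL : IsEvenLattice L) (hm : IsModularLattice ℓ L) {a b : Euc n} (hab : IsIsotropic a b) :
    quarticTheta L a b ∈ cuspForms ℓ k ((k : ℤ) + 4) := by
  have hslash : ∀ A ∈ CongruenceSubgroup.Gamma0 ℓ, quarticTheta L a b ∣[(k : ℤ) + 4] A =
      (latticeCharacter ℓ k A : ℂ) • quarticTheta L a b := by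
    obtain ⟨B, rfl⟩ := exists_basis_span_eq L
    exact quarticTheta_slash_gamma0 hℓ hk hL hm hab
  obtain ⟨M, hM, hb⟩ := exists_norm_quarticTheta_le hk L a b
  exact ⟨mdifferentiable_quarticTheta hk L a b, hslash, isZeroAtImInfty_slash hℓ hslash hM hb⟩

end ThetaCusp
end ModularLattice
end

noncomputable section

namespace ModularLattice
open Complex

/-! ### Shells and `q`-expansions -/

section Shells

variable {n : ℕ}

lemma shell_finite (L : Submodule ℤ (Euc n)) [DiscreteTopology L] (s : ℝ) : (shell L s).Finite := by
  have h : IsClosed ((L : Set (Euc n))) := by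
    have : DiscreteTopology L.toAddSubgroup := ‹DiscreteTopology L›
    exact AddSubgroup.isClosed_of_discrete (H := L.toAddSubgroup)
  have h2 : ((Metric.closedBall (0 : Euc n) (Real.sqrt s)) ∩ (L : Set (Euc n))).Finite :=
    Metric.finite_isBounded_inter_isClosed DiscreteTopology.isDiscrete Metric.isBounded_closedBall h
  refine h2.subset fun x hx => ⟨?_, hx.1⟩
  rw [mem_closedBall_zero_iff]
  exact Real.le_sqrt_of_sq_le hx.2.le

/-- The half norm `‖x‖²/2` of a vector of an even lattice. -/
lemma IsEvenLattice.exists_halfNorm {L : Submodule ℤ (Euc n)} (hL : IsEvenLattice L) :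
    ∃ g : L → ℕ, ∀ x : L, ‖(x : Euc n)‖ ^ 2 = 2 * (g x : ℝ) := by
  have : ∀ x : L, ∃ m : ℕ, ‖(x : Euc n)‖ ^ 2 = 2 * (m : ℝ) := by
    intro x
    obtain ⟨z, hz⟩ := hL x x.2
    rw [real_inner_self_eq_norm_sq] at hz
    have h0 : 0 ≤ z := by
      have h := sq_nonneg ‖(x : Euc n)‖
      rw [hz] at h
      have : (0 : ℝ) ≤ z := by linarith
      exact_mod_cast this
    obtain ⟨m, rfl⟩ := Int.eq_ofNat_of_zero_le h0
    exact ⟨m, by simpa using hz⟩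
  choose g hg using this
  exact ⟨g, hg⟩

/-- Summation over an even lattice, shell by shell. -/
theorem IsEvenLattice.hasSum_shell {V : Type*} [AddCommGroup V] [UniformSpace V]
    [IsUniformAddGroup V] [CompleteSpace V] [T2Space V] {L : Submodule ℤ (Euc n)}
    [DiscreteTopology L] (hL : IsEvenLattice L) {F : Euc n → V} {v : V}
    (h : HasSum (fun x : L => F x) v) :
    HasSum (fun m : ℕ => ∑ᶠ x ∈ shell L (2 * (m : ℝ)), F x) v := by
  obtain ⟨g, hg⟩ := hL.exists_halfNorm
  refine (h.tsum_fiberwise g).congr_fun ?_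
  intro m
  let e : (g ⁻¹' {m}) ≃ shell L (2 * (m : ℝ)) :=
    { toFun := fun x => ⟨x, x.1.2, by rw [hg]; congr 2; exact_mod_cast x.2⟩
      invFun := fun x => ⟨⟨x, x.2.1⟩, by
        have h := x.2.2
        have h2 := hg ⟨x, x.2.1⟩
        rw [h2] at h
        have h3 : (g ⟨x, x.2.1⟩ : ℝ) = m := by linarith
        exact_mod_cast h3⟩
      left_inv := fun x => rfl
      right_inv := fun x => rfl }
  have := (shell_finite L (2 * (m : ℝ))).to_subtype
  have h1 : ∑' j : shell L (2 * (m : ℝ)), F j = ∑ᶠ j : shell L (2 * (m : ℝ)), F j :=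
    tsum_eq_finsum (Set.toFinite _)
  rw [← finsum_set_coe_eq_finsum_mem, ← h1, ← e.tsum_eq]
  rfl

end Shells

/-! ### Fourier coefficients of cusp forms. -/

section QExpansion

open Function

variable {ℓ k : ℕ} {w : ℤ}

lemma kroneckerSymbol_one (a : ℤ) : kroneckerSymbol a 1 = 1 := by
  simp [kroneckerSymbol]

/-- `τ ↦ τ + 1` comes from a matrix in `Γ₀(ℓ)` with `d = 1`, where the character is `1`. -/
lemma periodic_of_mem_cuspForms {f : ℍ → ℂ} (hf : f ∈ cuspForms ℓ k w) :
    Periodic (f ∘ UpperHalfPlane.ofComplex) ((1 : ℝ) : ℂ) := by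
  have h1 := hf.2.1 (upperUni 1) (CongruenceSubgroup.Gamma0_mem.mpr (by simp [upperUni]))
  have hs : ∀ τ : ℍ, f (upperUni 1 • τ) = f τ := by
    intro τ
    rw [← slash_upperUni f w, h1, latticeCharacter]
    simp [upperUni, kroneckerSymbol_one]
  intro z
  by_cases hz : 0 < z.im
  · have hz' : 0 < (z + ((1 : ℝ) : ℂ)).im := by simpa using hz
    rw [Function.comp_apply, Function.comp_apply, UpperHalfPlane.ofComplex_apply_of_im_pos hz,
      UpperHalfPlane.ofComplex_apply_of_im_pos hz', ← hs ⟨z, hz⟩]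
    congr 1
    refine UpperHalfPlane.ext ?_
    rw [coe_upperUni_smul]
    simp
  -- Off the upper half plane `ofComplex` takes one fixed default value.
  · have hz' : ¬ 0 < (z + ((1 : ℝ) : ℂ)).im := by simpa using hz
    rw [Function.comp_apply, Function.comp_apply,
      UpperHalfPlane.ofComplex_apply_of_im_nonpos (not_lt.mp hz),
      UpperHalfPlane.ofComplex_apply_of_im_nonpos (not_lt.mp hz')]

lemma isBoundedAtImInfty_of_mem_cuspForms {f : ℍ → ℂ} (hf : f ∈ cuspForms ℓ k w) :
    UpperHalfPlane.IsBoundedAtImInfty f := by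
  have := hf.2.2 1
  rw [SlashAction.slash_one] at this
  exact this.boundedAtFilter

lemma analyticAt_cuspFunction_of_mem {f : ℍ → ℂ} (hf : f ∈ cuspForms ℓ k w) :
    AnalyticAt ℂ (UpperHalfPlane.cuspFunction 1 f) 0 :=
  UpperHalfPlane.analyticAt_cuspFunction_zero one_pos (periodic_of_mem_cuspForms hf) hf.1
    (isBoundedAtImInfty_of_mem_cuspForms hf)

lemma hasSum_qCoeff {f : ℍ → ℂ} (hf : f ∈ cuspForms ℓ k w) (τ : ℍ) :
    HasSum (fun m : ℕ => qCoeff f m * Periodic.qParam 1 τ ^ m) (f τ) :=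
  UpperHalfPlane.hasSum_qExpansion one_pos (periodic_of_mem_cuspForms hf) hf.1
    (isBoundedAtImInfty_of_mem_cuspForms hf) τ

lemma qCoeff_eq_of_hasSum {f : ℍ → ℂ} (hf : f ∈ cuspForms ℓ k w) {c : ℕ → ℂ}
    (hc : ∀ τ : ℍ, HasSum (fun m => c m * Periodic.qParam 1 τ ^ m) (f τ)) (m : ℕ) :
    qCoeff f m = c m :=
  (UpperHalfPlane.qExpansion_coeff_unique (⟨f, hf.1.continuous⟩ : C(ℍ, ℂ)) one_pos
    (analyticAt_cuspFunction_of_mem hf) hc m).symm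

/-- The `m`-th coefficient as a linear form on the space of cusp forms. -/
def qCoeffLin (ℓ k : ℕ) (w : ℤ) (m : ℕ) : cuspForms ℓ k w →ₗ[ℂ] ℂ where
  toFun f := qCoeff f m
  map_add' f g := by
    rw [qCoeff, Submodule.coe_add, UpperHalfPlane.qExpansion_add
      (analyticAt_cuspFunction_of_mem f.2) (analyticAt_cuspFunction_of_mem g.2), map_add]
    rfl
  map_smul' c f := by
    rw [qCoeff, Submodule.coe_smul, UpperHalfPlane.qExpansion_smul
      (analyticAt_cuspFunction_of_mem f.2)]
    simp [qCoeff]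

/-- The coefficients of a cusp form are determined by the first `e` of them. -/
theorem qCoeff_eq_sum {e : ℕ} (C : Module.Basis (Fin e) ℂ (cuspForms ℓ k w))
    (hC : IsReducedRowEchelon (fun i => (C i : ℍ → ℂ))) {f : ℍ → ℂ} (hf : f ∈ cuspForms ℓ k w)
    (m : ℕ) : qCoeff f m = ∑ i : Fin e, qCoeff (C i) m * qCoeff f ((i : ℕ) + 1) := by
  have key : ∀ m, qCoeff f m = ∑ i : Fin e, C.repr ⟨f, hf⟩ i * qCoeff (C i) m := by
    intro m
    have h := congrArg (qCoeffLin ℓ k w m) (C.sum_repr ⟨f, hf⟩)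
    rw [map_sum] at h
    refine h.symm.trans (Finset.sum_congr rfl fun i _ => ?_)
    rw [map_smul]
    rfl
  -- By the echelon form, the first `e` coefficients are the coordinates in the basis.
  have h2 : ∀ i : Fin e, qCoeff f ((i : ℕ) + 1) = C.repr ⟨f, hf⟩ i := by
    intro i
    rw [key, Finset.sum_eq_single i]
    · rw [hC i i, if_pos rfl, mul_one]
    · intro j _ hj
      rw [hC j i, if_neg hj, mul_zero]
    · simp
  rw [key]
  exact Finset.sum_congr rfl fun i _ => by rw [h2, mul_comm]

/-- This is the `q`-expansion at `τ = iα/π`, where `q = exp(-2α)`. -/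
lemma summable_qCoeff_mul_exp {f : ℍ → ℂ} (hf : f ∈ cuspForms ℓ k w) {α : ℝ} (hα : 0 < α) :
    Summable fun m : ℕ => qCoeff f m * (Real.exp (-2 * α * m) : ℂ) := by
  have hpi := Real.pi_pos
  have him : 0 < (((α / Real.pi : ℝ) : ℂ) * I).im := by
    rw [Complex.mul_I_im, Complex.ofReal_re]
    positivity
  refine (hasSum_qCoeff hf ⟨_, him⟩).summable.congr fun m => ?_
  congr 1
  rw [Periodic.qParam, ← Complex.exp_nat_mul, Complex.ofReal_exp]
  congr 1
  have : (Real.pi : ℂ) ≠ 0 := by exact_mod_cast hpi.ne'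
  push_cast
  field_simp
  linear_combination (α * m : ℂ) * I_sq

end QExpansion

/-! ### Fourth moments of shells as Fourier coefficients. -/

section ThetaCoeff

variable {n : ℕ}

/-- The `q`-coefficients of the theta function are sums over shells. -/
theorem qCoeff_quarticTheta {k ℓ : ℕ} (hℓ : 0 < ℓ) (hk : n = 2 * k)
    {L : Submodule ℤ (Euc n)} [DiscreteTopology L] [IsZLattice ℝ L]
    (hL : IsEvenLattice L) (hm : IsModularLattice ℓ L) {a b : Euc n} (hab : IsIsotropic a b)
    (m : ℕ) :
    qCoeff (quarticTheta L a b) m = ∑ᶠ x ∈ shell L (2 * (m : ℝ)), clin a b x ^ 4 := by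
  refine qCoeff_eq_of_hasSum (c := fun m : ℕ => ∑ᶠ x ∈ shell L (2 * (m : ℝ)), clin a b x ^ 4)
    (quarticTheta_mem_cuspForms hℓ hk hL hm hab) (fun τ => ?_) m
  have h := hL.hasSum_shell (summable_polyGauss_four hk L a b τ.im_pos).hasSum
  refine h.congr_fun fun m => ?_
  rw [finsum_mem_mul]
  refine finsum_mem_congr rfl fun x hx => ?_
  rw [polyGauss]
  congr 1
  have hx2 : (‖x‖ : ℂ) ^ 2 = 2 * m := by exact_mod_cast congrArg (fun t : ℝ => (t : ℂ)) hx.2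
  rw [hx2, Function.Periodic.qParam, ← Complex.exp_nat_mul]
  congr 1
  push_cast
  ring

/-- Relation between the fourth moments of the shells of `L` given by the cusp forms. -/
theorem finsum_shell_clin_pow_four {k ℓ e : ℕ} (hℓ : 0 < ℓ) (hk : n = 2 * k)
    {L : Submodule ℤ (Euc n)} [DiscreteTopology L] [IsZLattice ℝ L]
    (hL : IsEvenLattice L) (hm : IsModularLattice ℓ L)
    (C : Module.Basis (Fin e) ℂ (cuspForms ℓ k ((k : ℤ) + 4)))
    (hC : IsReducedRowEchelon (fun i => (C i : ℍ → ℂ))) {a b : Euc n} (hab : IsIsotropic a b)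
    (m : ℕ) :
    ∑ᶠ x ∈ shell L (2 * (m : ℝ)), clin a b x ^ 4 =
      ∑ i : Fin e, qCoeff (C i) m *
        ∑ᶠ x ∈ shell L (2 * (((i : ℕ) + 1 : ℕ) : ℝ)), clin a b x ^ 4 := by
  rw [← qCoeff_quarticTheta hℓ hk hL hm hab,
    qCoeff_eq_sum C hC (quarticTheta_mem_cuspForms hℓ hk hL hm hab)]
  exact Finset.sum_congr rfl fun i _ => by rw [qCoeff_quarticTheta hℓ hk hL hm hab]

end ThetaCoeff
end ModularLattice
end

noncomputable section

namespace ModularLattice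
open MeasureTheory

/-! ### Second moments of spherical designs -/

section Design

open scoped Pointwise

variable {n : ℕ}

/-- The action of a linear isometry on the unit sphere. -/
def sphereMap (f : Euc n ≃ₗᵢ[ℝ] Euc n) (u : Metric.sphere (0 : Euc n) 1) :
    Metric.sphere (0 : Euc n) 1 :=
  ⟨f u, by rw [mem_sphere_zero_iff_norm, f.norm_map]; exact mem_sphere_zero_iff_norm.mp u.2⟩

lemma continuous_sphereMap (f : Euc n ≃ₗᵢ[ℝ] Euc n) : Continuous (sphereMap f) :=
  Continuous.subtype_mk (f.continuous.comp continuous_subtype_val) _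

/-- The measure of a subset of the sphere is a multiple of the volume of the cone over it, and
linear isometries preserve volume. -/
lemma map_sphereMap (f : Euc n ≃ₗᵢ[ℝ] Euc n) :
    ((volume : Measure (Euc n)).toSphere).map (sphereMap f) = (volume : Measure (Euc n)).toSphere := by
  refine Measure.ext fun s hs => ?_
  have hm := (continuous_sphereMap f).measurable
  rw [Measure.map_apply hm hs, Measure.toSphere_apply' _ hs, Measure.toSphere_apply' _ (hm hs)]
  congr 1
  have hset : (Set.Ioo (0 : ℝ) 1) • ((↑) '' (sphereMap f ⁻¹' s) : Set (Euc n)) =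
      f ⁻¹' ((Set.Ioo (0 : ℝ) 1) • ((↑) '' s : Set (Euc n))) := by
    ext x
    simp only [Set.mem_preimage, Set.mem_smul]
    constructor
    · rintro ⟨t, ht, _, ⟨u, hu, rfl⟩, rfl⟩
      exact ⟨t, ht, f u, ⟨sphereMap f u, hu, rfl⟩, (f.map_smul t u).symm⟩
    · rintro ⟨t, ht, _, ⟨u, hu, rfl⟩, hx⟩
      refine ⟨t, ht, f.symm u, ⟨sphereMap f.symm u, ?_, rfl⟩, ?_⟩
      · have : sphereMap f (sphereMap f.symm u) = u := Subtype.ext (f.apply_symm_apply u)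
        rwa [Set.mem_preimage, this]
      · rw [← f.symm.map_smul, hx, f.symm_apply_apply]
  rw [hset]
  exact (LinearIsometryEquiv.measurePreserving f).measure_preimage_equiv
    (f := f.toHomeomorph.toMeasurableEquiv) _

lemma average_sphereMap (f : Euc n ≃ₗᵢ[ℝ] Euc n) {g : Metric.sphere (0 : Euc n) 1 → ℝ}
    (hg : Continuous g) :
    ⨍ u, g (sphereMap f u) ∂(volume : Measure (Euc n)).toSphere =
      ⨍ u, g u ∂(volume : Measure (Euc n)).toSphere := by
  rw [average_eq, average_eq]
  congr 1
  conv_rhs => rw [← map_sphereMap f]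
  rw [integral_map (continuous_sphereMap f).aemeasurable hg.aestronglyMeasurable]

lemma continuous_coord_mul (i j : Fin n) :
    Continuous fun u : Metric.sphere (0 : Euc n) 1 => (u : Euc n) i * (u : Euc n) j := by
  fun_prop

/-- Change of sign of one coordinate. -/
def coordNeg (i : Fin n) : Euc n ≃ₗᵢ[ℝ] Euc n :=
  LinearIsometryEquiv.piLpCongrRight 2
    fun j => if j = i then LinearIsometryEquiv.neg ℝ else LinearIsometryEquiv.refl ℝ ℝ

/-- Changing the sign of `u_i` preserves the measure and negates the integrand. -/
lemma average_coord_mul_of_ne {i j : Fin n} (hij : i ≠ j) :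
    ⨍ u : Metric.sphere (0 : Euc n) 1, (u : Euc n) i * (u : Euc n) j
      ∂(volume : Measure (Euc n)).toSphere = 0 := by
  have h := average_sphereMap (coordNeg i) (continuous_coord_mul i j)
  have h2 : ∀ u : Metric.sphere (0 : Euc n) 1,
      (sphereMap (coordNeg i) u : Euc n) i * (sphereMap (coordNeg i) u : Euc n) j =
        -((u : Euc n) i * (u : Euc n) j) := by
    intro u
    simp [sphereMap, coordNeg, hij.symm]
  simp only [h2] at h
  rw [average_eq, average_eq, integral_neg, smul_neg] at h
  rw [average_eq]
  linarith

/-- Coordinate swaps make the `n` averages equal, and they add up to the average of `‖u‖² = 1`. -/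
lemma average_coord_sq (hn : 0 < n) (i : Fin n) :
    ⨍ u : Metric.sphere (0 : Euc n) 1, (u : Euc n) i * (u : Euc n) i
      ∂(volume : Measure (Euc n)).toSphere = 1 / n := by
  have : NeZero n := ⟨hn.ne'⟩
  have : Nontrivial (Euc n) := by
    have : Nonempty (Fin n) := ⟨i⟩
    infer_instance
  have hsw : ∀ j : Fin n, ⨍ u : Metric.sphere (0 : Euc n) 1, (u : Euc n) j * (u : Euc n) j
      ∂(volume : Measure (Euc n)).toSphere = ⨍ u : Metric.sphere (0 : Euc n) 1,
        (u : Euc n) i * (u : Euc n) i ∂(volume : Measure (Euc n)).toSphere := by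
    intro j
    rw [← average_sphereMap (LinearIsometryEquiv.piLpCongrLeft 2 ℝ ℝ (Equiv.swap i j))
      (continuous_coord_mul i i)]
    congr 1
    funext u
    simp [sphereMap, LinearIsometryEquiv.piLpCongrLeft_apply]
  have hsum : ∑ j : Fin n, ⨍ u : Metric.sphere (0 : Euc n) 1, (u : Euc n) j * (u : Euc n) j
      ∂(volume : Measure (Euc n)).toSphere = 1 := by
    simp only [average_eq]
    rw [← Finset.smul_sum, ← integral_finsetSum _ fun j _ =>
      (continuous_coord_mul j j).integrable_of_hasCompactSupport
        (HasCompactSupport.of_compactSpace _), ← average_eq]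
    have : ∀ u : Metric.sphere (0 : Euc n) 1, ∑ j, (u : Euc n) j * (u : Euc n) j = 1 := by
      intro u
      have h := EuclideanSpace.real_norm_sq_eq (u : Euc n)
      rw [mem_sphere_zero_iff_norm.mp u.2] at h
      simpa [sq] using h.symm
    simp only [this]
    have hne : (volume : Measure (Euc n)).toSphere ≠ 0 := Measure.toSphere_ne_zero _
    have : NeZero (volume : Measure (Euc n)).toSphere := ⟨hne⟩
    exact average_const _ _
  rw [Finset.sum_congr rfl fun j _ => hsw j, Finset.sum_const, Finset.card_univ, Fintype.card_fin,
    nsmul_eq_mul] at hsum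
  rw [eq_div_iff (Nat.cast_ne_zero.mpr hn.ne'), mul_comm]
  exact hsum

/-- The second moments of a spherical `2`-design. -/
lemma IsSphericalDesign.finsum_coord_mul (hn : 0 < n) {r : ℝ} {X : Set (Euc n)}
    (hX : IsSphericalDesign 2 r X) (hne : X.Nonempty) (i j : Fin n) :
    ∑ᶠ x ∈ X, x i * x j = if i = j then r ^ 2 * X.ncard / n else 0 := by
  have hc : (X.ncard : ℝ) ≠ 0 := by
    exact_mod_cast (Set.ncard_pos hX.1).mpr hne |>.ne'
  have h := hX.2.2 (MvPolynomial.X i * MvPolynomial.X j)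
    ((MvPolynomial.totalDegree_mul _ _).trans (by
      rw [MvPolynomial.totalDegree_X, MvPolynomial.totalDegree_X]))
  simp only [map_mul, MvPolynomial.eval_X] at h
  have h2 : ∑ᶠ x ∈ X, x i * x j = X.ncard * (r ^ 2 *
      ⨍ u : Metric.sphere (0 : Euc n) 1, (u : Euc n) i * (u : Euc n) j
        ∂(volume : Measure (Euc n)).toSphere) := by
    rw [eq_inv_mul_iff_mul_eq₀ hc] at h
    rw [← h]
    congr 1
    have h3 : ∀ u : Metric.sphere (0 : Euc n) 1, r * (u : Euc n) i * (r * (u : Euc n) j) =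
        r ^ 2 * ((u : Euc n) i * (u : Euc n) j) := fun u => by ring
    simp only [h3]
    rw [average_eq, average_eq, smul_eq_mul, smul_eq_mul, integral_const_mul, mul_left_comm]
  rw [h2]
  split_ifs with hij
  · subst hij
    rw [average_coord_sq hn]
    ring
  · rw [average_coord_mul_of_ne hij, mul_zero, mul_zero]

lemma matQuad_eq_sum (G : Matrix (Fin n) (Fin n) ℝ) (x : Euc n) :
    matQuad G x = ∑ i, ∑ j, G i j * (x i * x j) := by
  simp only [matQuad, dotProduct, Matrix.mulVec, Finset.mul_sum]
  exact Finset.sum_congr rfl fun i _ => Finset.sum_congr rfl fun j _ => by ring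

/-- If every nonempty shell is a `2`-design, the mean of a quadratic form over a shell is
determined by its trace. -/
theorem finsum_shell_matQuad (hn : 0 < n) {L : Submodule ℤ (Euc n)} [DiscreteTopology L]
    (hD : ∀ r : ℝ, 0 < r → (shell L (r ^ 2)).Nonempty → IsSphericalDesign 2 r (shell L (r ^ 2)))
    (m : ℕ) (G : Matrix (Fin n) (Fin n) ℝ) :
    ∑ᶠ x ∈ shell L (2 * (m : ℝ)), matQuad G x = 2 * m * thetaCoeff L m / n * G.trace := by
  have hfin := shell_finite L (2 * (m : ℝ))
  have key : ∀ i j : Fin n, ∑ᶠ x ∈ shell L (2 * (m : ℝ)), x i * x j =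
      if i = j then 2 * (m : ℝ) * thetaCoeff L m / n else 0 := by
    intro i j
    rcases (shell L (2 * (m : ℝ))).eq_empty_or_nonempty with he | hne
    · rw [thetaCoeff, he]
      simp
    -- The shell of radius `0` is not covered by the design hypothesis, but the zero vector
    -- contributes nothing.
    · rcases Nat.eq_zero_or_pos m with rfl | hm
      · have : ∀ x ∈ shell L (2 * ((0 : ℕ) : ℝ)), x i * x j = 0 := by
          intro x hx
          have h := hx.2
          simp only [Nat.cast_zero, mul_zero, ne_eq, OfNat.ofNat_ne_zero, not_false_eq_true,
            pow_eq_zero_iff, norm_eq_zero] at h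
          simp [h]
        rw [finsum_mem_congr rfl this]
        simp
      · have hm' : (0 : ℝ) < 2 * m := by positivity
        have hs : Real.sqrt (2 * m) ^ 2 = 2 * m := Real.sq_sqrt hm'.le
        have hX := hD (Real.sqrt (2 * m)) (Real.sqrt_pos.mpr hm') (by rwa [hs])
        rw [hs] at hX
        rw [hX.finsum_coord_mul hn hne, hs, thetaCoeff]
  rw [finsum_mem_eq_finite_toFinset_sum _ hfin]
  simp only [finsum_mem_eq_finite_toFinset_sum _ hfin] at key
  simp only [matQuad_eq_sum]
  rw [Finset.sum_comm]
  simp only [Matrix.trace, Matrix.diag, Finset.mul_sum]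
  refine Finset.sum_congr rfl fun i _ => ?_
  rw [Finset.sum_comm, Finset.sum_eq_single i]
  · rw [← Finset.mul_sum, key, if_pos rfl, mul_comm]
  · intro j _ hj
    rw [← Finset.mul_sum, key, if_neg hj.symm, mul_zero]
  · simp

end Design
end ModularLattice
end

noncomputable section

namespace ModularLattice

/-! ### The harmonic part of the square of a quadratic form -/

section Harmonic

variable {n : ℕ}

/-- The harmonic projection of the square of a traceless diagonal form, as a combination of the
harmonic polynomials `Re (x_i + √-1 x_j)^4`. -/
lemma sum_harmonic_quartic (c x : Fin n → ℝ) (hc : ∑ i, c i = 0) :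
    ∑ i, ∑ j, (if i = j then 0 else
      (2 * (c i * c j) - 4 / ((n : ℝ) + 4) * (c i ^ 2 + c j ^ 2) +
        4 * (∑ i, c i ^ 2) / ((n + 2) * (n + 4))) * (x i ^ 4 - 6 * (x i ^ 2 * x j ^ 2) + x j ^ 4)) =
    -12 * ((∑ i, c i * x i ^ 2) ^ 2 - 4 / ((n : ℝ) + 4) * ((∑ i, x i ^ 2) * ∑ i, c i ^ 2 * x i ^ 2) +
      2 * (∑ i, c i ^ 2) / ((n + 2) * (n + 4)) * (∑ i, x i ^ 2) ^ 2) := by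
  set S := ∑ i, c i ^ 2 with hS
  -- `A` and `D` are the values for which pure fourth powers cancel: once the diagonal is removed,
  -- the coefficients `8 − 2A(n + 4)` of `∑ c_i² x_i⁴` and `2D(n + 2) − 2AS` of `∑ x_i⁴` vanish.
  set A : ℝ := 4 / ((n : ℝ) + 4) with hA
  set D : ℝ := 4 * S / ((n + 2) * (n + 4)) with hD
  set p : Fin n → Fin n → ℝ := fun i j =>
    (2 * (c i * c j) - A * (c i ^ 2 + c j ^ 2) + D) *
      (x i ^ 4 - 6 * (x i ^ 2 * x j ^ 2) + x j ^ 4) with hp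
  have h1 : ∑ i, ∑ j, (if i = j then 0 else p i j) = ∑ i, ∑ j, p i j - ∑ i, p i i := by
    rw [← Finset.sum_sub_distrib]
    refine Finset.sum_congr rfl fun i _ => ?_
    rw [eq_sub_iff_add_eq, ← Finset.add_sum_erase _ _ (Finset.mem_univ i),
      ← Finset.add_sum_erase _ (fun j => p i j) (Finset.mem_univ i), if_pos rfl, zero_add, add_comm]
    congr 1
    exact Finset.sum_congr rfl fun j hj => if_neg (Finset.ne_of_mem_erase hj).symm
  have h2 : ∑ i, p i i = -4 * ((2 - 2 * A) * ∑ i, c i ^ 2 * x i ^ 4 + D * ∑ i, x i ^ 4) := by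
    simp only [Finset.mul_sum, ← Finset.sum_add_distrib]
    exact Finset.sum_congr rfl fun i _ => by rw [hp]; ring
  have h3 : ∑ i, ∑ j, p i j = 2 * ((∑ i, c i * x i ^ 4) * ∑ j, c j)
      - 12 * ((∑ i, c i * x i ^ 2) * ∑ j, c j * x j ^ 2)
      + 2 * ((∑ i, c i) * ∑ j, c j * x j ^ 4)
      - A * ((∑ i, c i ^ 2 * x i ^ 4) * ∑ j : Fin n, (1 : ℝ)) - A * ((∑ i, x i ^ 4) * ∑ j, c j ^ 2)
      - A * ((∑ i : Fin n, (1 : ℝ)) * ∑ j, c j ^ 2 * x j ^ 4) - A * ((∑ i, c i ^ 2) * ∑ j, x j ^ 4)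
      + 6 * A * ((∑ i, c i ^ 2 * x i ^ 2) * ∑ j, x j ^ 2)
      + 6 * A * ((∑ i, x i ^ 2) * ∑ j, c j ^ 2 * x j ^ 2)
      + D * ((∑ i, x i ^ 4) * ∑ j : Fin n, (1 : ℝ)) + D * ((∑ i : Fin n, (1 : ℝ)) * ∑ j, x j ^ 4)
      - 6 * D * ((∑ i, x i ^ 2) * ∑ j, x j ^ 2) := by
    simp only [Finset.sum_mul_sum]
    simp only [Finset.mul_sum, ← Finset.sum_add_distrib, ← Finset.sum_sub_distrib]
    exact Finset.sum_congr rfl fun i _ => Finset.sum_congr rfl fun j _ => by rw [hp]; ring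
  rw [h1, h2, h3, hc, ← hS]
  simp only [Finset.sum_const, Finset.card_univ, Fintype.card_fin, nsmul_eq_mul, mul_one]
  have hn2 : (n : ℝ) + 2 ≠ 0 := by positivity
  have hn4 : (n : ℝ) + 4 ≠ 0 := by positivity
  rw [hD, hA]
  field_simp
  ring

lemma exp_smul_mulVec_eigenvectorBasis {H : Matrix (Fin n) (Fin n) ℝ} (hH : H.IsHermitian) (s : ℝ)
    (i : Fin n) : (NormedSpace.exp (s • H)).mulVec (hH.eigenvectorBasis i).ofLp =
      Real.exp (s * hH.eigenvalues i) • (hH.eigenvectorBasis i).ofLp := by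
  set U : Matrix (Fin n) (Fin n) ℝ := (hH.eigenvectorUnitary).1 with hU
  have hU1 : star U * U = 1 := Unitary.coe_star_mul_self _
  have hU2 : U * star U = 1 := Unitary.coe_mul_star_self _
  have hUu : IsUnit U := ⟨⟨U, star U, hU2, hU1⟩, rfl⟩
  have hinv : U⁻¹ = star U := Matrix.inv_eq_left_inv hU1
  have h1 : s • H = U * Matrix.diagonal (fun j => s * hH.eigenvalues j) * U⁻¹ := by
    conv_lhs => rw [hH.spectral_theorem, Unitary.conjStarAlgAut_apply]
    rw [hinv, show Matrix.diagonal (fun j => s * hH.eigenvalues j) =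
      s • Matrix.diagonal (fun j => hH.eigenvalues j) by rw [← Matrix.diagonal_smul]; rfl,
      Matrix.mul_smul, Matrix.smul_mul]
    rfl
  rw [h1, Matrix.exp_conj _ _ hUu, Matrix.exp_diagonal, ← hH.eigenvectorUnitary_mulVec i, ← hU,
    Matrix.mulVec_mulVec, Matrix.mul_assoc, hinv, hU1, mul_one, ← Matrix.mulVec_mulVec,
    ← Matrix.mulVec_smul]
  congr 1
  funext j
  rw [Matrix.mulVec_diagonal, Pi.coe_exp, ← Real.exp_eq_exp_ℝ]
  rcases eq_or_ne j i with rfl | h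
  · simp
  · simp [h]

/-- Orthonormal eigenvectors of a symmetric matrix. -/
lemma exists_eigenbasis {H : Matrix (Fin n) (Fin n) ℝ} (hH : H.IsSymm) :
    ∃ (u : OrthonormalBasis (Fin n) ℝ (Euc n)) (c : Fin n → ℝ),
      (∀ x, matQuad H x = ∑ i, c i * inner ℝ (u i) x ^ 2) ∧
      (∀ x, matQuad (H ^ 2) x = ∑ i, c i ^ 2 * inner ℝ (u i) x ^ 2) ∧
      H.trace = ∑ i, c i ∧ (H ^ 2).trace = ∑ i, c i ^ 2 ∧
      ∀ s i, (NormedSpace.exp (s • H)).mulVec (u i).ofLp = Real.exp (s * c i) • (u i).ofLp := by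
  have hH' : H.IsHermitian := by
    rw [Matrix.IsHermitian, Matrix.conjTranspose_eq_transpose_of_trivial]
    exact hH
  have hin : ∀ i (x : Euc n), inner ℝ (hH'.eigenvectorBasis i) (WithLp.toLp 2 (H.mulVec x.ofLp)) =
      hH'.eigenvalues i * inner ℝ (hH'.eigenvectorBasis i) x := by
    intro i x
    rw [EuclideanSpace.inner_eq_star_dotProduct, EuclideanSpace.inner_eq_star_dotProduct,
      star_trivial, dotProduct_comm, Matrix.dotProduct_mulVec, ← Matrix.mulVec_transpose, hH,
      hH'.mulVec_eigenvectorBasis, smul_dotProduct, smul_eq_mul, dotProduct_comm]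
  refine ⟨hH'.eigenvectorBasis, hH'.eigenvalues, fun x => ?_, fun x => ?_, ?_, ?_,
    exp_smul_mulVec_eigenvectorBasis hH'⟩
  · have h : matQuad H x = inner ℝ x (WithLp.toLp 2 (H.mulVec x.ofLp)) := by
      rw [EuclideanSpace.inner_eq_star_dotProduct, star_trivial, dotProduct_comm]
      rfl
    rw [h, ← hH'.eigenvectorBasis.sum_inner_mul_inner]
    refine Finset.sum_congr rfl fun i _ => ?_
    rw [hin, real_inner_comm]
    ring
  · have h : matQuad (H ^ 2) x =
        inner ℝ (WithLp.toLp 2 (H.mulVec x.ofLp) : Euc n) (WithLp.toLp 2 (H.mulVec x.ofLp)) := by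
      rw [EuclideanSpace.inner_eq_star_dotProduct, star_trivial, matQuad, sq,
        ← Matrix.mulVec_mulVec, Matrix.dotProduct_mulVec, ← Matrix.mulVec_transpose, hH]
    rw [h, ← hH'.eigenvectorBasis.sum_inner_mul_inner]
    refine Finset.sum_congr rfl fun i _ => ?_
    rw [real_inner_comm, hin]
    ring
  · simpa using hH'.trace_eq_sum_eigenvalues
  · conv_lhs => rw [hH'.spectral_theorem, ← map_pow, Unitary.conjStarAlgAut_apply,
      Matrix.trace_mul_cycle, Unitary.coe_star_mul_self, one_mul, Matrix.diagonal_pow,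
      Matrix.trace_diagonal]
    simp

end Harmonic

/-! ### Linear relations between the shell forms. -/

section Relation

open Complex

variable {n : ℕ}

/-- Summation over a shell, as a linear form. -/
def shellSum (L : Submodule ℤ (Euc n)) [DiscreteTopology L] (m : ℕ) : (Euc n → ℂ) →ₗ[ℂ] ℂ where
  toFun F := ∑ x ∈ (shell_finite L (2 * (m : ℝ))).toFinset, F x
  map_add' F G := Finset.sum_add_distrib
  map_smul' c F := by simp [Finset.mul_sum]

lemma shellSum_apply (L : Submodule ℤ (Euc n)) [DiscreteTopology L] (m : ℕ) (F : Euc n → ℂ) :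
    shellSum L m F = ∑ᶠ x ∈ shell L (2 * (m : ℝ)), F x :=
  (finsum_mem_eq_finite_toFinset_sum _ (shell_finite L _)).symm

/-- The deviation of the shell form `Q_{2m}[H]` from its mean. -/
def shellDeviation (L : Submodule ℤ (Euc n)) (m : ℕ) (H : Matrix (Fin n) (Fin n) ℝ) : ℝ :=
  ∑ᶠ x ∈ shell L (2 * (m : ℝ)), matQuad H x ^ 2 -
    8 * (m : ℝ) ^ 2 * thetaCoeff L m * (H ^ 2).trace / (n * (n + 2))

/-- The harmonic projection of `x ↦ H[x]²`, for traceless `H`. -/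
def harmonicSq (H : Matrix (Fin n) (Fin n) ℝ) (x : Euc n) : ℝ :=
  matQuad H x ^ 2 - 4 / ((n : ℝ) + 4) * (‖x‖ ^ 2 * matQuad (H ^ 2) x) +
    2 * (H ^ 2).trace / ((n + 2) * (n + 4)) * (‖x‖ ^ 2) ^ 2

/-- The design property gives the sums of both correction terms; by `-2/n + 1/(n+2) =
-(n+4)/(n(n+2))` they add up to the mean subtracted in `shellDeviation`. -/
lemma shellSum_harmonicSq (hn : 0 < n) {L : Submodule ℤ (Euc n)} [DiscreteTopology L]
    (hD : ∀ r : ℝ, 0 < r → (shell L (r ^ 2)).Nonempty → IsSphericalDesign 2 r (shell L (r ^ 2)))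
    (m : ℕ) (H : Matrix (Fin n) (Fin n) ℝ) :
    shellSum L m (fun x => (harmonicSq H x : ℂ)) = shellDeviation L m H := by
  have hfin := shell_finite L (2 * (m : ℝ))
  have h2 := finsum_shell_matQuad hn hD m (H ^ 2)
  rw [finsum_mem_eq_finite_toFinset_sum _ hfin] at h2
  have hcard : ((shell_finite L (2 * (m : ℝ))).toFinset.card : ℝ) = thetaCoeff L m := by
    rw [thetaCoeff, Set.ncard_eq_toFinset_card _ hfin]
  change ∑ x ∈ (shell_finite L (2 * (m : ℝ))).toFinset, (harmonicSq H x : ℂ) = _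
  rw [← Complex.ofReal_sum, shellDeviation, finsum_mem_eq_finite_toFinset_sum _ hfin]
  congr 1
  have h3 : ∀ x ∈ hfin.toFinset, harmonicSq H x =
      matQuad H x ^ 2 - 8 * m / ((n : ℝ) + 4) * matQuad (H ^ 2) x +
        8 * (m : ℝ) ^ 2 * (H ^ 2).trace / ((n + 2) * (n + 4)) := by
    intro x hx
    rw [harmonicSq, ((hfin.mem_toFinset).mp hx).2]
    ring
  rw [Finset.sum_congr rfl h3, Finset.sum_add_distrib, Finset.sum_sub_distrib, ← Finset.mul_sum, h2,
    Finset.sum_const, nsmul_eq_mul, hcard]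
  have hn0 : (n : ℝ) ≠ 0 := by positivity
  have hn2 : (n : ℝ) + 2 ≠ 0 := by positivity
  have hn4 : (n : ℝ) + 4 ≠ 0 := by positivity
  field_simp
  ring

/-- Linear relation between the shell forms, given by the cusp forms. -/
theorem shellDeviation_eq_sum {k ℓ e : ℕ} (hn : 0 < n) (hℓ : 0 < ℓ) (hk : n = 2 * k)
    {L : Submodule ℤ (Euc n)} [DiscreteTopology L] [IsZLattice ℝ L]
    (hL : IsEvenLattice L) (hm : IsModularLattice ℓ L)
    (hD : ∀ r : ℝ, 0 < r → (shell L (r ^ 2)).Nonempty → IsSphericalDesign 2 r (shell L (r ^ 2)))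
    (C : Module.Basis (Fin e) ℂ (cuspForms ℓ k ((k : ℤ) + 4)))
    (hC : IsReducedRowEchelon (fun i => (C i : ℍ → ℂ))) (m : ℕ)
    {H : Matrix (Fin n) (Fin n) ℝ} (hH : H.IsSymm) (hH0 : H.trace = 0) :
    (shellDeviation L m H : ℂ) =
      ∑ i : Fin e, qCoeff (C i) m * (shellDeviation L ((i : ℕ) + 1) H : ℂ) := by
  -- `J` is the defect of the desired relation, as a linear functional. It kills `clin a b ^ 4` for
  -- isotropic pairs, and `harmonicSq H` is a combination of real parts of such powers over pairs of
  -- orthonormal eigenvectors of `H`.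
  set J : (Euc n → ℂ) →ₗ[ℂ] ℂ :=
    shellSum L m - ∑ i : Fin e, qCoeff (C i) m • shellSum L ((i : ℕ) + 1) with hJ
  have hJapp : ∀ F, J F = shellSum L m F -
      ∑ i : Fin e, qCoeff (C i) m * shellSum L ((i : ℕ) + 1) F := by
    intro F
    simp [hJ, LinearMap.sum_apply]
  have hiso : ∀ a b : Euc n, IsIsotropic a b → J (fun x => clin a b x ^ 4) = 0 := by
    intro a b hab
    rw [hJapp, sub_eq_zero, shellSum_apply, finsum_shell_clin_pow_four hℓ hk hL hm C hC hab]
    exact Finset.sum_congr rfl fun i _ => by rw [shellSum_apply]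
  obtain ⟨u, c, hu1, hu2, hu3, hu4, -⟩ := exists_eigenbasis hH
  have hJij : ∀ i j, i ≠ j → J (fun x => ((inner ℝ (u i) x ^ 4 -
      6 * (inner ℝ (u i) x ^ 2 * inner ℝ (u j) x ^ 2) + inner ℝ (u j) x ^ 4 : ℝ) : ℂ)) = 0 := by
    intro i j hij
    have h1 : inner ℝ (u i) (u i) = (1 : ℝ) := by
      rw [real_inner_self_eq_norm_sq, u.norm_eq_one, one_pow]
    have h2 : inner ℝ (u j) (u j) = (1 : ℝ) := by
      rw [real_inner_self_eq_norm_sq, u.norm_eq_one, one_pow]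
    have h3 : inner ℝ (u i) (u j) = (0 : ℝ) := u.inner_eq_zero hij
    have e1 := hiso (u i) (u j) ⟨by rw [h1, h2], h3⟩
    have e2 := hiso (u i) (-u j) ⟨by rw [inner_neg_neg, h1, h2], by rw [inner_neg_right, h3, neg_zero]⟩
    -- A real part is half the sum with the conjugate, which belongs to the isotropic pair `u i`,
    -- `-u j`.
    have e3 : (fun x => ((inner ℝ (u i) x ^ 4 -
        6 * (inner ℝ (u i) x ^ 2 * inner ℝ (u j) x ^ 2) + inner ℝ (u j) x ^ 4 : ℝ) : ℂ)) =
        (1 / 2 : ℂ) • ((fun x => clin (u i) (u j) x ^ 4) + fun x => clin (u i) (-u j) x ^ 4) := by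
      funext x
      simp only [Pi.smul_apply, Pi.add_apply, clin_apply, inner_neg_left, smul_eq_mul]
      push_cast
      linear_combination (-6 * (inner ℝ (u i) x : ℂ) ^ 2 * (inner ℝ (u j) x : ℂ) ^ 2 -
        (inner ℝ (u j) x : ℂ) ^ 4 * (I ^ 2 - 1)) * I_sq
    rw [e3, map_smul, map_add, e1, e2, add_zero, smul_zero]
  have hP : (fun x => (harmonicSq H x : ℂ)) = ∑ i, ∑ j, (if i = j then 0 else
      ((-1 / 12 * (2 * (c i * c j) - 4 / ((n : ℝ) + 4) * (c i ^ 2 + c j ^ 2) +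
        4 * (∑ i, c i ^ 2) / ((n + 2) * (n + 4))) : ℝ) : ℂ)) • (fun x : Euc n =>
        ((inner ℝ (u i) x ^ 4 - 6 * (inner ℝ (u i) x ^ 2 * inner ℝ (u j) x ^ 2) +
          inner ℝ (u j) x ^ 4 : ℝ) : ℂ)) := by
    funext x
    have h := sum_harmonic_quartic c (fun i => inner ℝ (u i) x) (hu3 ▸ hH0)
    have hnorm : ‖x‖ ^ 2 = ∑ i, inner ℝ (u i) x ^ 2 := by
      rw [← real_inner_self_eq_norm_sq, ← u.sum_inner_mul_inner]
      exact Finset.sum_congr rfl fun i _ => by rw [real_inner_comm, sq]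
    have h' : harmonicSq H x = ∑ i, ∑ j, (if i = j then 0 else
      (-1 / 12 * (2 * (c i * c j) - 4 / ((n : ℝ) + 4) * (c i ^ 2 + c j ^ 2) +
        4 * (∑ i, c i ^ 2) / ((n + 2) * (n + 4))) )) *
        (inner ℝ (u i) x ^ 4 - 6 * (inner ℝ (u i) x ^ 2 * inner ℝ (u j) x ^ 2) +
          inner ℝ (u j) x ^ 4) := by
      rw [harmonicSq, hu1, hu2, hu4, hnorm]
      have h4 := congrArg (fun t => -1 / 12 * t) h
      refine Eq.trans (by ring) (h4.symm.trans ?_)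
      rw [Finset.mul_sum]
      refine Finset.sum_congr rfl fun i _ => ?_
      rw [Finset.mul_sum]
      refine Finset.sum_congr rfl fun j _ => ?_
      split_ifs
      · simp
      · ring
    rw [h']
    simp only [Finset.sum_apply, Pi.smul_apply, smul_eq_mul]
    push_cast
    refine Finset.sum_congr rfl fun i _ => Finset.sum_congr rfl fun j _ => ?_
    split_ifs <;> simp
  have hJP : J (fun x => (harmonicSq H x : ℂ)) = 0 := by
    rw [hP, map_sum]
    refine Finset.sum_eq_zero fun i _ => ?_
    rw [map_sum]
    refine Finset.sum_eq_zero fun j _ => ?_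
    rw [map_smul]
    split_ifs with hij
    · rw [zero_smul]
    · rw [hJij i j hij, smul_zero]
  rw [hJapp, sub_eq_zero, shellSum_harmonicSq hn hD] at hJP
  rw [hJP]
  exact Finset.sum_congr rfl fun i _ => by rw [shellSum_harmonicSq hn hD]

end Relation
end ModularLattice
end

noncomputable section

namespace ModularLattice

/-! ### The Hessian of the energy -/

section ExpSums

variable {n : ℕ} {ι : Type*}

/-- `∑ c_i^d exp(t c_i) y_i²`, the `d`-th derivative of `t ↦ ∑ exp(t c_i) y_i²`. -/
def expForm (c y : Fin n → ℝ) (d : ℕ) (t : ℝ) : ℝ := ∑ i, c i ^ d * Real.exp (t * c i) * y i ^ 2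

lemma hasDerivAt_expForm (c y : Fin n → ℝ) (d : ℕ) (t : ℝ) :
    HasDerivAt (expForm c y d) (expForm c y (d + 1) t) t := by
  unfold expForm
  refine HasDerivAt.fun_sum fun i _ => ?_
  have h := (((hasDerivAt_id t).mul_const (c i)).exp.const_mul (c i ^ d)).mul_const (y i ^ 2)
  refine h.congr_deriv ?_
  simp only [id]
  ring

lemma abs_expForm_le (c y : Fin n → ℝ) (d : ℕ) {K : ℝ} (hK : ∀ i, |c i| ≤ K) {t : ℝ}
    (ht : |t| ≤ 1) : |expForm c y d t| ≤ K ^ d * Real.exp K * ∑ i, y i ^ 2 := by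
  rw [expForm, Finset.mul_sum]
  refine (Finset.abs_sum_le_sum_abs _ _).trans (Finset.sum_le_sum fun i _ => ?_)
  rw [abs_mul, abs_mul, abs_pow, Real.abs_exp, abs_of_nonneg (sq_nonneg (y i))]
  have h0 := abs_nonneg (c i)
  have hK0 : 0 ≤ K := h0.trans (hK i)
  have h1 : t * c i ≤ K := (le_abs_self _).trans (by
    rw [abs_mul]
    exact (mul_le_mul ht (hK i) h0 zero_le_one).trans (one_mul K).le)
  gcongr
  exact hK i

/-- For `|t| ≤ 1` the deformed norm stays above a fixed fraction of the original one; this yields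
the majorants for termwise differentiation. -/
lemma le_expForm_zero (c y : Fin n → ℝ) {K : ℝ} (hK : ∀ i, |c i| ≤ K) {t : ℝ}
    (ht : |t| ≤ 1) : Real.exp (-K) * ∑ i, y i ^ 2 ≤ expForm c y 0 t := by
  rw [expForm, Finset.mul_sum]
  refine Finset.sum_le_sum fun i _ => ?_
  rw [pow_zero, one_mul]
  have h0 := abs_nonneg (c i)
  have h1 : -K ≤ t * c i := neg_le_of_abs_le (by
    rw [abs_mul]
    exact (mul_le_mul ht (hK i) h0 zero_le_one).trans (one_mul K).le)
  gcongr

/-- Second derivative at `0` of `t ↦ ∑_x exp(-α ∑_i exp(t c_i) y_i(x)²)`. -/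
theorem hasSum_iteratedDeriv_two_exp (c : Fin n → ℝ) (y : ι → Fin n → ℝ) {α : ℝ} (hα : 0 < α)
    (hs : ∀ (j : ℕ) (β : ℝ), 0 < β →
      Summable fun x => (∑ i, y x i ^ 2) ^ j * Real.exp (-β * ∑ i, y x i ^ 2)) :
    HasSum (fun x => ((α * expForm c (y x) 1 0) ^ 2 - α * expForm c (y x) 2 0) *
        Real.exp (-α * expForm c (y x) 0 0))
      (iteratedDeriv 2 (fun t => ∑' x, Real.exp (-α * expForm c (y x) 0 t)) 0) := by
  obtain ⟨K, hK⟩ : ∃ K : ℝ, ∀ i, |c i| ≤ K :=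
    ⟨∑ i, |c i|, fun i => Finset.single_le_sum (f := fun i => |c i|) (fun i _ => abs_nonneg _)
      (Finset.mem_univ i)⟩
  set g : ι → ℝ → ℝ := fun x t => Real.exp (-α * expForm c (y x) 0 t) with hg
  set g1 : ι → ℝ → ℝ := fun x t => -(α * expForm c (y x) 1 t) * g x t with hg1
  set g2 : ι → ℝ → ℝ := fun x t =>
    ((α * expForm c (y x) 1 t) ^ 2 - α * expForm c (y x) 2 t) * g x t with hg2
  have hd1 : ∀ x t, HasDerivAt (g x) (g1 x t) t := by
    intro x t
    refine ((hasDerivAt_expForm c (y x) 0 t).const_mul (-α)).exp.congr_deriv ?_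
    simp only [hg1, hg]
    ring
  have hd2 : ∀ x t, HasDerivAt (g1 x) (g2 x t) t := by
    intro x t
    refine (((hasDerivAt_expForm c (y x) 1 t).const_mul α).neg.mul (hd1 x t)).congr_deriv ?_
    simp only [hg2, hg1, Pi.neg_apply]
    ring
  set N : ι → ℝ := fun x => ∑ i, y x i ^ 2 with hN
  have hN0 : ∀ x, 0 ≤ N x := fun x => Finset.sum_nonneg fun i _ => sq_nonneg _
  set β := α * Real.exp (-K) with hβ
  have hβ0 : 0 < β := by positivity
  have hbg : ∀ x t, |t| ≤ 1 → g x t ≤ Real.exp (-β * N x) := by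
    intro x t ht
    refine Real.exp_le_exp.mpr ?_
    have := mul_le_mul_of_nonneg_left (le_expForm_zero c (y x) hK ht) hα.le
    rw [← mul_assoc] at this
    linarith
  have hg0 : ∀ x t, 0 ≤ g x t := fun x t => (Real.exp_pos _).le
  have hb1 : ∀ x t, |t| ≤ 1 → ‖g1 x t‖ ≤
      α * (K ^ 1 * Real.exp K) * (N x ^ 1 * Real.exp (-β * N x)) := by
    intro x t ht
    have h1 := abs_expForm_le c (y x) 1 hK ht
    rw [Real.norm_eq_abs, hg1, abs_mul, abs_neg, abs_mul, abs_of_pos hα, abs_of_nonneg (hg0 x t)]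
    calc α * |expForm c (y x) 1 t| * g x t
        ≤ α * (K ^ 1 * Real.exp K * N x) * Real.exp (-β * N x) := by
          have := hbg x t ht
          have := hg0 x t
          gcongr
          exact mul_nonneg hα.le ((abs_nonneg _).trans h1)
      _ = _ := by ring
  have hb2 : ∀ x t, |t| ≤ 1 → ‖g2 x t‖ ≤
      (α * (K ^ 1 * Real.exp K)) ^ 2 * (N x ^ 2 * Real.exp (-β * N x)) +
        α * (K ^ 2 * Real.exp K) * (N x ^ 1 * Real.exp (-β * N x)) := by
    intro x t ht
    have h1 := abs_expForm_le c (y x) 1 hK ht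
    have h2 := abs_expForm_le c (y x) 2 hK ht
    have h3 : |(α * expForm c (y x) 1 t) ^ 2 - α * expForm c (y x) 2 t| ≤
        (α * (K ^ 1 * Real.exp K * N x)) ^ 2 + α * (K ^ 2 * Real.exp K * N x) := by
      refine (abs_sub _ _).trans ?_
      rw [abs_pow, abs_mul, abs_mul, abs_of_pos hα]
      gcongr
    rw [Real.norm_eq_abs, hg2, abs_mul, abs_of_nonneg (hg0 x t)]
    calc |(α * expForm c (y x) 1 t) ^ 2 - α * expForm c (y x) 2 t| * g x t
        ≤ ((α * (K ^ 1 * Real.exp K * N x)) ^ 2 + α * (K ^ 2 * Real.exp K * N x)) *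
          Real.exp (-β * N x) :=
          mul_le_mul h3 (hbg x t ht) (hg0 x t) ((abs_nonneg _).trans h3)
      _ = _ := by ring
  have hs1 : Summable fun x => α * (K ^ 1 * Real.exp K) * (N x ^ 1 * Real.exp (-β * N x)) :=
    (hs 1 β hβ0).mul_left _
  have hs2 : Summable fun x => (α * (K ^ 1 * Real.exp K)) ^ 2 * (N x ^ 2 * Real.exp (-β * N x)) +
        α * (K ^ 2 * Real.exp K) * (N x ^ 1 * Real.exp (-β * N x)) :=
    ((hs 2 β hβ0).mul_left _).add ((hs 1 β hβ0).mul_left _)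
  have hmem : ∀ t ∈ Set.Ioo (-1 : ℝ) 1, |t| ≤ 1 := fun t ht => abs_le.mpr ⟨ht.1.le, ht.2.le⟩
  have h00 : (0 : ℝ) ∈ Set.Ioo (-1 : ℝ) 1 := by constructor <;> norm_num
  have hsg : Summable fun x => g x 0 :=
    Summable.of_nonneg_of_le (fun x => hg0 x 0) (fun x => by simpa using hbg x 0 (by simp))
      (by simpa using hs 0 β hβ0)
  have hsg1 : Summable fun x => g1 x 0 :=
    Summable.of_norm_bounded hs1 fun x => hb1 x 0 (by simp)
  have hsg2 : Summable fun x => g2 x 0 :=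
    Summable.of_norm_bounded hs2 fun x => hb2 x 0 (by simp)
  -- The first derivative is needed on a neighbourhood of `0`, since it is differentiated again.
  have hD1 : ∀ t ∈ Set.Ioo (-1 : ℝ) 1, HasDerivAt (fun t => ∑' x, g x t) (∑' x, g1 x t) t :=
    fun t ht => hasDerivAt_tsum_of_isPreconnected hs1 isOpen_Ioo isPreconnected_Ioo
      (fun x t _ => hd1 x t) (fun x t ht => hb1 x t (hmem t ht)) h00 hsg ht
  have hD2 : HasDerivAt (fun t => ∑' x, g1 x t) (∑' x, g2 x 0) 0 :=
    hasDerivAt_tsum_of_isPreconnected hs2 isOpen_Ioo isPreconnected_Ioo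
      (fun x t _ => hd2 x t) (fun x t ht => hb2 x t (hmem t ht)) h00 hsg1 h00
  have hit : iteratedDeriv 2 (fun t => ∑' x, g x t) 0 = ∑' x, g2 x 0 := by
    rw [iteratedDeriv_succ, iteratedDeriv_one]
    refine (Filter.EventuallyEq.deriv_eq ?_).trans hD2.deriv
    filter_upwards [isOpen_Ioo.mem_nhds h00] with t ht
    exact (hD1 t ht).deriv
  rw [hit]
  exact hsg2.hasSum

end ExpSums

/-! ### The energy of deformed lattices. -/

section Hessian

variable {n : ℕ}

lemma summable_norm_sq_pow_mul_exp (L : Submodule ℤ (Euc n)) [DiscreteTopology L] [IsZLattice ℝ L]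
    (j : ℕ) {β : ℝ} (hβ : 0 < β) :
    Summable fun x : L => (‖(x : Euc n)‖ ^ 2) ^ j * Real.exp (-β * ‖(x : Euc n)‖ ^ 2) := by
  have hr : IsRapid fun x : Euc n => (((‖x‖ ^ 2) ^ j * Real.exp (-β * ‖x‖ ^ 2) : ℝ) : ℂ) := by
    refine isRapid_of_bound (by fun_prop) (M := 1) hβ (2 * j) fun x => ?_
    rw [Complex.norm_real, Real.norm_of_nonneg (by positivity), one_mul, ← pow_mul]
    gcongr
    linarith [norm_nonneg x]
  have h := hr.summable L 0
  simp only [zero_add] at h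
  exact Complex.summable_ofReal.mp h

/-- Summing over the undeformed lattice keeps the index set fixed while the deformation parameter
varies. -/
lemma energy_map (α : ℝ) (L : Submodule ℤ (Euc n)) (f : Euc n →ₗ[ℝ] Euc n)
    (hf : Function.Injective f) :
    energy α (L.map (f.restrictScalars ℤ)) =
      ∑' x : {x : Euc n // x ∈ L ∧ x ≠ 0}, Real.exp (-α * ‖f x‖ ^ 2) := by
  let e : {x : Euc n // x ∈ L ∧ x ≠ 0} ≃
      {x : Euc n // x ∈ L.map (f.restrictScalars ℤ) ∧ x ≠ 0} :=
    Equiv.ofBijective (fun x => ⟨f x, ⟨x, x.2.1, rfl⟩, fun h => x.2.2 (hf (h.trans (map_zero f).symm))⟩)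
      ⟨fun x y h => Subtype.ext (hf (congrArg Subtype.val h)), by
        rintro ⟨_, ⟨x, hx, rfl⟩, h0⟩
        exact ⟨⟨x, hx, fun h => h0 (by rw [h]; exact map_zero f)⟩, rfl⟩⟩
  exact (e.tsum_eq _).symm

/-- The Hessian of the energy, as a sum over the lattice. -/
theorem hasSum_hessian {α : ℝ} (hα : 0 < α) (L : Submodule ℤ (Euc n)) [DiscreteTopology L]
    [IsZLattice ℝ L] (H : tracelessSymm n) :
    HasSum (fun x : {x : Euc n // x ∈ L ∧ x ≠ 0} =>
        α * (Real.exp (-α * ‖(x : Euc n)‖ ^ 2) *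
          (α / 2 * matQuad (H : Matrix (Fin n) (Fin n) ℝ) x ^ 2
            - 1 / 2 * matQuad ((H : Matrix (Fin n) (Fin n) ℝ) ^ 2) x)))
        (hessian α L H) := by
  obtain ⟨u, c, hu1, hu2, -, -, hu5⟩ := exists_eigenbasis H.2.1
  have hnorm : ∀ x : Euc n, ‖x‖ ^ 2 = ∑ i, inner ℝ (u i) x ^ 2 := by
    intro x
    rw [← real_inner_self_eq_norm_sq, ← u.sum_inner_mul_inner]
    exact Finset.sum_congr rfl fun i _ => by rw [real_inner_comm, sq]
  set M : ℝ → Matrix (Fin n) (Fin n) ℝ := fun t =>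
    NormedSpace.exp ((1 / 2 : ℝ) • (t • (H : Matrix (Fin n) (Fin n) ℝ))) with hM
  have hMin : ∀ t i (x : Euc n), inner ℝ (u i) (Matrix.toEuclideanLin (M t) x) =
      Real.exp (t / 2 * c i) * inner ℝ (u i) x := by
    intro t i x
    have hsymm : (M t).transpose = M t := by
      have hHs : (H : Matrix (Fin n) (Fin n) ℝ).transpose = H := H.2.1
      rw [hM, ← Matrix.exp_transpose, Matrix.transpose_smul, Matrix.transpose_smul, hHs]
    have h5 := hu5 (t / 2) i
    rw [show (t / 2) • (H : Matrix (Fin n) (Fin n) ℝ) =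
      (1 / 2 : ℝ) • (t • (H : Matrix (Fin n) (Fin n) ℝ)) by rw [smul_smul]; congr 1; ring] at h5
    rw [Matrix.toLpLin_apply, EuclideanSpace.inner_eq_star_dotProduct,
      EuclideanSpace.inner_eq_star_dotProduct, star_trivial, dotProduct_comm,
      Matrix.dotProduct_mulVec, ← Matrix.mulVec_transpose, hsymm, h5, smul_dotProduct, smul_eq_mul,
      dotProduct_comm]
  -- `exp(tH/2)` scales the `i`-th eigencoordinate by `exp(t c_i/2)`; squaring removes the half.
  have hMnorm : ∀ t (x : Euc n), ‖Matrix.toEuclideanLin (M t) x‖ ^ 2 =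
      expForm c (fun i => inner ℝ (u i) x) 0 t := by
    intro t x
    rw [hnorm, expForm]
    refine Finset.sum_congr rfl fun i _ => ?_
    rw [hMin, mul_pow, ← Real.exp_nat_mul, pow_zero, one_mul]
    congr 2
    push_cast
    ring
  have hinj : ∀ t, Function.Injective (Matrix.toEuclideanLin (M t)) := by
    intro t
    rw [← LinearMap.ker_eq_bot, LinearMap.ker_eq_bot']
    intro x hx
    rw [← norm_eq_zero, ← sq_eq_zero_iff, hnorm]
    refine Finset.sum_eq_zero fun i _ => ?_
    have h := hMin t i x
    rw [hx, inner_zero_right, eq_comm, mul_eq_zero] at h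
    rw [h.resolve_left (Real.exp_pos _).ne', sq, mul_zero]
  have hE : (fun t : ℝ => energy α (deform L (t • (H : Matrix (Fin n) (Fin n) ℝ)))) =
      fun t => ∑' x : {x : Euc n // x ∈ L ∧ x ≠ 0},
        Real.exp (-α * expForm c (fun i => inner ℝ (u i) (x : Euc n)) 0 t) := by
    funext t
    rw [deform, energy_map α L _ (hinj t)]
    exact tsum_congr fun x => by rw [hMnorm]
  have hkey := hasSum_iteratedDeriv_two_exp (ι := {x : Euc n // x ∈ L ∧ x ≠ 0}) c
    (fun x i => inner ℝ (u i) (x : Euc n)) hα (fun j β hβ => by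
      have h := (summable_norm_sq_pow_mul_exp L j hβ).comp_injective
        (i := fun x : {x : Euc n // x ∈ L ∧ x ≠ 0} => (⟨x, x.2.1⟩ : L))
        (fun x y h => Subtype.ext (congrArg (fun z : L => (z : Euc n)) h))
      refine h.congr fun x => ?_
      rw [← hnorm]
      rfl)
  rw [← hE] at hkey
  refine (hkey.mul_left (1 / 2)).congr_fun fun x => ?_
  rw [show expForm c (fun i => inner ℝ (u i) (x : Euc n)) 0 0 = ‖(x : Euc n)‖ ^ 2 by
      simp [expForm, hnorm],
    show expForm c (fun i => inner ℝ (u i) (x : Euc n)) 1 0 =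
      matQuad (H : Matrix (Fin n) (Fin n) ℝ) x by simp [expForm, hu1],
    show expForm c (fun i => inner ℝ (u i) (x : Euc n)) 2 0 =
      matQuad ((H : Matrix (Fin n) (Fin n) ℝ) ^ 2) x by simp [expForm, hu2]]
  ring

end Hessian
end ModularLattice
end

noncomputable section

namespace ModularLattice

/-! ### Eigenvalues of the Hessian -/

section Eigen

variable {n : ℕ}

lemma finsum_shell_const (L : Submodule ℤ (Euc n)) [DiscreteTopology L] (m : ℕ) (a : ℝ) :
    ∑ᶠ _x ∈ shell L (2 * (m : ℝ)), a = thetaCoeff L m * a := by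
  have hfin := shell_finite L (2 * (m : ℝ))
  rw [finsum_mem_eq_finite_toFinset_sum _ hfin, Finset.sum_const, nsmul_eq_mul, thetaCoeff,
    Set.ncard_eq_toFinset_card _ hfin]

/-- The terms are shell sums of a convergent series of Gaussian moments over `L`. -/
lemma summable_thetaTerm {α : ℝ} (hα : 0 < α) {L : Submodule ℤ (Euc n)} [DiscreteTopology L]
    [IsZLattice ℝ L] (hL : IsEvenLattice L) : Summable fun m : ℕ => thetaTerm α L m := by
  have h := ((summable_norm_sq_pow_mul_exp L 2 hα).mul_left (α ^ 2)).sub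
    ((summable_norm_sq_pow_mul_exp L 1 hα).mul_left (α * ((n : ℝ) / 2 + 1)))
  have h2 := hL.hasSum_shell (F := fun x => α ^ 2 * ((‖x‖ ^ 2) ^ 2 * Real.exp (-α * ‖x‖ ^ 2)) -
    α * ((n : ℝ) / 2 + 1) * ((‖x‖ ^ 2) ^ 1 * Real.exp (-α * ‖x‖ ^ 2))) h.hasSum
  refine h2.summable.congr fun m => ?_
  rw [finsum_mem_congr (g := fun _ => (2 * α * m) * (2 * α * m - ((n : ℝ) / 2 + 1)) *
    Real.exp (-2 * α * m)) rfl fun x hx => ?_, finsum_shell_const, thetaTerm]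
  · ring
  · rw [hx.2, show -α * (2 * (m : ℝ)) = -2 * α * m by ring]
    ring

lemma summable_cuspTerm {e ℓ k : ℕ} {w : ℤ} {α : ℝ} (hα : 0 < α) (L : Submodule ℤ (Euc n))
    (C : Fin e → cuspForms ℓ k w) (lam : Fin e → ℝ) :
    Summable fun m : ℕ => cuspTerm α L (fun i => (C i : ℍ → ℂ)) lam m := by
  have h : Summable fun m : ℕ => ∑ i : Fin e, ((α ^ 2 / 2 * (lam i * n * (n + 2) -
      8 * ((i : ℕ) + 1) ^ 2 * thetaCoeff L ((i : ℕ) + 1)) : ℝ) : ℂ) *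
        (qCoeff (C i) m * (Real.exp (-2 * α * m) : ℂ)) :=
    summable_sum fun i _ => (summable_qCoeff_mul_exp (C i).2 hα).mul_left _
  refine h.congr fun m => ?_
  rw [cuspTerm, Finset.sum_mul]
  exact Finset.sum_congr rfl fun i _ => by ring

lemma matQuad_zero_right (H : Matrix (Fin n) (Fin n) ℝ) : matQuad H 0 = 0 := by
  simp [matQuad]

lemma matQuad_add (G H : Matrix (Fin n) (Fin n) ℝ) (x : Euc n) :
    matQuad (G + H) x = matQuad G x + matQuad H x := by
  rw [matQuad, Matrix.add_mulVec, dotProduct_add]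
  rfl

/-- The Hessian in terms of the shell forms. -/
theorem hasSum_hessian_shell (hn : 0 < n) {α : ℝ} (hα : 0 < α) {L : Submodule ℤ (Euc n)}
    [DiscreteTopology L] [IsZLattice ℝ L] (hL : IsEvenLattice L)
    (hD : ∀ r : ℝ, 0 < r → (shell L (r ^ 2)).Nonempty → IsSphericalDesign 2 r (shell L (r ^ 2)))
    (H : tracelessSymm n) :
    HasSum (fun m : ℕ => α ^ 2 / 2 * Real.exp (-2 * α * m) *
        shellDeviation L m (H : Matrix (Fin n) (Fin n) ℝ) +
        ((H : Matrix (Fin n) (Fin n) ℝ) ^ 2).trace / (n * (n + 2)) * thetaTerm α L m)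
      (hessian α L H) := by
  set F : Euc n → ℝ := fun x => α * (Real.exp (-α * ‖x‖ ^ 2) *
    (α / 2 * matQuad (H : Matrix (Fin n) (Fin n) ℝ) x ^ 2
      - 1 / 2 * matQuad ((H : Matrix (Fin n) (Fin n) ℝ) ^ 2) x)) with hF
  have h1 : HasSum (fun x : L => F x) (hessian α L H) := by
    have hi : Function.Injective
        (fun x : {x : Euc n // x ∈ L ∧ x ≠ 0} => (⟨x, x.2.1⟩ : L)) := fun x y h =>
      Subtype.ext (congrArg (fun z : L => (z : Euc n)) h)
    -- The zero vector may be included, since both quadratic forms vanish there.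
    refine (hi.hasSum_iff fun x hx => ?_).mp (hasSum_hessian hα L H)
    have : (x : Euc n) = 0 := by
      by_contra h0
      exact hx ⟨⟨x, x.2, h0⟩, rfl⟩
    simp [hF, this, matQuad_zero_right]
  refine (hL.hasSum_shell h1).congr_fun fun m => ?_
  have hfin := shell_finite L (2 * (m : ℝ))
  have h2 := finsum_shell_matQuad hn hD m ((H : Matrix (Fin n) (Fin n) ℝ) ^ 2)
  rw [finsum_mem_eq_finite_toFinset_sum _ hfin] at h2 ⊢
  have h3 : ∀ x ∈ hfin.toFinset, F x = α ^ 2 / 2 * Real.exp (-2 * α * m) *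
      matQuad (H : Matrix (Fin n) (Fin n) ℝ) x ^ 2 - α / 2 * Real.exp (-2 * α * m) *
        matQuad ((H : Matrix (Fin n) (Fin n) ℝ) ^ 2) x := by
    intro x hx
    have hx2 := (hfin.mem_toFinset.mp hx).2
    rw [hF]
    simp only
    rw [hx2, show -α * (2 * (m : ℝ)) = -2 * α * m by ring]
    ring
  -- Replacing `Q_{2m}` by its deviation leaves `4α²m² − αm(n + 2) = 2αm(2αm − (n/2 + 1))` as the
  -- factor of `a_m Tr(H²) exp(-2αm)/(n(n+2))`: the theta term.
  rw [Finset.sum_congr rfl h3, Finset.sum_sub_distrib, ← Finset.mul_sum, ← Finset.mul_sum, h2,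
    shellDeviation, finsum_mem_eq_finite_toFinset_sum _ hfin, thetaTerm]
  have hn0 : (n : ℝ) ≠ 0 := by positivity
  have hn2 : (n : ℝ) + 2 ≠ 0 := by positivity
  field_simp
  ring

/-- Polarization of `shellDeviation`. -/
lemma shellDeviation_polar (L : Submodule ℤ (Euc n)) [DiscreteTopology L] (m : ℕ)
    (G H : tracelessSymm n) :
    1 / 2 * (shellDeviation L m ((G + H : tracelessSymm n) : Matrix (Fin n) (Fin n) ℝ) -
      shellDeviation L m (G : Matrix (Fin n) (Fin n) ℝ) -
      shellDeviation L m (H : Matrix (Fin n) (Fin n) ℝ)) =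
    shellBilin L (2 * m) G H - 8 * (m : ℝ) ^ 2 * thetaCoeff L m *
      ((G : Matrix (Fin n) (Fin n) ℝ) * H).trace / (n * (n + 2)) := by
  have hfin := shell_finite L (2 * (m : ℝ))
  have h1 : (((G + H : tracelessSymm n) : Matrix (Fin n) (Fin n) ℝ) ^ 2).trace =
      ((G : Matrix (Fin n) (Fin n) ℝ) ^ 2).trace + ((H : Matrix (Fin n) (Fin n) ℝ) ^ 2).trace +
        2 * ((G : Matrix (Fin n) (Fin n) ℝ) * H).trace := by
    rw [Submodule.coe_add, sq, sq, sq, add_mul, mul_add, mul_add, Matrix.trace_add,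
      Matrix.trace_add, Matrix.trace_add, Matrix.trace_mul_comm (H : Matrix (Fin n) (Fin n) ℝ) G]
    ring
  have h2 : ∑ x ∈ hfin.toFinset,
      matQuad ((G + H : tracelessSymm n) : Matrix (Fin n) (Fin n) ℝ) x ^ 2 =
      ∑ x ∈ hfin.toFinset, matQuad (G : Matrix (Fin n) (Fin n) ℝ) x ^ 2 +
      ∑ x ∈ hfin.toFinset, matQuad (H : Matrix (Fin n) (Fin n) ℝ) x ^ 2 +
      2 * ∑ x ∈ hfin.toFinset, matQuad (G : Matrix (Fin n) (Fin n) ℝ) x *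
        matQuad (H : Matrix (Fin n) (Fin n) ℝ) x := by
    rw [Finset.mul_sum, ← Finset.sum_add_distrib, ← Finset.sum_add_distrib]
    refine Finset.sum_congr rfl fun x _ => ?_
    rw [Submodule.coe_add, matQuad_add]
    ring
  simp only [shellDeviation, shellBilin, finsum_mem_eq_finite_toFinset_sum _ hfin]
  rw [h1, h2]
  ring

/-- On a common eigenspace of the shell forms, the Hessian is given by the eigenvalue formula. -/
theorem hessianBilin_eq {k ℓ e : ℕ} (hn : 0 < n) (hℓ : 0 < ℓ) (hk : n = 2 * k)
    {L : Submodule ℤ (Euc n)} [DiscreteTopology L] [IsZLattice ℝ L]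
    (hL : IsEvenLattice L) (hm : IsModularLattice ℓ L)
    (hD : ∀ r : ℝ, 0 < r → (shell L (r ^ 2)).Nonempty → IsSphericalDesign 2 r (shell L (r ^ 2)))
    (C : Module.Basis (Fin e) ℂ (cuspForms ℓ k ((k : ℤ) + 4)))
    (hC : IsReducedRowEchelon (fun i => (C i : ℍ → ℂ))) {α : ℝ} (hα : 0 < α) (lam : Fin e → ℝ)
    {H : tracelessSymm n}
    (hH : ∀ i : Fin e, InEigenspace (shellBilin L (2 * ((i : ℕ) + 1))) (lam i) H)
    (G : tracelessSymm n) :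
    (hessianBilin α L G H : ℂ) =
      (1 / ((n : ℂ) * (n + 2)) *
          (∑' m : ℕ+, cuspTerm α L (fun i => (C i : ℍ → ℂ)) lam m) +
        1 / ((n : ℂ) * (n + 2)) * ((∑' m : ℕ+, thetaTerm α L m : ℝ) : ℂ)) *
        (((G : Matrix (Fin n) (Fin n) ℝ) * H).trace : ℂ) := by
  set T : ℝ := ((G : Matrix (Fin n) (Fin n) ℝ) * H).trace with hT
  have hn0 : (n : ℂ) ≠ 0 := Nat.cast_ne_zero.mpr hn.ne'
  have hn2 : (n : ℂ) + 2 ≠ 0 := by exact_mod_cast (Nat.succ_ne_zero (n + 1))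
  -- The polarized deviation. It inherits the cusp form relation, and at `m = i + 1` the eigenvector
  -- property of `H` evaluates it.
  set b : ℕ → ℝ := fun m => shellBilin L (2 * m) G H - 8 * (m : ℝ) ^ 2 * thetaCoeff L m *
    T / (n * (n + 2)) with hb
  have hrel : ∀ m, (b m : ℂ) = ∑ i : Fin e, qCoeff (C i) m * (b ((i : ℕ) + 1) : ℂ) := by
    intro m
    have h := fun K : tracelessSymm n =>
      shellDeviation_eq_sum hn hℓ hk hL hm hD C hC m K.2.1 K.2.2
    simp only [hb, hT]
    simp only [← shellDeviation_polar]
    push_cast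
    rw [← Submodule.coe_add, h, h, h, ← Finset.sum_sub_distrib, ← Finset.sum_sub_distrib,
      Finset.mul_sum]
    exact Finset.sum_congr rfl fun i _ => by ring
  have hbi : ∀ i : Fin e, b ((i : ℕ) + 1) = T / (n * (n + 2)) * (lam i * n * (n + 2) -
      8 * ((i : ℕ) + 1) ^ 2 * thetaCoeff L ((i : ℕ) + 1)) := by
    intro i
    have h := hH i G
    have hn0 : (n : ℝ) ≠ 0 := by positivity
    have hn2 : (n : ℝ) + 2 ≠ 0 := by positivity
    simp only [hb]
    push_cast
    rw [h, ← hT]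
    field_simp
  have hcusp : ∀ m : ℕ, (α ^ 2 / 2 * Real.exp (-2 * α * m) * b m : ℂ) =
      T / (n * (n + 2)) * cuspTerm α L (fun i => (C i : ℍ → ℂ)) lam m := by
    intro m
    rw [hrel, cuspTerm, Finset.mul_sum, Finset.sum_mul, Finset.mul_sum]
    refine Finset.sum_congr rfl fun i _ => ?_
    rw [hbi]
    push_cast
    ring
  have hsum : HasSum (fun m : ℕ => α ^ 2 / 2 * Real.exp (-2 * α * m) * b m +
      T / (n * (n + 2)) * thetaTerm α L m) (hessianBilin α L G H) := by
    have h := fun K => hasSum_hessian_shell hn hα hL hD K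
    have h2 := (((h (G + H)).sub (h G)).sub (h H)).mul_left (1 / 2)
    refine h2.congr_fun fun m => ?_
    simp only [hb, hT]
    rw [← shellDeviation_polar]
    have h1 : (((G + H : tracelessSymm n) : Matrix (Fin n) (Fin n) ℝ) ^ 2).trace =
        ((G : Matrix (Fin n) (Fin n) ℝ) ^ 2).trace + ((H : Matrix (Fin n) (Fin n) ℝ) ^ 2).trace +
          2 * ((G : Matrix (Fin n) (Fin n) ℝ) * H).trace := by
      rw [Submodule.coe_add, sq, sq, sq, add_mul, mul_add, mul_add, Matrix.trace_add,
        Matrix.trace_add, Matrix.trace_add, Matrix.trace_mul_comm (H : Matrix (Fin n) (Fin n) ℝ) G]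
      ring
    rw [h1]
    ring
  -- Summation over shells starts at `m = 0`, the eigenvalue formula at `m = 1`; the extra term
  -- vanishes.
  have hb0 : b 0 = 0 := by
    have : ∀ x ∈ shell L (2 * ((0 : ℕ) : ℝ)), matQuad (G : Matrix (Fin n) (Fin n) ℝ) x *
        matQuad (H : Matrix (Fin n) (Fin n) ℝ) x = 0 := by
      intro x hx
      have h := hx.2
      simp only [Nat.cast_zero, mul_zero, ne_eq, OfNat.ofNat_ne_zero, not_false_eq_true,
        pow_eq_zero_iff, norm_eq_zero] at h
      rw [h, matQuad_zero_right, zero_mul]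
    simp only [hb]
    rw [shellBilin, finsum_mem_congr rfl this]
    simp
  have hsum' : HasSum (fun m : ℕ+ => α ^ 2 / 2 * Real.exp (-2 * α * (m : ℕ)) * b m +
      T / (n * (n + 2)) * thetaTerm α L m) (hessianBilin α L G H) := by
    refine (PNat.coe_injective.hasSum_iff fun m hm => ?_).mpr hsum
    have : m = 0 := by
      by_contra h0
      exact hm ⟨⟨m, Nat.pos_of_ne_zero h0⟩, rfl⟩
    rw [this, hb0]
    simp [thetaTerm]
  have hc := Complex.hasSum_ofReal.mpr hsum'
  have hS1 : Summable fun m : ℕ+ => cuspTerm α L (fun i => (C i : ℍ → ℂ)) lam m :=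
    (summable_cuspTerm hα L (fun i => C i) lam).comp_injective PNat.coe_injective
  have hS2 : Summable fun m : ℕ+ => thetaTerm α L m :=
    (summable_thetaTerm hα hL).comp_injective PNat.coe_injective
  have h3 := (hS1.hasSum.mul_left ((T : ℂ) / (n * (n + 2)))).add
    ((Complex.hasSum_ofReal.mpr hS2.hasSum).mul_left ((T : ℂ) / (n * (n + 2))))
  have h4 := h3.unique (hc.congr_fun fun m => ?_)
  · rw [← h4]
    ring
  · push_cast
    rw [← hcusp]
    push_cast
    ring

/-- For symmetric `H` this trace is the sum of the squares of the entries. -/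
lemma trace_mul_self_ne_zero {H : tracelessSymm n} (hH : H ≠ 0) :
    ((H : Matrix (Fin n) (Fin n) ℝ) * H).trace ≠ 0 := by
  intro h
  apply hH
  have hs : (H : Matrix (Fin n) (Fin n) ℝ).conjTranspose = H := by
    rw [Matrix.conjTranspose_eq_transpose_of_trivial]
    exact H.2.1
  have h2 : ((H : Matrix (Fin n) (Fin n) ℝ).conjTranspose * H).trace = 0 := by rw [hs, h]
  exact Subtype.ext (Matrix.trace_conjTranspose_mul_self_eq_zero_iff.mp h2)

/-- If the forms in subspaces which span the traceless symmetric matrices are eigenvectors of a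
symmetric `B`, every eigenvalue of `B` occurs on one of the subspaces. -/
lemma isEigenvalue_iff {s : ℕ} {B : tracelessSymm n → tracelessSymm n → ℝ}
    (hB : ∀ G H, B G H = B H G) {E : Fin s → Submodule ℝ (tracelessSymm n)} (hE : iSup E = ⊤)
    (hE0 : ∀ j, E j ≠ ⊥) {μ : Fin s → ℝ} (hμ : ∀ j, ∀ H ∈ E j, InEigenspace B (μ j) H) :
    {x : ℝ | IsEigenvalue B x} = Set.range μ := by
  ext x
  constructor
  · rintro ⟨H, hH0, hH⟩
    by_contra hx
    refine trace_mul_self_ne_zero hH0 ?_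
    let φ : tracelessSymm n →ₗ[ℝ] ℝ :=
      { toFun := fun G => ((G : Matrix (Fin n) (Fin n) ℝ) * H).trace
        map_add' := fun G K => by rw [Submodule.coe_add, add_mul, Matrix.trace_add]
        map_smul' := fun c G => by
          rw [Submodule.coe_smul, Matrix.smul_mul, Matrix.trace_smul]
          rfl }
    -- Eigenvectors of a symmetric form for different eigenvalues are orthogonal. If `x` is none of
    -- the `μ j`, then `H` is orthogonal to every `E j`, hence to itself.
    have hker : iSup E ≤ LinearMap.ker φ := by
      refine iSup_le fun j G hG => ?_
      have h1 := hμ j G hG H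
      rw [hB, hH G, Matrix.trace_mul_comm (H : Matrix (Fin n) (Fin n) ℝ)] at h1
      have h2 : (x - μ j) * φ G = 0 := by
        rw [sub_mul, sub_eq_zero]
        exact h1
      exact (mul_eq_zero.mp h2).resolve_left fun h => hx ⟨j, (sub_eq_zero.mp h).symm⟩
    rw [hE] at hker
    exact hker (Submodule.mem_top (x := H))
  · rintro ⟨j, rfl⟩
    obtain ⟨H, hH, hH0⟩ := Submodule.exists_mem_ne_zero_of_ne_bot (hE0 j)
    exact ⟨H, hH0, hμ j H hH⟩

end Eigen
end ModularLattice
end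

/-! ### The main theorem. -/

theorem theorem3p2 (n k ℓ e s : ℕ) (hn : 0 < n) (hk : n = 2 * k) (hℓ : 0 < ℓ)
    (L : Submodule ℤ (ModularLattice.Euc n)) [DiscreteTopology L] [IsZLattice ℝ L]
    (hL_even : ModularLattice.IsEvenLattice L)
    (hL_mod : ModularLattice.IsModularLattice ℓ L)
    (hL_design : ∀ r : ℝ, 0 < r → (ModularLattice.shell L (r ^ 2)).Nonempty →
      ModularLattice.IsSphericalDesign 2 r (ModularLattice.shell L (r ^ 2)))
    (C : Module.Basis (Fin e) ℂ (ModularLattice.cuspForms ℓ k ((k : ℤ) + 4)))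
    (hC : ModularLattice.IsReducedRowEchelon (fun i => (C i : ℍ → ℂ)))
    (E : Fin s → Submodule ℝ (ModularLattice.tracelessSymm n)) (lam : Fin e → Fin s → ℝ)
    (hE : ModularLattice.IsSimultaneousDiagonalization L E lam)
    (α : ℝ) (hα : 0 < α) :
    -- the Hessian, given by its series
    (∀ H : ModularLattice.tracelessSymm n,
      HasSum (fun x : {x : ModularLattice.Euc n // x ∈ L ∧ x ≠ 0} =>
        α * (Real.exp (-α * ‖(x : ModularLattice.Euc n)‖ ^ 2) *
          (α / 2 * ModularLattice.matQuad (H : Matrix (Fin n) (Fin n) ℝ) x ^ 2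
            - 1 / 2 * ModularLattice.matQuad ((H : Matrix (Fin n) (Fin n) ℝ) ^ 2) x)))
        (ModularLattice.hessian α L H)) ∧
    -- its eigenvalues `μ_1, …, μ_s`
    ∃ μ : Fin s → ℝ,
      (∀ j, Summable fun m : ℕ+ =>
        ModularLattice.cuspTerm α L (fun i => (C i : ℍ → ℂ)) (fun i => lam i j) m) ∧
      (Summable fun m : ℕ+ => ModularLattice.thetaTerm α L m) ∧
      (∀ j, (μ j : ℂ) =
        1 / ((n : ℂ) * (n + 2)) *
          (∑' m : ℕ+, ModularLattice.cuspTerm α L (fun i => (C i : ℍ → ℂ)) (fun i => lam i j) m) +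
        1 / ((n : ℂ) * (n + 2)) *
          ((∑' m : ℕ+, ModularLattice.thetaTerm α L m : ℝ) : ℂ)) ∧
      (∀ j, ∀ H ∈ E j, ModularLattice.InEigenspace (ModularLattice.hessianBilin α L) (μ j) H) ∧
      {x : ℝ | ModularLattice.IsEigenvalue (ModularLattice.hessianBilin α L) x} = Set.range μ := by
  have hcast := fun j (H : ModularLattice.tracelessSymm n) (hH : H ∈ E j) =>
    ModularLattice.hessianBilin_eq hn hℓ hk hL_even hL_mod hL_design C hC hα (fun i => lam i j)
      ((hE.mem_iff j H).mp hH)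
  refine ⟨fun H => ModularLattice.hasSum_hessian hα L H, ?_⟩
  -- The series has coefficients that are a priori complex. Its value is real, being the Rayleigh
  -- quotient of the Hessian at any nonzero element of `E j`.
  have key : ∀ j, ∃ μ : ℝ, (μ : ℂ) =
      1 / ((n : ℂ) * (n + 2)) *
        (∑' m : ℕ+, ModularLattice.cuspTerm α L (fun i => (C i : ℍ → ℂ)) (fun i => lam i j) m) +
      1 / ((n : ℂ) * (n + 2)) *
        ((∑' m : ℕ+, ModularLattice.thetaTerm α L m : ℝ) : ℂ) := by
    intro j
    obtain ⟨H, hH, hH0⟩ := Submodule.exists_mem_ne_zero_of_ne_bot (hE.ne_bot j)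
    have h := hcast j H hH H
    have hT := ModularLattice.trace_mul_self_ne_zero hH0
    refine ⟨ModularLattice.hessianBilin α L H H /
      ((H : Matrix (Fin n) (Fin n) ℝ) * H).trace, ?_⟩
    rw [Complex.ofReal_div, h, mul_div_cancel_right₀]
    exact_mod_cast hT
  choose μ hμ using key
  have hμ' : ∀ j, ∀ H ∈ E j,
      ModularLattice.InEigenspace (ModularLattice.hessianBilin α L) (μ j) H := by
    intro j H hH G
    have h := hcast j H hH G
    rw [← hμ j] at h
    exact_mod_cast h
  refine ⟨μ, fun j => ?_, ?_, hμ, hμ', ?_⟩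
  · exact (ModularLattice.summable_cuspTerm hα L (fun i => C i) fun i => lam i j).comp_injective
      PNat.coe_injective
  · exact (ModularLattice.summable_thetaTerm hα hL_even).comp_injective PNat.coe_injective
  · exact ModularLattice.isEigenvalue_iff
      (fun G H => by
        rw [ModularLattice.hessianBilin, ModularLattice.hessianBilin, QuadraticMap.polar_comm])
      hE.isInternal.submodule_iSup_eq_top hE.ne_bot hμ'
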